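/- **Notation.** Let $d\ge 1$, $r\ge 2$, $m\ge 1$ be integers. A dilation matrix is a $d\times d$ integer matrix $M$ all of whose eigenvalues have modulus greater than one. For a finitely supported filter $u:\mathbb Z^d\to\mathbb C^{s\times r}$ put $\hat u(\xi)=\sum_k u(k)e^{-ik\cdot\xi}$ and $u^\star(k)=\overline{u(-k)}^T$; for $f\in L_1(\mathbb R^d)$ put $\hat f(\xi)=\int f(x)e^{-ix\cdot\xi}dx$ (entrywise for vectors). Let $\Omega_M=(M^{-T}\mathbb Z^d)\cap[0,1)^d$, $\delta(0)=1$ and $\delta(x)=0$ for $x\ne0$, $\langle f,g\rangle=\int f\bar g$, and $\psi_{\ell,M^j;k}=|\det M|^{j/2}\psi_\ell(M^j\cdot-k)$. - A filter $a$ with values in $\mathbb C^{r\times r}$ has *order $m$ sum rules* with a finitely supported matching filter $\upsilon:\mathbb Z^d\to\mathbb C^{1\times r}$ if $\hat\upsilon(0)\neq0$ and $\hat\upsilon(M^T\xi)\hat a(\xi+2\pi\omega)=\delta(\omega)\hat\upsilon(\xi)+O(\|\xi\|^m)$ as $\xi\to0$ for all $\omega\in\Omega_M$. - $\psi$ has *order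 $m$ vanishing moments* if $\langle p,\psi_\ell\rangle=0$ for all $\ell$ and all polynomials $p$ of degree less than $m$. - For $\epsilon_\ell\in\{\pm1\}$, $\{\mathring\phi;\psi\}_{(\epsilon_1,\dots,\epsilon_s)}$ with $\mathring\phi\in(L_2(\mathbb R^d))^r$, $\psi\in(L_2(\mathbb R^d))^s$ is a *quasi-tight $M$-framelet* if there are $0<C_1,C_2<\infty$ such that, for all $f\in L_2(\mathbb R^d)$, $$C_1\|f\|^2\le\sum_{\ell,k}|\langle f,\mathring\phi_\ell(\cdot-k)\rangle|^2+\sum_{j\ge0}\sum_{\ell,k}|\langle f,\psi_{\ell,M^j;k}\rangle|^2\le C_2\|f\|^2$$ and, with unconditional convergence in $L_2(\mathbb R^d)$, $$f=\sum_{\ell,k}\langle f,\mathring\phi_\ell(\cdot-k)\rangle\mathring\phi_\ell(\cdot-k)+\sum_{j\ge0}\sum_{\ell,k}\epsilon_\ell\langle f,\psi_{\ell,M^j;k}\rangle\psi_{\ell,M^j;k}.$$ - For finitely supported $a,b,\Theta$, $\{a;b\}_{\Theta,(\epsilon_1,\dots,\epsilon_s)}$ is a *quasi-tight $M$-framelet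 filter bank* if for all $\omega\in\Omega_M$ and $\xi\in\mathbb R^d$ $$\overline{\hat a(\xi)}^T\hat\Theta(M^T\xi)\hat a(\xi+2\pi\omega)+\overline{\hat b(\xi)}^T\mathrm{diag}(\epsilon_1,\dots,\epsilon_s)\hat b(\xi+2\pi\omega)=\delta(\omega)\hat\Theta(\xi).$$ - For sequences $v$ of row vectors let $[v*u](n)=\sum_kv(k)u(n-k)$, $\mathcal T_{u}v=|\det M|^{1/2}[v*u^\star](M\cdot)$ and $\mathcal S_{u}v=|\det M|^{1/2}[v\uparrow M]*u$, where $[v\uparrow M](Mk)=v(k)$ and $v\uparrow M$ vanishes off $M\mathbb Z^d$. - For an integer matrix $N$ with $|\det N|=r$ and an enumeration $\kappa_1,\dots,\kappa_r$ of representatives of $\mathbb Z^d/N\mathbb Z^d$ let $[E_Nv](k)=(v(Nk+\kappa_1),\dots,v(Nk+\kappa_r))$. Let $\mathbb P_{m-1}$ be the polynomial sequences on $\mathbb Z^d$ of degree less than $m$. A filter $b$ has *order $m$ $E_N$-balanced vanishing moments* if $\mathcal T_bE_N(p)=0$ for all $p\in\mathbb P_{m-1}$; $\{a;b\}$ is *order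 $m$ $E_N$-balanced* if moreover $\mathcal T_aE_N(p)\in E_N(\mathbb P_{m-1})$ for all $p\in\mathbb P_{m-1}$. **Theorem.** Let $M$ be a $d\times d$ dilation matrix and let $\phi\in(L_2(\mathbb R^d))^r$ be a vector of compactly supported functions with $\hat\phi(M^T\xi)=\hat a(\xi)\hat\phi(\xi)$ for all $\xi$, $\hat\phi(0)\ne0$, for a finitely supported filter $a:\mathbb Z^d\to\mathbb C^{r\times r}$. Suppose that $a$ has order $m$ sum rules with a matching filter $\upsilon$ such that $\hat\upsilon(0)\hat\phi(0)=1$. Let $N$ be a $d\times d$ integer matrix with $|\det N|=r$, and $\kappa_1,\dots,\kappa_r$ representatives of $\mathbb Z^d/N\mathbb Z^d$. Then there exist $s$, finitely supported filters $b:\mathbb Z^d\to\mathbb C^{s\times r}$ and $\theta:\mathbb Z^d\to\mathbb C^{r\times r}$, and $\epsilon_1,\dots,\epsilon_s\in\{\pm1\}$ such that, with $$\hat{\mathring\phi}(\xi)=\hat\theta(\xi)\hat\phi(\xi),\quad\hat\psi(\xi)=\hat b(M^{-T}\xi)\hat\phi(M^{-T}\xi),\quad\hat\Theta(\xi)=\overline{\hat\theta(\xi)}^T\hat\theta(\xi),$$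 $$\hat{\mathring a}(\xi)=\hat\theta(M^T\xi)\hat a(\xi)\hat\theta(\xi)^{-1},\quad\hat{\mathring b}(\xi)=\hat b(\xi)\hat\theta(\xi)^{-1},$$ the following hold. 1. $\overline{\hat\phi(0)}^T\hat\Theta(0)\hat\phi(0)=1$; $\{\mathring\phi;\psi\}_{(\epsilon_1,\dots,\epsilon_s)}$ is a compactly supported quasi-tight $M$-framelet in $L_2(\mathbb R^d)$; $\psi$ has order $m$ vanishing moments; and $\hat{\mathring\phi}(M^T\xi)=\hat{\mathring a}(\xi)\hat{\mathring\phi}(\xi)$, $\hat\psi(M^T\xi)=\hat{\mathring b}(\xi)\hat{\mathring\phi}(\xi)$ for all $\xi$. 2. $\theta$ is strongly invertible: $\hat\theta^{-1}$ is also the symbol of a finitely supported filter. 3. $\{a;b\}_{\Theta,(\epsilon_1,\dots,\epsilon_s)}$ and $\{\mathring a;\mathring b\}_{\delta I_r,(\epsilon_1,\dots,\epsilon_s)}$ are quasi-tight $M$-framelet filter banks with finitely supported filters. 4. The discrete multiframelet transform employing $\{\mathring a;\mathring b\}_{\delta I_r,(\epsilon_1,\dots,\epsilon_s)}$ is compact: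 for every number $J$ of levels, the decomposition $v_j=\mathcal T_{\mathring a}v_{j-1}$, $w_j=\mathcal T_{\mathring b}v_{j-1}$ ($1\le j\le J$) followed by the reconstruction $\tilde v_J=v_J$, $\tilde v_{j-1}=\mathcal S_{\mathring a}\tilde v_j+\mathcal S_{\mathrm{diag}(\epsilon)\mathring b}w_j$ uses only the finitely supported filters $\mathring a,\mathring b$ and gives $\tilde v_0=v_0$ for every $v_0:\mathbb Z^d\to\mathbb C^{1\times r}$. Moreover $\{\mathring a;\mathring b\}$ is order $m$ $E_N$-balanced. If $m$ is the largest order of sum rules of $a$ (over all matching filters), then $m$ is also the largest order of vanishing moments of $\psi$, of $E_N$-balanced vanishing moments of $\mathring b$, and of $E_N$-balancing of $\{\mathring a;\mathring b\}$. -/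

import Mathlib

open MeasureTheory Filter Topology Asymptotics Matrix Complex
open scoped ComplexConjugate ENNReal NNReal

namespace QuasiTight

noncomputable section

/-! ### Filters, symbols and matrices -/

/-- Finitely supported sequences on `ℤ^d` of complex `s × r` matrices. -/
abbrev Mask (d s r : ℕ) : Type := (Fin d → ℤ) →₀ Matrix (Fin s) (Fin r) ℂ

/-- An integer matrix, regarded as a real matrix. -/
def realMat {d : ℕ} (M : Matrix (Fin d) (Fin d) ℤ) : Matrix (Fin d) (Fin d) ℝ :=
  M.map (Int.cast : ℤ → ℝ)

/-- An integer vector, regarded as a real vector. -/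
def realVec {d : ℕ} (k : Fin d → ℤ) : Fin d → ℝ := fun i => (k i : ℝ)

/-- A dilation matrix: every (complex) eigenvalue has modulus greater than one. -/
def IsDilation {d : ℕ} (M : Matrix (Fin d) (Fin d) ℤ) : Prop :=
  ∀ z ∈ spectrum ℂ (M.map (Int.cast : ℤ → ℂ)), 1 < ‖z‖

/-- The symbol `û(ξ) = ∑ₖ u(k) e^{-i k·ξ}`. -/
def symb {d s r : ℕ} (u : Mask d s r) (ξ : Fin d → ℝ) : Matrix (Fin s) (Fin r) ℂ :=
  u.sum fun k A => cexp (-(I * ((realVec k ⬝ᵥ ξ : ℝ) : ℂ))) • A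

/-- The representatives `(M^{-T} ℤ^d) ∩ [0,1)^d` of the cosets of `M^{-T} ℤ^d` modulo `ℤ^d`. -/
def Omega {d : ℕ} (M : Matrix (Fin d) (Fin d) ℤ) : Set (Fin d → ℝ) :=
  {ω | (∃ k : Fin d → ℤ, ω = ((realMat M)ᵀ)⁻¹ *ᵥ realVec k) ∧ ∀ i, 0 ≤ ω i ∧ ω i < 1}

/-- `θ` is strongly invertible: the inverse of its symbol is again the symbol of a finitely
supported filter. -/
def StronglyInvertible {d r : ℕ} (θ : Mask d r r) : Prop :=
  ∃ θ' : Mask d r r, ∀ ξ, symb θ ξ * symb θ' ξ = 1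

open scoped Classical in
/-- `a` has order `m` sum rules with respect to `M` with the matching filter `υ`:
`υ̂(0) ≠ 0` and `υ̂(Mᵀξ) â(ξ+2πω) = δ(ω) υ̂(ξ) + O(‖ξ‖^m)` as `ξ → 0`, for all `ω ∈ Omega M`.
All functions here are trigonometric polynomials, for which `O(‖ξ‖^m)` at the origin says that all
partial derivatives of order less than `m` vanish at the origin. -/
def HasSumRules {d r : ℕ} (M : Matrix (Fin d) (Fin d) ℤ) (a : Mask d r r) (υ : Mask d 1 r)
    (m : ℕ) : Prop :=
  symb υ 0 ≠ 0 ∧ ∀ ω ∈ Omega M, ∀ j : Fin r,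
    (fun ξ : Fin d → ℝ =>
      (symb υ ((realMat M)ᵀ *ᵥ ξ) * symb a (ξ + (2 * Real.pi) • ω)) 0 j
        - (if ω = 0 then symb υ ξ 0 j else 0))
      =O[𝓝 0] fun ξ => ‖ξ‖ ^ m

open scoped Classical in
/-- `{a; b}_{Θ, ε}` is an (OEP-based) quasi-tight `M`-framelet filter bank, where `Θ` is given by
its symbol: for all `ω ∈ Omega M` and all `ξ`, `â(ξ)ᴴ Θ̂(Mᵀξ) â(ξ+2πω) + b̂(ξ)ᴴ diag(ε) b̂(ξ+2πω)`
equals `δ(ω) Θ̂(ξ)`. -/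
def IsQuasiTightFilterBank {d r s : ℕ} (M : Matrix (Fin d) (Fin d) ℤ) (a : Mask d r r)
    (b : Mask d s r) (Θ : (Fin d → ℝ) → Matrix (Fin r) (Fin r) ℂ) (ε : Fin s → ℂ) : Prop :=
  ∀ ω ∈ Omega M, ∀ ξ : Fin d → ℝ,
    (symb a ξ)ᴴ * Θ ((realMat M)ᵀ *ᵥ ξ) * symb a (ξ + (2 * Real.pi) • ω)
      + (symb b ξ)ᴴ * Matrix.diagonal ε * symb b (ξ + (2 * Real.pi) • ω)
      = if ω = 0 then Θ ξ else 0

/-! ### Functions on `ℝ^d`, vanishing moments and framelets -/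

/-- A vector of compactly supported functions in `L²(ℝ^d)`. -/
def IsCompactL2 {d r : ℕ} (f : Fin r → (Fin d → ℝ) → ℂ) : Prop :=
  ∀ l, MemLp (f l) 2 volume ∧ HasCompactSupport (f l)

/-- The entrywise Fourier transform `f̂(ξ) = ∫ f(x) e^{-i x·ξ} dx` of a vector function. -/
def fourierVec {d r : ℕ} (f : Fin r → (Fin d → ℝ) → ℂ) (ξ : Fin d → ℝ) : Fin r → ℂ :=
  fun l => ∫ x : Fin d → ℝ, f l x * cexp (-(I * ((x ⬝ᵥ ξ : ℝ) : ℂ)))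

/-- The inner product `∫ f(x) \overline{g(x)} dx`. -/
def innerL2 {d : ℕ} (f g : (Fin d → ℝ) → ℂ) : ℂ := ∫ x, f x * conj (g x)

/-- All entries of `ψ` have order `m` vanishing moments: they are orthogonal to all polynomials of
(total) degree less than `m`. -/
def HasVanishingMoments {d s : ℕ} (ψ : Fin s → (Fin d → ℝ) → ℂ) (m : ℕ) : Prop :=
  ∀ l, ∀ p : MvPolynomial (Fin d) ℂ, p.totalDegree < m →
    innerL2 (fun x => MvPolynomial.eval (fun i => (x i : ℂ)) p) (ψ l) = 0

/-- Indices of the system generated by `{φ; ψ}`: pairs `(l, k)` for the integer shifts of `φ`, and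
triples `(j, l, k)` for the dilates and shifts of `ψ`. -/
abbrev SystemIndex (d r s : ℕ) : Type :=
  (Fin r × (Fin d → ℤ)) ⊕ (ℕ × Fin s × (Fin d → ℤ))

/-- The functions `φ_l(x - k)` and `|det M|^{j/2} ψ_l(M^j x - k)`, `j ≥ 0`. -/
def system {d r s : ℕ} (M : Matrix (Fin d) (Fin d) ℤ) (φ : Fin r → (Fin d → ℝ) → ℂ)
    (ψ : Fin s → (Fin d → ℝ) → ℂ) : SystemIndex d r s → (Fin d → ℝ) → ℂ
  | .inl (l, k) => fun x => φ l (x - realVec k)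
  | .inr (j, l, k) => fun x =>
      ((Real.sqrt |(realMat M).det| ^ j : ℝ) : ℂ) * ψ l ((realMat M ^ j) *ᵥ x - realVec k)

/-- `{φ; ψ}` is an `M`-framelet in `L²(ℝ^d)`. -/
def IsFramelet {d r s : ℕ} (M : Matrix (Fin d) (Fin d) ℤ) (φ : Fin r → (Fin d → ℝ) → ℂ)
    (ψ : Fin s → (Fin d → ℝ) → ℂ) : Prop :=
  (∀ l, MemLp (φ l) 2 volume) ∧ (∀ l, MemLp (ψ l) 2 volume) ∧
  ∃ C₁ C₂ : ℝ≥0, 0 < C₁ ∧ 0 < C₂ ∧ ∀ f : (Fin d → ℝ) → ℂ, MemLp f 2 volume →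
    (C₁ : ℝ≥0∞) * eLpNorm f 2 volume ^ 2 ≤ ∑' i, ‖innerL2 f (system M φ ψ i)‖ₑ ^ 2 ∧
    ∑' i, ‖innerL2 f (system M φ ψ i)‖ₑ ^ 2 ≤ (C₂ : ℝ≥0∞) * eLpNorm f 2 volume ^ 2

/-- The sign attached to an index of the system: `1` for shifts of `φ`, and `ε_l` for `ψ_l`. -/
def systemSign {d r s : ℕ} (ε : Fin s → ℂ) : SystemIndex d r s → ℂ
  | .inl _ => 1
  | .inr (_, l, _) => ε l

/-- `{φ; ψ}_ε` is a quasi-tight `M`-framelet in `L²(ℝ^d)`: it is an `M`-framelet, and every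
`f ∈ L²(ℝ^d)` is the unconditional `L²`-limit of its signed framelet series (the net of all finite
partial sums of the series converges to `f` in `L²`). -/
def IsQuasiTightFramelet {d r s : ℕ} (M : Matrix (Fin d) (Fin d) ℤ)
    (φ : Fin r → (Fin d → ℝ) → ℂ) (ψ : Fin s → (Fin d → ℝ) → ℂ) (ε : Fin s → ℂ) : Prop :=
  IsFramelet M φ ψ ∧ ∀ f : (Fin d → ℝ) → ℂ, MemLp f 2 volume →
    Tendsto (fun S : Finset (SystemIndex d r s) =>
      eLpNorm (fun x => f x -
        ∑ i ∈ S, systemSign ε i * innerL2 f (system M φ ψ i) * system M φ ψ i x) 2 volume)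
      atTop (𝓝 0)

/-! ### The discrete framelet transform and its balancing property -/

/-- Arbitrary sequences on `ℤ^d` of complex row vectors of length `r`. -/
abbrev RowSeq (d r : ℕ) : Type := (Fin d → ℤ) → Fin r → ℂ

/-- The convolution `[v * a](n) = ∑ₖ v(k) a(n-k) = ∑ⱼ v(n-j) a(j)`. -/
def conv {d s r : ℕ} (v : RowSeq d s) (a : Mask d s r) : RowSeq d r :=
  fun n => a.sum fun j A => v (n - j) ᵥ* A

/-- The filter `a⋆(k) = a(-k)ᴴ`. -/
def adjointMask {d s r : ℕ} (a : Mask d s r) : Mask d r s :=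
  (a.mapRange Matrix.conjTranspose (Matrix.conjTranspose_zero)).equivMapDomain
    (Equiv.neg (Fin d → ℤ))

/-- The filter `diag(ε) b`. -/
def signedMask {d s r : ℕ} (ε : Fin s → ℂ) (b : Mask d s r) : Mask d s r :=
  b.mapRange (fun A => Matrix.diagonal ε * A) (Matrix.mul_zero _)

/-- The transition operator `T_{a,M} v = |det M|^{1/2} [v * a⋆](M ·)`. -/
def transition {d s r : ℕ} (M : Matrix (Fin d) (Fin d) ℤ) (a : Mask d s r) (v : RowSeq d r) :
    RowSeq d s :=
  fun n => ((Real.sqrt |(realMat M).det| : ℝ) : ℂ) • conv v (adjointMask a) (M *ᵥ n)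

/-- The upsampled sequence `v ↑ M`: its value at `M l` is `v l`, and it vanishes off `M ℤ^d`. -/
def upsample {d r : ℕ} (M : Matrix (Fin d) (Fin d) ℤ) (v : RowSeq d r) : RowSeq d r :=
  Function.extend (fun l : Fin d → ℤ => M *ᵥ l) v 0

/-- The subdivision operator `S_{a,M} v = |det M|^{1/2} [v ↑ M] * a`. -/
def subdivision {d s r : ℕ} (M : Matrix (Fin d) (Fin d) ℤ) (a : Mask d s r) (v : RowSeq d s) :
    RowSeq d r :=
  fun n => ((Real.sqrt |(realMat M).det| : ℝ) : ℂ) • conv (upsample M v) a n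

/-- Decomposition: the low-pass coefficients `v_j = T_{a,M} v_{j-1}`, with `v_0 = v`. -/
def lowPass {d r : ℕ} (M : Matrix (Fin d) (Fin d) ℤ) (a : Mask d r r) (v : RowSeq d r) :
    ℕ → RowSeq d r
  | 0 => v
  | j + 1 => transition M a (lowPass M a v j)

/-- Decomposition: the high-pass coefficients at level `j + 1`, i.e. `w_{j+1} = T_{b,M} v_j`. -/
def highPass {d r s : ℕ} (M : Matrix (Fin d) (Fin d) ℤ) (a : Mask d r r) (b : Mask d s r)
    (v : RowSeq d r) (j : ℕ) : RowSeq d s :=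
  transition M b (lowPass M a v j)

/-- Reconstruction: starting with `u = v_J`, compute `v_{j-1} = S_{a,M} v_j + S_{b,M} w_j` for
`j = J, …, 1`, and return `v_0`; here `w j` holds the high-pass coefficients at level `j + 1`. -/
def reconstruct {d r s : ℕ} (M : Matrix (Fin d) (Fin d) ℤ) (a : Mask d r r) (b : Mask d s r)
    (w : ℕ → RowSeq d s) : ℕ → RowSeq d r → RowSeq d r
  | 0, u => u
  | J + 1, u => reconstruct M a b w J (subdivision M a u + subdivision M b (w J))

/-- The discrete framelet transform employing `{a; b}_{δ I_r, ε}` is compact: at every number `J` of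
levels, convolutions with the finitely supported filters `a`, `b` (decomposition) and `a`,
`diag(ε) b` (reconstruction), with no deconvolution step, recover every input sequence. -/
def IsCompactTransform {d r s : ℕ} (M : Matrix (Fin d) (Fin d) ℤ) (a : Mask d r r)
    (b : Mask d s r) (ε : Fin s → ℂ) : Prop :=
  ∀ (J : ℕ) (v : RowSeq d r),
    reconstruct M a (signedMask ε b) (highPass M a b v) J (lowPass M a v J) = v

/-- `κ` enumerates a complete set of representatives of `ℤ^d / N ℤ^d`, that is, `ℤ^d` is the
disjoint union of the sets `κ_i + N ℤ^d`. -/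
def IsCosetReps {d r : ℕ} (N : Matrix (Fin d) (Fin d) ℤ) (κ : Fin r → Fin d → ℤ) : Prop :=
  ∀ n : Fin d → ℤ, ∃! i : Fin r, ∃ k : Fin d → ℤ, n = κ i + N *ᵥ k

/-- The vector conversion operator `[E_N v](k) = (v(N k + κ_1), …, v(N k + κ_r))`. -/
def vecConv {d r : ℕ} (N : Matrix (Fin d) (Fin d) ℤ) (κ : Fin r → Fin d → ℤ)
    (v : (Fin d → ℤ) → ℂ) : RowSeq d r :=
  fun k i => v (N *ᵥ k + κ i)

/-- Polynomial sequences on `ℤ^d` of (total) degree less than `m`. -/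
def PolySeq (d m : ℕ) : Set ((Fin d → ℤ) → ℂ) :=
  {v | ∃ p : MvPolynomial (Fin d) ℂ, p.totalDegree < m ∧
    ∀ k, v k = MvPolynomial.eval (fun i => (k i : ℂ)) p}

/-- `b` has order `m` `E_N`-balanced vanishing moments. -/
def HasBalancedVanishingMoments {d r s : ℕ} (M N : Matrix (Fin d) (Fin d) ℤ)
    (κ : Fin r → Fin d → ℤ) (b : Mask d s r) (m : ℕ) : Prop :=
  ∀ p ∈ PolySeq d m, transition M b (vecConv N κ p) = 0

/-- `{a; b}` is order `m` `E_N`-balanced: the transition operator of `a` maps `E_N` of the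
polynomial sequences of degree less than `m` into itself, and that of `b` annihilates it. -/
def IsBalanced {d r s : ℕ} (M N : Matrix (Fin d) (Fin d) ℤ) (κ : Fin r → Fin d → ℤ)
    (a : Mask d r r) (b : Mask d s r) (m : ℕ) : Prop :=
  (∀ p ∈ PolySeq d m, ∃ q ∈ PolySeq d m, transition M a (vecConv N κ p) = vecConv N κ q) ∧
  HasBalancedVanishingMoments M N κ b m

end

end QuasiTight

open QuasiTight

/-!
The refinable vector `φ` is replaced by `θφ` for a strongly invertible filter `θ` that puts all the
data into the best possible position at the origin, and the high-pass filters are then read off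
from an explicit factorization. Everything happens modulo functions that vanish to a given order at
the origin (`Van`, `VanV`), where smooth functions may be replaced by trigonometric polynomials
(`Approx`).

*Position.* The vector `u(ξ)` with entries `r^{-1/2} e^{-i N⁻¹κ_j·ξ}` (`balVec`) is the one that
`E_N` attaches to exponentials: the transition operator acts on `E_N` of polynomials of degree less
than `n` through the jets of order `n` of `b̂ u` (`hasBalancedVanishingMoments_iff`,
`transition_balanced`). It is a unit vector. By the sum rules, `υ̂ φ̂` is invariant under `Mᵀ` to
order `m`, and hence is `1 + O(‖ξ‖^m)` because `M` is expanding (`van_sub_of_scaling`). For `r ≥ 2`,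
any column `F` and row `G` with `G F = 1 + O(‖ξ‖^m)` can be brought to the coordinate vector
`e_{i₀}` and its transpose, the column even to order `2m`, by a product of elementary matrices of
trigonometric polynomials (`exists_normal_form`). Applied to `(φ̂, υ̂)` and to `(u, uᴴ)`, this gives
`θ` with `θ̂ φ̂ = u + O(‖ξ‖^{2m})` and `υ̂ θ̂⁻¹ = uᴴ + O(‖ξ‖^m)` (`exists_balancing`).

*Factorization.* Let `å` be the filter of `θφ`. In coordinates where `u` is `e_{i₀}`, the `(i, j)`
entry of the kernel `δ(ω) I - å(ξ)ᴴ å(ξ + 2πω)` vanishes to order `m` at `ξ = 0` if `i = i₀`, to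
order `m` at `ξ + 2πω = 0` if `j = i₀`, and to order `2m` if `ω = 0` and `i = j = i₀`. Such a kernel
is a sum of products of trigonometric polynomials, one factor in `ξ` and one in `ξ + 2πω`, that
annihilate `u` to order `m`, and polarization turns it into a signed sum of squares. The squares are
the rows of `b̊`, and the signs are `ε` (`exists_factorization`). So `{å; b̊}` is a filter bank with
`b̊ u = O(‖ξ‖^m)`; that it recovers every sequence is its time-domain form, by orthogonality of the
characters of `ℤ^d / M ℤ^d` (`perfect_reconstruction`).

*From filter bank to framelet.* The filter bank identity makes the signed energies telescope: the
sum over the levels below `J` equals the energy of `f` in the level `J` shifts of `θφ`, which tends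
to `‖f‖²` for continuous `f` of compact support, as `θφ` has unit mass (`tendsto_level_energy`).
The Bessel bound at a fixed level comes from compact support (`level_bessel`). Across levels it
comes from the correlations of a function of mean zero with a refinable vector: they evolve by a
fixed linear map on a finite-dimensional space, and they tend to zero, hence do so geometrically
(`level_decay`, `wavelet_bessel`). The Bessel bound extends the reconstruction formula to all `f`,
and the lower frame bound follows from it (`isQuasiTightFramelet`).

*Maximality.* Orders of vanishing moments, of balanced vanishing moments, and of vanishing of
`b̊ u` agree up to `2m`. If `b̊ u = O(‖ξ‖^{m+1})`, multiplying the filter bank identity by `uᴴ`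
gives sum rules of order `m + 1` for `å`, and these are transported back to `a`
(`SumRules.of_filterBank`, `SumRules.conjugate`).
-/

namespace QuasiTight

/-! ### Trigonometric polynomials -/

/-- The character `ξ ↦ e^{-i k·ξ}`. -/
noncomputable def chr {d : ℕ} (k : Fin d → ℤ) (ξ : Fin d → ℝ) : ℂ :=
  cexp (-(I * ((realVec k ⬝ᵥ ξ : ℝ) : ℂ)))

section chr
variable {d : ℕ}

theorem realVec_add (k l : Fin d → ℤ) : realVec (k + l) = realVec k + realVec l := by
  ext i; simp [realVec]

theorem realVec_neg (k : Fin d → ℤ) : realVec (-k) = -realVec k := by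
  ext i; simp [realVec]

theorem realVec_sub (k l : Fin d → ℤ) : realVec (k - l) = realVec k - realVec l := by
  ext i; simp [realVec]

@[simp] theorem realVec_zero : realVec (0 : Fin d → ℤ) = 0 := by
  ext i; simp [realVec]

theorem realVec_injective : Function.Injective (realVec : (Fin d → ℤ) → Fin d → ℝ) := by
  intro k l h
  ext i
  have := congrFun h i
  simpa [realVec] using this

theorem realMat_mulVec (M : Matrix (Fin d) (Fin d) ℤ) (k : Fin d → ℤ) :
    realMat M *ᵥ realVec k = realVec (M *ᵥ k) := by
  ext i
  simp [realMat, realVec, mulVec, dotProduct]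

theorem realMat_transpose (M : Matrix (Fin d) (Fin d) ℤ) : (realMat M)ᵀ = realMat Mᵀ := by
  ext i j; simp [realMat]

theorem realMat_det (M : Matrix (Fin d) (Fin d) ℤ) : (realMat M).det = (M.det : ℝ) := by
  have := Int.cast_det (R := ℝ) M
  rw [this]; rfl

theorem chr_zero (ξ : Fin d → ℝ) : chr 0 ξ = 1 := by simp [chr]

theorem chr_zero_right (k : Fin d → ℤ) : chr k 0 = 1 := by simp [chr]

theorem chr_add (k l : Fin d → ℤ) (ξ : Fin d → ℝ) : chr (k + l) ξ = chr k ξ * chr l ξ := by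
  simp only [chr, realVec_add, add_dotProduct, ← Complex.exp_add]
  congr 1; push_cast; ring

theorem chr_add_right (k : Fin d → ℤ) (ξ η : Fin d → ℝ) :
    chr k (ξ + η) = chr k ξ * chr k η := by
  simp only [chr, dotProduct_add, ← Complex.exp_add]
  congr 1; push_cast; ring

theorem conj_chr (k : Fin d → ℤ) (ξ : Fin d → ℝ) : conj (chr k ξ) = chr (-k) ξ := by
  simp only [chr, realVec_neg, neg_dotProduct, ← Complex.exp_conj]
  congr 1; simp

theorem chr_neg_right (k : Fin d → ℤ) (ξ : Fin d → ℝ) : chr k (-ξ) = chr (-k) ξ := by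
  simp only [chr, realVec_neg, neg_dotProduct, dotProduct_neg]

theorem chr_neg_mul (k : Fin d → ℤ) (ξ : Fin d → ℝ) : chr (-k) ξ * chr k ξ = 1 := by
  rw [← chr_add, neg_add_cancel, chr_zero]

theorem chr_mulVec (M : Matrix (Fin d) (Fin d) ℤ) (k : Fin d → ℤ) (ξ : Fin d → ℝ) :
    chr k ((realMat M)ᵀ *ᵥ ξ) = chr (M *ᵥ k) ξ := by
  rw [chr, chr, ← realMat_mulVec, dotProduct_mulVec, vecMul_transpose]

theorem continuous_chr (k : Fin d → ℤ) : Continuous (chr k) := by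
  unfold chr; fun_prop

/-- Integer frequencies are periods: `e^{-i k·2πl} = 1`. -/
theorem chr_two_pi (k l : Fin d → ℤ) : chr k ((2 * Real.pi) • realVec l) = 1 := by
  rw [chr, Complex.exp_eq_one_iff]
  refine ⟨-(k ⬝ᵥ l), ?_⟩
  rw [dotProduct_smul]
  simp only [smul_eq_mul, realVec, dotProduct]
  push_cast
  ring

end chr

/-- The algebra of trigonometric polynomials on `ℝ^d`, as functions. -/
noncomputable def trig (d : ℕ) : Subalgebra ℂ ((Fin d → ℝ) → ℂ) :=
  (AddMonoidAlgebra.lift ℂ ((Fin d → ℝ) → ℂ) (Fin d → ℤ)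
    { toFun := fun k => chr k.toAdd
      map_one' := by ext ξ; exact chr_zero ξ
      map_mul' := fun k l => by ext ξ; exact chr_add _ _ ξ }).range

section trig
variable {d : ℕ}

theorem trig_iff {f : (Fin d → ℝ) → ℂ} :
    f ∈ trig d ↔ ∃ u : (Fin d → ℤ) →₀ ℂ, ∀ ξ, f ξ = u.sum fun k c => c * chr k ξ := by
  have key : ∀ (u : AddMonoidAlgebra ℂ (Fin d → ℤ)) (ξ : Fin d → ℝ),
      AddMonoidAlgebra.lift ℂ ((Fin d → ℝ) → ℂ) (Fin d → ℤ)
        { toFun := fun k => chr k.toAdd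
          map_one' := by ext ξ; exact chr_zero ξ
          map_mul' := fun k l => by ext ξ; exact chr_add _ _ ξ } u ξ
        = u.coeff.sum fun k c => c * chr k ξ := by
    intro u ξ
    rw [AddMonoidAlgebra.lift_apply]
    simp [Finsupp.sum]
  constructor
  · rintro ⟨u, rfl⟩
    exact ⟨u.coeff, fun ξ => key u ξ⟩
  · rintro ⟨u, hu⟩
    exact ⟨.ofCoeff u, funext fun ξ => (key _ ξ).trans (hu ξ).symm⟩

theorem chr_mem_trig (k : Fin d → ℤ) : chr k ∈ trig d :=
  trig_iff.2 ⟨Finsupp.single k 1, fun ξ => by simp⟩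

theorem const_mem_trig (c : ℂ) : (fun _ => c) ∈ trig d := (trig d).algebraMap_mem c

/-- Induction principle: trigonometric polynomials are the linear combinations of characters. -/
theorem trig_induction {P : ((Fin d → ℝ) → ℂ) → Prop} (h0 : P fun _ => 0)
    (hadd : ∀ f g, P f → P g → P fun ξ => f ξ + g ξ)
    (hchr : ∀ (c : ℂ) (k : Fin d → ℤ), P fun ξ => c * chr k ξ)
    {f : (Fin d → ℝ) → ℂ} (hf : f ∈ trig d) : P f := by
  obtain ⟨u, hu⟩ := trig_iff.1 hf
  rw [funext hu]
  clear hu hf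
  induction u using Finsupp.induction_linear with
  | zero => simpa using h0
  | add u v hu hv =>
    have : (fun ξ : Fin d → ℝ => (u + v).sum fun k c => c * chr k ξ)
        = fun ξ => (u.sum fun k c => c * chr k ξ) + v.sum fun k c => c * chr k ξ := by
      ext ξ
      exact Finsupp.sum_add_index' (by simp) (by intros; ring)
    rw [this]; exact hadd _ _ hu hv
  | single k c => simpa using hchr c k

theorem trig_add {f g : (Fin d → ℝ) → ℂ} (hf : f ∈ trig d) (hg : g ∈ trig d) :
    (fun ξ => f ξ + g ξ) ∈ trig d := (trig d).add_mem hf hg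

theorem trig_sub {f g : (Fin d → ℝ) → ℂ} (hf : f ∈ trig d) (hg : g ∈ trig d) :
    (fun ξ => f ξ - g ξ) ∈ trig d := (trig d).sub_mem hf hg

theorem trig_mul {f g : (Fin d → ℝ) → ℂ} (hf : f ∈ trig d) (hg : g ∈ trig d) :
    (fun ξ => f ξ * g ξ) ∈ trig d := (trig d).mul_mem hf hg

theorem trig_sum {ι : Type*} (s : Finset ι) {f : ι → (Fin d → ℝ) → ℂ}
    (hf : ∀ i ∈ s, f i ∈ trig d) : (fun ξ => ∑ i ∈ s, f i ξ) ∈ trig d := by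
  have := (trig d).sum_mem hf
  convert this using 1
  ext ξ; simp

theorem trig_conj {f : (Fin d → ℝ) → ℂ} (hf : f ∈ trig d) : (fun ξ => conj (f ξ)) ∈ trig d := by
  refine trig_induction (P := fun f => (fun ξ => conj (f ξ)) ∈ trig d) ?_ ?_ ?_ hf
  · simpa using const_mem_trig 0
  · intro f g hf hg; simpa using trig_add hf hg
  · intro c k
    simp only [map_mul, conj_chr]
    exact trig_mul (const_mem_trig _) (chr_mem_trig _)

theorem trig_translate {f : (Fin d → ℝ) → ℂ} (hf : f ∈ trig d) (η : Fin d → ℝ) :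
    (fun ξ => f (ξ + η)) ∈ trig d := by
  refine trig_induction (P := fun f => (fun ξ => f (ξ + η)) ∈ trig d) ?_ ?_ ?_ hf
  · exact const_mem_trig 0
  · intro f g hf hg; exact trig_add hf hg
  · intro c k
    simp only [chr_add_right]
    exact trig_mul (const_mem_trig _) (trig_mul (chr_mem_trig _) (const_mem_trig _))

theorem trig_dilate {f : (Fin d → ℝ) → ℂ} (hf : f ∈ trig d) (M : Matrix (Fin d) (Fin d) ℤ) :
    (fun ξ => f ((realMat M)ᵀ *ᵥ ξ)) ∈ trig d := by
  refine trig_induction (P := fun f => (fun ξ => f ((realMat M)ᵀ *ᵥ ξ)) ∈ trig d) ?_ ?_ ?_ hf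
  · exact const_mem_trig 0
  · intro f g hf hg; exact trig_add hf hg
  · intro c k
    simp only [chr_mulVec]
    exact trig_mul (const_mem_trig _) (chr_mem_trig _)

theorem trig_continuous {f : (Fin d → ℝ) → ℂ} (hf : f ∈ trig d) : Continuous f := by
  refine trig_induction (P := Continuous) ?_ ?_ ?_ hf
  · exact continuous_const
  · intro f g hf hg; exact hf.add hg
  · intro c k; exact continuous_const.mul (continuous_chr k)

theorem trig_periodic {f : (Fin d → ℝ) → ℂ} (hf : f ∈ trig d) (ξ : Fin d → ℝ) (l : Fin d → ℤ) :
    f (ξ + (2 * Real.pi) • realVec l) = f ξ := by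
  refine trig_induction (P := fun f => f (ξ + (2 * Real.pi) • realVec l) = f ξ) rfl ?_ ?_ hf
  · intro f g hf hg; simp only [hf, hg]
  · intro c k; simp only [chr_add_right, chr_two_pi, mul_one]

/-- Distinct characters are linearly independent. -/
theorem chr_coeff_unique (u : (Fin d → ℤ) →₀ ℂ)
    (h : ∀ ξ, u.sum (fun k c => c * chr k ξ) = 0) : u = 0 := by
  let χ : (Fin d → ℤ) → (Multiplicative (Fin d → ℝ) →* ℂ) := fun k =>
    { toFun := fun ξ => chr k ξ.toAdd
      map_one' := chr_zero_right k
      map_mul' := fun ξ η => chr_add_right k _ _ }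
  have hinj : Function.Injective χ := by
    intro k l hkl
    ext i
    by_contra hne
    -- at `ξ = π / (k i - l i) e_i` the two characters differ by the factor `-1`
    have hne' : ((k i : ℝ) - l i) ≠ 0 := sub_ne_zero.2 (by exact_mod_cast hne)
    have h1 := DFunLike.congr_fun hkl
      (Multiplicative.ofAdd (Pi.single i (Real.pi / ((k i : ℝ) - l i))))
    have h2 : chr (k - l) (Pi.single i (Real.pi / ((k i : ℝ) - l i))) = 1 := by
      rw [sub_eq_add_neg, chr_add, mul_comm, ← chr_neg_mul l]
      exact congrArg _ h1
    have h3 : chr (k - l) (Pi.single i (Real.pi / ((k i : ℝ) - l i))) = -1 := by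
      rw [chr, dotProduct_single, realVec_sub, Pi.sub_apply]
      simp only [realVec]
      rw [mul_div_cancel₀ _ hne', mul_comm, Complex.exp_neg, Complex.exp_pi_mul_I]
      norm_num
    rw [h3] at h2
    norm_num at h2
  have hli := (linearIndependent_monoidHom (Multiplicative (Fin d → ℝ)) ℂ).comp χ hinj
  rw [linearIndependent_iff] at hli
  refine hli u ?_
  ext ξ
  rw [Finsupp.linearCombination_apply]
  simpa [Finsupp.sum, χ] using h ξ.toAdd

end trig

/-! ### Symbols of filters -/

section symb
variable {d s r t : ℕ}

theorem symb_apply (u : Mask d s r) (ξ : Fin d → ℝ) (i : Fin s) (j : Fin r) :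
    symb u ξ i j = u.sum fun k A => A i j * chr k ξ := by
  simp only [symb, Finsupp.sum, Matrix.sum_apply, Matrix.smul_apply, smul_eq_mul, chr]
  exact Finset.sum_congr rfl fun _ _ => mul_comm _ _

theorem symb_mem_trig (u : Mask d s r) (i : Fin s) (j : Fin r) :
    (fun ξ => symb u ξ i j) ∈ trig d := by
  simp only [symb_apply]
  exact trig_sum _ fun k _ => trig_mul (const_mem_trig _) (chr_mem_trig _)

/-- A matrix-valued function is a symbol as soon as its entries are trigonometric polynomials. -/
theorem exists_mask {F : (Fin d → ℝ) → Matrix (Fin s) (Fin r) ℂ}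
    (hF : ∀ i j, (fun ξ => F ξ i j) ∈ trig d) : ∃ u : Mask d s r, ∀ ξ, symb u ξ = F ξ := by
  choose c hc using fun i j => trig_iff.1 (hF i j)
  classical
  let S : Finset (Fin d → ℤ) := Finset.univ.biUnion fun i => Finset.univ.biUnion fun j =>
    (c i j).support
  refine ⟨Finsupp.onFinset S (fun k => Matrix.of fun i j => c i j k) ?_, ?_⟩
  · intro k hk
    by_contra hkS
    apply hk
    ext i j
    simp only [S, Finset.mem_biUnion, Finset.mem_univ, true_and, not_exists,
      Finsupp.notMem_support_iff] at hkS
    simpa using hkS i j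
  · intro ξ
    ext i j
    rw [symb_apply, hc, Finsupp.onFinset_sum _ (by simp)]
    simp only [Matrix.of_apply]
    rw [Finsupp.sum]
    refine (Finset.sum_subset ?_ ?_).symm
    · intro k hk
      simp only [S, Finset.mem_biUnion, Finset.mem_univ, true_and]
      exact ⟨i, j, hk⟩
    · intro k _ hk
      simp [Finsupp.notMem_support_iff.1 hk]

theorem trig_matrix_mul {F : (Fin d → ℝ) → Matrix (Fin s) (Fin r) ℂ}
    {G : (Fin d → ℝ) → Matrix (Fin r) (Fin t) ℂ} (hF : ∀ i j, (fun ξ => F ξ i j) ∈ trig d)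
    (hG : ∀ i j, (fun ξ => G ξ i j) ∈ trig d) (i : Fin s) (j : Fin t) :
    (fun ξ => (F ξ * G ξ) i j) ∈ trig d := by
  simp only [Matrix.mul_apply]
  exact trig_sum _ fun k _ => trig_mul (hF i k) (hG k j)

end symb

/-! ### Orders of vanishing and approximation by trigonometric polynomials -/

/-- `f` vanishes to order `n` at the origin. -/
def Van {d : ℕ} (n : ℕ) (f : (Fin d → ℝ) → ℂ) : Prop := f =O[𝓝 0] fun ξ => ‖ξ‖ ^ n

section Van
variable {d : ℕ} {n p q : ℕ} {f g : (Fin d → ℝ) → ℂ}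

theorem Van.add (hf : Van n f) (hg : Van n g) : Van n fun ξ => f ξ + g ξ := IsBigO.add hf hg

theorem Van.sub (hf : Van n f) (hg : Van n g) : Van n fun ξ => f ξ - g ξ := IsBigO.sub hf hg

theorem Van.neg (hf : Van n f) : Van n fun ξ => -f ξ := IsBigO.neg_left hf

theorem Van.sum {ι : Type*} (s : Finset ι) {f : ι → (Fin d → ℝ) → ℂ}
    (hf : ∀ i ∈ s, Van n (f i)) : Van n fun ξ => ∑ i ∈ s, f i ξ := IsBigO.fun_sum hf

theorem Van.zero : Van n fun _ : Fin d → ℝ => (0 : ℂ) := isBigO_zero _ _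

theorem Van.mul (hf : Van p f) (hg : Van q g) : Van (p + q) fun ξ => f ξ * g ξ := by
  simpa only [Van, pow_add] using IsBigO.mul hf hg

theorem Van.mul_right (hf : Van n f) (hg : ContinuousAt g 0) : Van n fun ξ => f ξ * g ξ := by
  have : Van 0 g := by simpa [Van] using hg.isBigO_one ℝ
  simpa using hf.mul this

theorem Van.mul_left (hf : Van n f) (hg : ContinuousAt g 0) : Van n fun ξ => g ξ * f ξ := by
  simpa only [mul_comm] using hf.mul_right hg

theorem Van.mono (h : p ≤ q) (hf : Van q f) : Van p f := by
  refine IsBigO.trans hf (IsBigO.of_bound 1 ?_)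
  filter_upwards [Metric.ball_mem_nhds (0 : Fin d → ℝ) one_pos] with ξ hξ
  rw [mem_ball_zero_iff] at hξ
  simpa using pow_le_pow_of_le_one (norm_nonneg ξ) hξ.le h

theorem Van.conj (hf : Van n f) : Van n fun ξ => conj (f ξ) := by
  refine IsBigO.trans (IsBigO.of_bound 1 (Eventually.of_forall fun ξ => ?_)) hf
  simp

theorem Van.pow (hf : Van p f) (k : ℕ) : Van (p * k) fun ξ => f ξ ^ k := by
  simpa only [Van, pow_mul] using IsBigO.pow hf k

/-- Vanishing orders are preserved by linear substitutions. -/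
theorem Van.comp_mulVec (hf : Van n f) (A : Matrix (Fin d) (Fin d) ℝ) :
    Van n fun ξ => f (A *ᵥ ξ) := by
  have hc : Tendsto (fun ξ : Fin d → ℝ => A *ᵥ ξ) (𝓝 0) (𝓝 0) := by
    have : Continuous fun ξ : Fin d → ℝ => A *ᵥ ξ := by fun_prop
    simpa using this.tendsto 0
  refine (IsBigO.comp_tendsto hf hc).trans (IsBigO.pow ?_ n)
  exact ((Matrix.mulVecLin A).toContinuousLinearMap.isBigO_id (𝓝 0)).norm_norm

/-- A differentiable function that vanishes at the origin vanishes there to order one. -/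
theorem Van.of_differentiableAt (hf : DifferentiableAt ℝ f 0) (h0 : f 0 = 0) : Van 1 f := by
  have := hf.isBigO_sub
  simp only [h0, sub_zero] at this
  simpa [Van] using this.norm_right

theorem Van.congr (hf : Van n f) (h : ∀ ξ, f ξ = g ξ) : Van n g := by
  rwa [← funext h]

theorem Van.eval_zero (hf : Van n f) (hn : n ≠ 0) : f 0 = 0 := by
  obtain ⟨C, hC⟩ := IsBigO.bound hf
  simpa [hn] using hC.self_of_nhds

theorem trig_differentiable (hf : f ∈ trig d) : Differentiable ℝ f := by
  refine trig_induction (P := Differentiable ℝ) ?_ ?_ ?_ hf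
  · fun_prop
  · intro f g hf hg; exact hf.add hg
  · intro c k
    refine Differentiable.const_mul ?_ c
    unfold chr dotProduct
    have : Differentiable ℝ fun t : ℝ => (t : ℂ) := Complex.ofRealCLM.differentiable
    fun_prop

theorem trig_van_one (hf : f ∈ trig d) (h0 : f 0 = 0) : Van 1 f :=
  Van.of_differentiableAt (trig_differentiable hf 0) h0

/-- `F` agrees to order `n` at the origin with some trigonometric polynomial. -/
def Approx {d : ℕ} (n : ℕ) (F : (Fin d → ℝ) → ℂ) : Prop := ∃ f ∈ trig d, Van n fun ξ => F ξ - f ξ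

variable {F G : (Fin d → ℝ) → ℂ}

theorem Approx.of_trig (hf : f ∈ trig d) : Approx n f := ⟨f, hf, by simpa using Van.zero⟩

theorem Approx.add (hF : Approx n F) (hG : Approx n G) : Approx n fun ξ => F ξ + G ξ := by
  obtain ⟨f, hf, hf'⟩ := hF
  obtain ⟨g, hg, hg'⟩ := hG
  exact ⟨_, trig_add hf hg, (hf'.add hg').congr fun ξ => by ring⟩

theorem Approx.sum {ι : Type*} (s : Finset ι) {f : ι → (Fin d → ℝ) → ℂ}
    (hf : ∀ i ∈ s, Approx n (f i)) : Approx n fun ξ => ∑ i ∈ s, f i ξ := by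
  classical
  induction s using Finset.induction_on with
  | empty => simpa using Approx.of_trig (const_mem_trig 0)
  | insert a s ha ih =>
    simp only [Finset.sum_insert ha]
    exact (hf a (by simp)).add (ih fun i hi => hf i (by simp [hi]))

theorem Approx.mul (hF : Approx n F) (hG : Approx n G) : Approx n fun ξ => F ξ * G ξ := by
  obtain ⟨f, hf, hf'⟩ := hF
  obtain ⟨g, hg, hg'⟩ := hG
  refine ⟨_, trig_mul hf hg, ?_⟩
  have h1 : Van n fun ξ => (F ξ - f ξ) * (G ξ - g ξ) :=
    (hf'.mul hg').mono (Nat.le_add_right n n)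
  exact ((h1.add (hf'.mul_right (trig_continuous hg).continuousAt)).add
    (hg'.mul_left (trig_continuous hf).continuousAt)).congr fun ξ => by ring

theorem Approx.add_van (hF : Approx n F) (h : Van n fun ξ => G ξ - F ξ) : Approx n G := by
  obtain ⟨f, hf, hf'⟩ := hF
  exact ⟨f, hf, (h.add hf').congr fun ξ => by ring⟩

theorem trig_pow (hf : f ∈ trig d) (k : ℕ) : (fun ξ => f ξ ^ k) ∈ trig d := (trig d).pow_mem hf k

/-- The coordinate functions are approximable: `-iξ_j = log (1 + (e^{-iξ_j} - 1))`. -/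
theorem Approx.coord (n : ℕ) (j : Fin d) : Approx n fun ξ : Fin d → ℝ => (ξ j : ℂ) := by
  set w : (Fin d → ℝ) → ℂ := fun ξ => chr (Pi.single j 1) ξ - 1
  have hw : w ∈ trig d := trig_sub (chr_mem_trig _) (const_mem_trig 1)
  have hw0 : w 0 = 0 := by simp [w, chr_zero_right]
  have hw1 : Van 1 w := trig_van_one hw hw0
  have hchr : ∀ ξ : Fin d → ℝ, chr (Pi.single j 1) ξ = cexp (-(I * ξ j)) := by
    intro ξ
    have : realVec (Pi.single j 1 : Fin d → ℤ) = Pi.single j 1 := by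
      ext i; by_cases h : i = j
      · subst h; simp [realVec]
      · simp [realVec, h]
    simp [chr, this]
  have hlog : ∀ᶠ ξ : Fin d → ℝ in 𝓝 0, Complex.log (1 + w ξ) = -(I * ξ j) := by
    filter_upwards [Metric.ball_mem_nhds (0 : Fin d → ℝ) one_pos] with ξ hξ
    rw [mem_ball_zero_iff] at hξ
    have h1 : |ξ j| < 1 := lt_of_le_of_lt (norm_le_pi_norm ξ j) hξ
    have h2 := abs_lt.1 h1
    have h3 := Real.pi_gt_three
    simp only [w, hchr, add_sub_cancel]
    rw [Complex.log_exp] <;> simp <;> linarith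
  have hT : (fun ξ => logTaylor (n + 1) (w ξ)) ∈ trig d := by
    simp only [logTaylor]
    refine trig_sum _ fun k _ => ?_
    have := trig_mul (const_mem_trig ((-1) ^ (k + 1) / (k : ℂ))) (trig_pow hw k)
    convert this using 2
    ring
  refine ⟨fun ξ => I * logTaylor (n + 1) (w ξ), trig_mul (const_mem_trig I) hT, ?_⟩
  have hsmall : ∀ᶠ ξ : Fin d → ℝ in 𝓝 0, ‖w ξ‖ < 1 / 2 := by
    have : Tendsto (fun ξ => ‖w ξ‖) (𝓝 0) (𝓝 0) := by
      simpa [hw0] using (trig_continuous hw).norm.tendsto 0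
    exact this.eventually (gt_mem_nhds (by norm_num))
  have hbig : (fun ξ : Fin d → ℝ => (ξ j : ℂ) - I * logTaylor (n + 1) (w ξ))
      =O[𝓝 0] fun ξ => w ξ ^ (n + 1) := by
    refine IsBigO.of_bound 2 ?_
    filter_upwards [hlog, hsmall] with ξ h1 h2
    have h3 : (ξ j : ℂ) - I * logTaylor (n + 1) (w ξ)
        = I * (Complex.log (1 + w ξ) - logTaylor (n + 1) (w ξ)) := by
      rw [h1]; ring_nf; simp
    rw [h3, norm_mul, norm_I, one_mul, norm_pow]
    refine (norm_log_sub_logTaylor_le n (by linarith)).trans ?_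
    have h4 : (1 - ‖w ξ‖)⁻¹ ≤ 2 := by
      rw [inv_le_comm₀ (by linarith) (by norm_num)]; linarith
    have h5 : 0 ≤ ‖w ξ‖ ^ (n + 1) := by positivity
    have h6 : (0 : ℝ) ≤ (1 - ‖w ξ‖)⁻¹ := inv_nonneg.2 (by linarith)
    calc ‖w ξ‖ ^ (n + 1) * (1 - ‖w ξ‖)⁻¹ / (n + 1)
        ≤ ‖w ξ‖ ^ (n + 1) * (1 - ‖w ξ‖)⁻¹ :=
          div_le_self (by positivity) (by simp)
      _ ≤ ‖w ξ‖ ^ (n + 1) * 2 := by gcongr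
      _ = _ := by ring
  have hvan : Van (n + 1) fun ξ : Fin d → ℝ => (ξ j : ℂ) - I * logTaylor (n + 1) (w ξ) := by
    refine IsBigO.trans hbig ?_
    simpa [Van] using hw1.pow (n + 1)
  exact hvan.mono (Nat.le_succ n)

/-- Polynomials are approximable. -/
theorem Approx.polynomial (n : ℕ) (P : MvPolynomial (Fin d) ℂ) :
    Approx n fun ξ : Fin d → ℝ => MvPolynomial.eval (fun i => (ξ i : ℂ)) P := by
  induction P using MvPolynomial.induction_on with
  | C a => simpa using Approx.of_trig (const_mem_trig a)
  | add p q hp hq => simpa using hp.add hq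
  | mul_X p i hp => simpa using hp.mul (Approx.coord n i)

/-- A trigonometric polynomial that does not vanish at the origin is invertible to any order. -/
theorem exists_trig_inverse (n : ℕ) (hf : f ∈ trig d) (h0 : f 0 ≠ 0) :
    ∃ g ∈ trig d, Van n fun ξ => g ξ * f ξ - 1 := by
  set h : (Fin d → ℝ) → ℂ := fun ξ => 1 - (f 0)⁻¹ * f ξ
  have hh : h ∈ trig d := trig_sub (const_mem_trig 1) (trig_mul (const_mem_trig _) hf)
  have hh1 : Van 1 h := trig_van_one hh (by simp [h, h0])
  refine ⟨fun ξ => (∑ k ∈ Finset.range n, h ξ ^ k) * (f 0)⁻¹,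
    trig_mul (trig_sum _ fun k _ => trig_pow hh k) (const_mem_trig _), ?_⟩
  have h2 : Van n fun ξ => -(h ξ ^ n) := by simpa using (hh1.pow n).neg
  refine h2.congr fun ξ => ?_
  have h3 := geom_sum_mul_neg (h ξ) n
  have h4 : (f 0)⁻¹ * f ξ = 1 - h ξ := by simp [h]
  rw [mul_assoc, h4, h3]; ring

end Van

/-! ### Powers of the ideal of trigonometric polynomials vanishing at the origin -/

section IdealPower
variable {d : ℕ}

/-- The generator `e^{-iξ_j} - 1` of the ideal of trigonometric polynomials vanishing at `0`. -/
noncomputable def wgen {d : ℕ} (j : Fin d) (ξ : Fin d → ℝ) : ℂ := chr (Pi.single j 1) ξ - 1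

theorem wgen_mem (j : Fin d) : wgen j ∈ trig d := trig_sub (chr_mem_trig _) (const_mem_trig 1)

/-- Up to a monomial factor, a trigonometric polynomial is a polynomial in the `e^{-iξ_j} - 1`. -/
theorem trig_eq_polynomial {f : (Fin d → ℝ) → ℂ} (hf : f ∈ trig d) :
    ∃ (K : Fin d → ℕ) (P : MvPolynomial (Fin d) ℂ),
      ∀ ξ, chr (fun i => (K i : ℤ)) ξ * f ξ = MvPolynomial.eval (fun j => wgen j ξ) P := by
  have hnat : ∀ K : Fin d → ℕ, ∃ P : MvPolynomial (Fin d) ℂ,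
      ∀ ξ, chr (fun i => (K i : ℤ)) ξ = MvPolynomial.eval (fun j => wgen j ξ) P := by
    intro K
    refine ⟨∏ i, (MvPolynomial.X i + 1) ^ K i, fun ξ => ?_⟩
    simp only [map_prod, map_pow, map_add, MvPolynomial.eval_X, map_one, wgen, sub_add_cancel]
    have h1 : (fun i => (K i : ℤ)) = ∑ i, K i • (Pi.single i 1 : Fin d → ℤ) := by
      ext j; simp [Finset.sum_apply, Pi.single_apply]
    have h2 : ∀ (s : Finset (Fin d)), chr (∑ i ∈ s, K i • (Pi.single i 1 : Fin d → ℤ)) ξ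
        = ∏ i ∈ s, chr (Pi.single i 1) ξ ^ K i := by
      intro s
      classical
      induction s using Finset.induction_on with
      | empty => simp [chr_zero]
      | insert a s ha ih =>
        rw [Finset.sum_insert ha, Finset.prod_insert ha, chr_add, ih]
        congr 1
        generalize K a = n
        induction n with
        | zero => simp [chr_zero]
        | succ n ihn => rw [succ_nsmul, chr_add, ihn, pow_succ]
    rw [h1, h2]
  refine trig_induction (P := fun f => ∃ (K : Fin d → ℕ) (P : MvPolynomial (Fin d) ℂ),
      ∀ ξ, chr (fun i => (K i : ℤ)) ξ * f ξ = MvPolynomial.eval (fun j => wgen j ξ) P)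
      ⟨0, 0, by simp⟩ ?_ ?_ hf
  · rintro f g ⟨K, P, hP⟩ ⟨L, Q, hQ⟩
    obtain ⟨A, hA⟩ := hnat K
    obtain ⟨B, hB⟩ := hnat L
    refine ⟨K + L, B * P + A * Q, fun ξ => ?_⟩
    have : (fun i => (((K + L) i : ℕ) : ℤ)) = (fun i => (K i : ℤ)) + fun i => (L i : ℤ) := by
      ext; simp
    rw [this, chr_add]
    simp only [map_add, map_mul, ← hP, ← hQ, ← hA, ← hB]
    ring
  · intro c k
    obtain ⟨P, hP⟩ := hnat fun i => (k i).toNat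
    refine ⟨fun i => (-k i).toNat, MvPolynomial.C c * P, fun ξ => ?_⟩
    rw [mul_left_comm, ← chr_add]
    simp only [map_mul, MvPolynomial.eval_C, ← hP]
    congr 2
    ext i
    simp only [Pi.add_apply]
    omega

theorem _root_.MvPolynomial.IsHomogeneous.eval_mul {σ : Type*} [Fintype σ]
    {Q : MvPolynomial σ ℂ} {i : ℕ} (hQ : Q.IsHomogeneous i) (c : ℂ) (y : σ → ℂ) :
    MvPolynomial.eval (fun j => c * y j) Q = c ^ i * MvPolynomial.eval y Q := by
  rw [MvPolynomial.eval_eq', MvPolynomial.eval_eq', Finset.mul_sum]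
  refine Finset.sum_congr rfl fun α hα => ?_
  have hdeg := hQ (MvPolynomial.mem_support_iff.1 hα)
  rw [Finsupp.weight_apply, Finsupp.sum_fintype _ _ (by simp)] at hdeg
  simp only [mul_pow, Finset.prod_mul_distrib, Finset.prod_pow_eq_pow_sum]
  simp only [Pi.one_apply, smul_eq_mul, mul_one] at hdeg
  rw [hdeg]; ring

theorem tendsto_wgen (x : Fin d → ℝ) (j : Fin d) :
    Tendsto (fun t : ℝ => (t : ℂ)⁻¹ * wgen j (t • x)) (𝓝[≠] 0) (𝓝 (-I * (x j : ℂ))) := by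
  have hform : ∀ t : ℝ, wgen j (t • x) = cexp ((-I * x j) * t) - 1 := by
    intro t
    have : realVec (Pi.single j 1 : Fin d → ℤ) = Pi.single j 1 := by
      ext i; by_cases h : i = j
      · subst h; simp [realVec]
      · simp [realVec, h]
    simp only [wgen, chr, this, single_one_dotProduct, Pi.smul_apply, smul_eq_mul]
    congr 2; push_cast; ring
  have hd : HasDerivAt (fun t : ℝ => wgen j (t • x)) (-I * x j) 0 := by
    have h1 : HasDerivAt (fun t : ℂ => cexp ((-I * x j) * t)) (-I * x j) ((0 : ℝ) : ℂ) := by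
      have := ((hasDerivAt_id ((0 : ℝ) : ℂ)).const_mul (-I * (x j : ℂ))).cexp
      simpa using this
    have h2 := h1.comp_ofReal
    rw [funext hform]
    exact h2.sub_const 1
  have := hd.tendsto_slope_zero
  simp only [zero_add] at this
  have h0 : wgen j (0 : Fin d → ℝ) = 0 := by simp [wgen, chr_zero_right]
  simpa [h0] using this

/-- Suppose that `w_j` has the linear part `c ξ_j` at the origin, `c ≠ 0`. If a polynomial in the
`w_j` vanishes to order `n` at the origin, then all its coefficients of degree less than `n` are
zero: its homogeneous part of lowest degree is the leading term at the origin. -/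
theorem homogeneousComponent_eq_zero_of_van {n : ℕ} {P : MvPolynomial (Fin d) ℂ}
    {v : Fin d → (Fin d → ℝ) → ℂ} {c : ℂ} (hc0 : c ≠ 0)
    (hv : ∀ x j, Tendsto (fun t : ℝ => (t : ℂ)⁻¹ * v j (t • x)) (𝓝[≠] 0) (𝓝 (c * x j)))
    (hP : Van n fun ξ => MvPolynomial.eval (fun j => v j ξ) P) :
    ∀ k < n, MvPolynomial.homogeneousComponent k P = 0 := by
  intro k
  induction k using Nat.strong_induction_on with
  | _ k ih =>
  intro hk
  have hline : ∀ x : Fin d → ℝ,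
      MvPolynomial.eval (fun j => c * (x j : ℂ)) (MvPolynomial.homogeneousComponent k P) = 0 := by
    intro x
    -- restrict to the line `t ↦ t x` and let `t → 0`
    set w : ℝ → Fin d → ℂ := fun t j => v j (t • x)
    have hw : ∀ j, Tendsto (fun t : ℝ => (t : ℂ)⁻¹ * w t j) (𝓝[≠] 0) (𝓝 (c * (x j : ℂ))) :=
      hv x
    have hsum : ∀ t : ℝ, MvPolynomial.eval (w t) P
        = ∑ i ∈ Finset.range (P.totalDegree + 1),
          MvPolynomial.eval (w t) (MvPolynomial.homogeneousComponent i P) := by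
      intro t
      conv_lhs => rw [← MvPolynomial.sum_homogeneousComponent P]
      rw [map_sum]
    have hterm : ∀ i ∈ Finset.range (P.totalDegree + 1), Tendsto (fun t : ℝ => ((t : ℂ) ^ k)⁻¹ *
        MvPolynomial.eval (w t) (MvPolynomial.homogeneousComponent i P)) (𝓝[≠] 0)
        (𝓝 (if i = k then MvPolynomial.eval (fun j => c * (x j : ℂ))
          (MvPolynomial.homogeneousComponent i P) else 0)) := by
      intro i _
      rcases lt_or_ge i k with hik | hik
      · simp [ih i hik (hik.trans hk), hik.ne]
      have h1 : Tendsto (fun t : ℝ => MvPolynomial.eval (fun j => (t : ℂ)⁻¹ * w t j)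
          (MvPolynomial.homogeneousComponent i P)) (𝓝[≠] 0)
          (𝓝 (MvPolynomial.eval (fun j => c * (x j : ℂ))
            (MvPolynomial.homogeneousComponent i P))) := by
        have hc := MvPolynomial.continuous_eval (MvPolynomial.homogeneousComponent i P)
        exact (hc.tendsto _).comp (tendsto_pi_nhds.2 hw)
      have h2 : Tendsto (fun t : ℝ => (t : ℂ) ^ (i - k)) (𝓝[≠] 0) (𝓝 (0 ^ (i - k))) := by
        have : Continuous fun t : ℝ => (t : ℂ) ^ (i - k) := by fun_prop
        simpa using (this.tendsto 0).mono_left nhdsWithin_le_nhds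
      have h3 := h2.mul h1
      have h4 : (0 : ℂ) ^ (i - k) * MvPolynomial.eval (fun j => c * (x j : ℂ))
          (MvPolynomial.homogeneousComponent i P) = if i = k then
            MvPolynomial.eval (fun j => c * (x j : ℂ))
              (MvPolynomial.homogeneousComponent i P) else 0 := by
        by_cases h : i = k
        · simp [h]
        · rw [if_neg h, zero_pow (by omega), zero_mul]
      rw [h4] at h3
      refine h3.congr' ?_
      filter_upwards [self_mem_nhdsWithin] with t ht
      have ht' : (t : ℂ) ≠ 0 := by exact_mod_cast ht
      rw [(MvPolynomial.homogeneousComponent_isHomogeneous i P).eval_mul, ← mul_assoc]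
      congr 1
      rw [inv_pow, pow_sub₀ _ ht' hik]
      field_simp
    have hlim := tendsto_finsetSum _ hterm
    simp only [← Finset.mul_sum, ← hsum] at hlim
    have hzero : Tendsto (fun t : ℝ => ((t : ℂ) ^ k)⁻¹ * MvPolynomial.eval (w t) P)
        (𝓝[≠] 0) (𝓝 0) := by
      have h1 : (fun t : ℝ => MvPolynomial.eval (w t) P) =O[𝓝 0] fun t : ℝ => t ^ n := by
        have hc : Tendsto (fun t : ℝ => t • x) (𝓝 0) (𝓝 0) := by
          have : Continuous fun t : ℝ => t • x := by fun_prop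
          simpa using this.tendsto 0
        refine (IsBigO.comp_tendsto hP hc).trans ?_
        refine IsBigO.of_bound (‖x‖ ^ n) (Eventually.of_forall fun t => ?_)
        simp [norm_smul, mul_pow, mul_comm]
      have h2 : (fun t : ℝ => ((t : ℂ) ^ k)⁻¹ * MvPolynomial.eval (w t) P)
          =O[𝓝[≠] 0] fun t : ℝ => t ^ (n - k) := by
        have h3 : (fun t : ℝ => ((t : ℂ) ^ k)⁻¹) =O[𝓝[≠] 0] fun t : ℝ => (t ^ k)⁻¹ :=
          IsBigO.of_bound 1 (Eventually.of_forall fun t => by simp)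
        refine (h3.mul (h1.mono nhdsWithin_le_nhds)).congr' EventuallyEq.rfl ?_
        filter_upwards [self_mem_nhdsWithin] with t ht
        rw [pow_sub₀ _ ht hk.le, mul_comm]
      refine h2.trans_tendsto ?_
      have : Tendsto (fun t : ℝ => t ^ (n - k)) (𝓝 0) (𝓝 (0 ^ (n - k))) :=
        (continuous_pow (n - k)).tendsto 0
      rw [zero_pow (by omega)] at this
      exact this.mono_left nhdsWithin_le_nhds
    have huniq := tendsto_nhds_unique hlim hzero
    rw [Finset.sum_ite_eq'] at huniq
    by_cases hkd : k ∈ Finset.range (P.totalDegree + 1)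
    · simpa [hkd] using huniq
    · rw [MvPolynomial.homogeneousComponent_eq_zero, map_zero]
      simpa using hkd
  refine MvPolynomial.funext_set (fun _ => Set.range fun t : ℝ => c * (t : ℂ))
    (fun _ => Set.infinite_range_of_injective fun s t h => by simpa [hc0] using h) fun y hy => ?_
  choose x hx using fun j => hy j (Set.mem_univ j)
  have : y = fun j => c * (x j : ℂ) := funext fun j => (hx j).symm
  rw [this, hline, map_zero]

/-- A trigonometric polynomial that vanishes to order `p + q` at the origin is a sum of products of
trigonometric polynomials vanishing to orders `p` and `q`. -/
theorem exists_sum_mul_of_van {p q : ℕ} {f : (Fin d → ℝ) → ℂ} (hf : f ∈ trig d)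
    (hv : Van (p + q) f) :
    ∃ (n : ℕ) (P Q : Fin n → (Fin d → ℝ) → ℂ), (∀ i, P i ∈ trig d ∧ Van p (P i)) ∧
      (∀ i, Q i ∈ trig d ∧ Van q (Q i)) ∧ ∀ ξ, f ξ = ∑ i, P i ξ * Q i ξ := by
  -- `J` is the ideal of the origin in the ring of trigonometric polynomials; up to a unit, `f` is a
  -- polynomial in its generators without terms of degree less than `p + q`, so `f ∈ J ^ p * J ^ q`
  let w : Fin d → trig d := fun j => ⟨wgen j, wgen_mem j⟩
  let J : Ideal (trig d) := Ideal.span (Set.range w)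
  let V : ℕ → Ideal (trig d) := fun n =>
    { carrier := {g | Van n g.1}
      add_mem' := fun hf hg => hf.add hg
      zero_mem' := Van.zero
      smul_mem' := fun c g hg => hg.mul_left (trig_continuous c.2).continuousAt }
  have hJV : ∀ n, J ^ n ≤ V n := by
    intro n
    induction n with
    | zero =>
      intro g _
      change Van 0 g.1
      unfold Van
      simpa only [pow_zero] using (trig_continuous g.2).continuousAt.isBigO_one ℝ
    | succ n ih =>
      rw [pow_succ, Ideal.mul_le]
      intro a ha b hb
      have hb1 : b ∈ V 1 := by
        have hle : J ≤ V 1 := Ideal.span_le.2 (by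
          rintro _ ⟨j, rfl⟩
          exact trig_van_one (wgen_mem j) (show wgen j 0 = 0 by simp [wgen, chr_zero_right]))
        exact hle hb
      exact Van.mul (ih ha) hb1
  obtain ⟨K, P, hP⟩ := trig_eq_polynomial hf
  have hPv : Van (p + q) fun ξ => MvPolynomial.eval (fun j => wgen j ξ) P :=
    (hv.mul_left (continuous_chr _).continuousAt).congr hP
  have hcomp := homogeneousComponent_eq_zero_of_van (neg_ne_zero.2 I_ne_zero) tendsto_wgen hPv
  have heval : ∀ (R : MvPolynomial (Fin d) ℂ) (ξ : Fin d → ℝ),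
      (MvPolynomial.aeval w R).1 ξ = MvPolynomial.eval (fun j => wgen j ξ) R := by
    intro R ξ
    induction R using MvPolynomial.induction_on with
    | C a => rw [MvPolynomial.aeval_C, MvPolynomial.eval_C]; rfl
    | add a b ha hb => rw [map_add, map_add, ← ha, ← hb]; rfl
    | mul_X a i ha =>
      rw [map_mul, map_mul, MvPolynomial.aeval_X, MvPolynomial.eval_X, ← ha]; rfl
  have hmem : MvPolynomial.aeval w P ∈ J ^ (p + q) := by
    rw [MvPolynomial.aeval_def, MvPolynomial.eval₂_eq]
    refine Ideal.sum_mem _ fun α hα => ?_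
    have hdeg : p + q ≤ α.degree := by
      by_contra hlt
      have h0 := congrArg (MvPolynomial.coeff α) (hcomp _ (not_le.1 hlt))
      rw [MvPolynomial.coeff_homogeneousComponent, if_pos rfl] at h0
      exact (MvPolynomial.mem_support_iff.1 hα) (by simpa using h0)
    refine Ideal.mul_mem_left _ _ (Ideal.pow_le_pow_right hdeg ?_)
    rw [Finsupp.degree_apply, ← Finset.prod_pow_eq_pow_sum]
    exact Ideal.prod_mem_prod fun j _ =>
      Ideal.pow_mem_pow (Ideal.subset_span (Set.mem_range_self j)) _
  have hfmem : (⟨f, hf⟩ : trig d) ∈ J ^ p * J ^ q := by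
    rw [← pow_add]
    have h1 : (⟨f, hf⟩ : trig d)
        = ⟨chr (-fun i => (K i : ℤ)), chr_mem_trig _⟩ * MvPolynomial.aeval w P := by
      ext ξ
      change f ξ = chr _ ξ * (MvPolynomial.aeval w P).1 ξ
      rw [heval, ← hP, ← mul_assoc, chr_neg_mul, one_mul]
    rw [h1]
    exact Ideal.mul_mem_left _ _ hmem
  have hgoal : ∀ g ∈ J ^ p * J ^ q, ∃ (n : ℕ) (P Q : Fin n → (Fin d → ℝ) → ℂ),
      (∀ i, P i ∈ trig d ∧ Van p (P i)) ∧
      (∀ i, Q i ∈ trig d ∧ Van q (Q i)) ∧ ∀ ξ, g.1 ξ = ∑ i, P i ξ * Q i ξ := by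
    intro g hg
    induction hg using Submodule.mul_induction_on' with
    | mem_mul_mem a ha b hb =>
      exact ⟨1, fun _ => a.1, fun _ => b.1, fun _ => ⟨a.2, hJV p ha⟩, fun _ => ⟨b.2, hJV q hb⟩,
        fun ξ => by simp⟩
    | add a _ b _ ha hb =>
      obtain ⟨n, P, Q, h1, h2, h3⟩ := ha
      obtain ⟨n', P', Q', h1', h2', h3'⟩ := hb
      refine ⟨n + n', Fin.append P P', Fin.append Q Q', fun i => ?_, fun i => ?_, fun ξ => ?_⟩
      · induction i using Fin.addCases with
        | left i => simpa using h1 i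
        | right i => simpa using h1' i
      · induction i using Fin.addCases with
        | left i => simpa using h2 i
        | right i => simpa using h2' i
      · simp [Fin.sum_univ_add, ← h3, ← h3']
  exact hgoal _ hfmem

end IdealPower

/-! ### Moments and the behaviour of Fourier transforms at the origin -/

section Moments
variable {d : ℕ} {T : Type*} [MeasurableSpace T] {μ : Measure T} {y : T → Fin d → ℝ} {g : T → ℂ}

/-- The moment `∫ y(t)^α g(t) dμ(t)`. -/
noncomputable def moment (μ : Measure T) (y : T → Fin d → ℝ) (g : T → ℂ) (α : Fin d → ℕ) : ℂ :=
  ∫ t, (∏ i, (y t i : ℂ) ^ α i) * g t ∂μ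

/-- The Taylor polynomial of degree less than `n` at the origin of
`ξ ↦ ∫ g(t) e^{-i y(t)·ξ} dμ(t)`. -/
noncomputable def taylorPoly (μ : Measure T) (y : T → Fin d → ℝ) (g : T → ℂ) (n : ℕ) :
    MvPolynomial (Fin d) ℂ :=
  ∑ k ∈ Finset.range n, ∑ α ∈ Finset.piAntidiag Finset.univ k,
    MvPolynomial.monomial (Finsupp.equivFunOnFinite.symm α)
      ((-I) ^ k / (k.factorial : ℂ) * (Nat.multinomial Finset.univ α : ℂ) * moment μ y g α)

theorem integrable_bounded_mul {h : T → ℂ} {R : ℝ} (hh : AEStronglyMeasurable h μ)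
    (hg : Integrable g μ) (hR : ∀ t, g t ≠ 0 → ‖h t‖ ≤ R) : Integrable (fun t => h t * g t) μ := by
  refine Integrable.mono' (hg.norm.const_mul R) (hh.mul hg.1) (Eventually.of_forall fun t => ?_)
  rw [norm_mul]
  by_cases h0 : g t = 0
  · simp [h0]
  · exact mul_le_mul_of_nonneg_right (hR t h0) (norm_nonneg _)

theorem integrable_monomial (hy : Measurable y) (hg : Integrable g μ) {R : ℝ}
    (hR : ∀ t, g t ≠ 0 → ‖y t‖ ≤ R) (α : Fin d → ℕ) :
    Integrable (fun t => (∏ i, (y t i : ℂ) ^ α i) * g t) μ := by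
  refine integrable_bounded_mul (R := ∏ i, R ^ α i) ?_ hg fun t ht => ?_
  · refine Measurable.aestronglyMeasurable ?_
    fun_prop
  · rw [norm_prod]
    refine Finset.prod_le_prod (fun _ _ => norm_nonneg _) fun i _ => ?_
    rw [norm_pow, norm_real]
    exact pow_le_pow_left₀ (norm_nonneg _) ((norm_le_pi_norm (y t) i).trans (hR t ht)) _

theorem integral_eval_eq_sum_moment (hy : Measurable y) (hg : Integrable g μ) {R : ℝ}
    (hR : ∀ t, g t ≠ 0 → ‖y t‖ ≤ R) (p : MvPolynomial (Fin d) ℂ) :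
    ∫ t, MvPolynomial.eval (fun i => (y t i : ℂ)) p * g t ∂μ
      = ∑ α ∈ p.support, MvPolynomial.coeff α p * moment μ y g α := by
  simp only [MvPolynomial.eval_eq', Finset.sum_mul, mul_assoc]
  rw [integral_finsetSum]
  · simp only [integral_const_mul, moment]
  · intro α _
    exact (integrable_monomial hy hg hR α).const_mul _

theorem abs_dotProduct_le (x ξ : Fin d → ℝ) : |x ⬝ᵥ ξ| ≤ d * (‖x‖ * ‖ξ‖) := by
  rw [dotProduct]
  refine (Finset.abs_sum_le_sum_abs _ _).trans ?_
  have : ∀ i ∈ Finset.univ, |x i * ξ i| ≤ ‖x‖ * ‖ξ‖ := fun i _ => by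
    rw [abs_mul]
    exact mul_le_mul (norm_le_pi_norm x i) (norm_le_pi_norm ξ i) (abs_nonneg _) (norm_nonneg _)
  simpa using Finset.sum_le_sum this

theorem eval_taylorPoly (hy : Measurable y) (hg : Integrable g μ) {R : ℝ}
    (hR : ∀ t, g t ≠ 0 → ‖y t‖ ≤ R) (n : ℕ) (ξ : Fin d → ℝ) :
    MvPolynomial.eval (fun i => (ξ i : ℂ)) (taylorPoly μ y g n)
      = ∫ t, (∑ k ∈ Finset.range n, (-(I * ((y t ⬝ᵥ ξ : ℝ) : ℂ))) ^ k / (k.factorial : ℂ)) * g t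
          ∂μ := by
  have hexp : ∀ t, (∑ k ∈ Finset.range n,
      (-(I * ((y t ⬝ᵥ ξ : ℝ) : ℂ))) ^ k / (k.factorial : ℂ)) * g t
      = ∑ k ∈ Finset.range n, ∑ α ∈ Finset.piAntidiag Finset.univ k,
        ((-I) ^ k / (k.factorial : ℂ) * (Nat.multinomial Finset.univ α : ℂ)
          * ∏ i, (ξ i : ℂ) ^ α i) * ((∏ i, (y t i : ℂ) ^ α i) * g t) := by
    intro t
    rw [Finset.sum_mul]
    refine Finset.sum_congr rfl fun k _ => ?_
    have h1 : ((y t ⬝ᵥ ξ : ℝ) : ℂ) = ∑ i, (y t i : ℂ) * ξ i := by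
      simp [dotProduct]
    rw [← neg_mul, mul_pow, h1, Finset.sum_pow_eq_sum_piAntidiag, Finset.mul_sum, Finset.sum_div,
      Finset.sum_mul]
    refine Finset.sum_congr rfl fun α _ => ?_
    simp only [mul_pow, Finset.prod_mul_distrib]
    ring
  simp only [hexp]
  rw [integral_finsetSum]
  · simp only [taylorPoly, map_sum]
    refine Finset.sum_congr rfl fun k _ => ?_
    rw [integral_finsetSum]
    · refine Finset.sum_congr rfl fun α _ => ?_
      rw [integral_const_mul, MvPolynomial.eval_monomial, Finsupp.prod_fintype _ _ (by simp)]
      simp only [Finsupp.equivFunOnFinite_symm_apply_apply, moment]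
      ring
    · intro α _
      exact (integrable_monomial hy hg hR α).const_mul _
  · intro k _
    refine integrable_finsetSum _ fun α _ => ?_
    exact (integrable_monomial hy hg hR α).const_mul _

/-- Taylor expansion at the origin of the Fourier transform of a compactly supported density. -/
theorem van_sub_taylorPoly (hy : Measurable y) (hg : Integrable g μ) {R : ℝ}
    (hR : ∀ t, g t ≠ 0 → ‖y t‖ ≤ R) (n : ℕ) :
    Van n fun ξ => (∫ t, g t * cexp (-(I * ((y t ⬝ᵥ ξ : ℝ) : ℂ))) ∂μ)
      - MvPolynomial.eval (fun i => (ξ i : ℂ)) (taylorPoly μ y g n) := by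
  have hR0 : 0 ≤ max R 0 := le_max_right _ _
  set B : ℝ := d * max R 0
  have hB : 0 ≤ B := by positivity
  refine IsBigO.of_bound (B ^ n * Real.exp B * ∫ t, ‖g t‖ ∂μ) ?_
  filter_upwards [Metric.ball_mem_nhds (0 : Fin d → ℝ) one_pos] with ξ hξ
  rw [mem_ball_zero_iff] at hξ
  have hs : ∀ t, g t ≠ 0 → ‖-(I * ((y t ⬝ᵥ ξ : ℝ) : ℂ))‖ ≤ B * ‖ξ‖ := by
    intro t ht
    rw [norm_neg, norm_mul, norm_I, one_mul, norm_real, Real.norm_eq_abs]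
    refine (abs_dotProduct_le _ _).trans ?_
    rw [← mul_assoc]
    exact mul_le_mul_of_nonneg_right (mul_le_mul_of_nonneg_left
      ((hR t ht).trans (le_max_left _ _)) (by positivity)) (norm_nonneg _)
  have hm : Measurable fun t => -(I * ((y t ⬝ᵥ ξ : ℝ) : ℂ)) := by
    unfold dotProduct; fun_prop
  have hi1 : Integrable (fun t => cexp (-(I * ((y t ⬝ᵥ ξ : ℝ) : ℂ))) * g t) μ := by
    refine integrable_bounded_mul (R := 1) hm.cexp.aestronglyMeasurable hg fun t _ => ?_
    rw [Complex.norm_exp]; simp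
  have hi2 : Integrable (fun t => (∑ k ∈ Finset.range n,
      (-(I * ((y t ⬝ᵥ ξ : ℝ) : ℂ))) ^ k / (k.factorial : ℂ)) * g t) μ := by
    refine integrable_bounded_mul (R := ∑ k ∈ Finset.range n, (B * ‖ξ‖) ^ k / (k.factorial : ℝ))
      (Measurable.aestronglyMeasurable (by fun_prop)) hg fun t ht => ?_
    refine (norm_sum_le _ _).trans (Finset.sum_le_sum fun k _ => ?_)
    rw [norm_div, norm_pow, Complex.norm_natCast]
    gcongr
    exact hs t ht
  simp only [mul_comm (g _)]
  rw [eval_taylorPoly hy hg hR, ← integral_sub hi1 hi2, norm_pow, norm_norm]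
  refine (norm_integral_le_integral_norm _).trans ?_
  have : ∀ t, ‖cexp (-(I * ((y t ⬝ᵥ ξ : ℝ) : ℂ))) * g t - (∑ k ∈ Finset.range n,
      (-(I * ((y t ⬝ᵥ ξ : ℝ) : ℂ))) ^ k / (k.factorial : ℂ)) * g t‖
      ≤ B ^ n * Real.exp B * ‖ξ‖ ^ n * ‖g t‖ := by
    intro t
    rw [← sub_mul, norm_mul]
    by_cases h0 : g t = 0
    · simp [h0]
    refine mul_le_mul_of_nonneg_right ?_ (norm_nonneg _)
    refine (Complex.norm_exp_sub_sum_le_norm_mul_exp _ n).trans ?_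
    have h1 := hs t h0
    have h2 : B * ‖ξ‖ ≤ B := mul_le_of_le_one_right hB hξ.le
    calc _ ≤ (B * ‖ξ‖) ^ n * Real.exp B := by
          gcongr
          exact h1.trans h2
      _ = _ := by ring
  refine (integral_mono_of_nonneg (Eventually.of_forall fun _ => norm_nonneg _)
    (hg.norm.const_mul _) (Eventually.of_forall this)).trans (le_of_eq ?_)
  rw [integral_const_mul]; ring

theorem approx_fourier (hy : Measurable y) (hg : Integrable g μ) {R : ℝ}
    (hR : ∀ t, g t ≠ 0 → ‖y t‖ ≤ R) (n : ℕ) :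
    Approx n fun ξ => ∫ t, g t * cexp (-(I * ((y t ⬝ᵥ ξ : ℝ) : ℂ))) ∂μ :=
  (Approx.polynomial n (taylorPoly μ y g n)).add_van (van_sub_taylorPoly hy hg hR n)

theorem coeff_taylorPoly (n : ℕ) (α : Fin d →₀ ℕ) (hα : α.degree < n) :
    MvPolynomial.coeff α (taylorPoly μ y g n)
      = (-I) ^ α.degree / (α.degree.factorial : ℂ) * (Nat.multinomial Finset.univ α : ℂ)
        * moment μ y g α := by
  classical
  simp only [taylorPoly, MvPolynomial.coeff_sum, MvPolynomial.coeff_monomial]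
  have hdeg : α.degree = ∑ i, α i := by
    rw [Finsupp.degree_apply]
    exact Finset.sum_subset (Finset.subset_univ _) fun i _ hi => by simpa using hi
  rw [Finset.sum_eq_single α.degree]
  · rw [Finset.sum_eq_single (α : Fin d → ℕ)]
    · rw [if_pos (by ext; simp)]
    · intro β _ hβ
      rw [if_neg]
      rintro rfl
      exact hβ (by ext; simp)
    · intro h
      exact absurd (by simp [hdeg]) h
  · intro k _ hk
    refine Finset.sum_eq_zero fun β hβ => ?_
    rw [if_neg]
    rintro rfl
    rw [Finset.mem_piAntidiag] at hβ
    apply hk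
    rw [hdeg, ← hβ.1]
    simp
  · intro h
    exact absurd (Finset.mem_range.2 hα) h

/-- The Fourier transform of a compactly supported density vanishes to order `n` at the origin if
and only if the density annihilates all polynomials of degree less than `n`. -/
theorem van_fourier_iff (hy : Measurable y) (hg : Integrable g μ) {R : ℝ}
    (hR : ∀ t, g t ≠ 0 → ‖y t‖ ≤ R) (n : ℕ) :
    (Van n fun ξ => ∫ t, g t * cexp (-(I * ((y t ⬝ᵥ ξ : ℝ) : ℂ))) ∂μ) ↔
      ∀ p : MvPolynomial (Fin d) ℂ, p.totalDegree < n →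
        ∫ t, MvPolynomial.eval (fun i => (y t i : ℂ)) p * g t ∂μ = 0 := by
  have hT := van_sub_taylorPoly hy hg hR n
  constructor
  · intro hF p hp
    have hP : Van n fun ξ : Fin d → ℝ =>
        MvPolynomial.eval (fun i => (ξ i : ℂ)) (taylorPoly μ y g n) :=
      (hF.sub hT).congr fun ξ => by ring
    have hcomp := homogeneousComponent_eq_zero_of_van (v := fun j ξ => (ξ j : ℂ)) one_ne_zero
      (fun x j => by
        refine (tendsto_const_nhds (x := 1 * (x j : ℂ))).congr' ?_
        filter_upwards [self_mem_nhdsWithin] with t ht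
        have : (t : ℂ) ≠ 0 := by exact_mod_cast ht
        simp [this]) hP
    rw [integral_eval_eq_sum_moment hy hg hR]
    refine Finset.sum_eq_zero fun α hα => ?_
    have hdeg : α.degree < n := lt_of_le_of_lt (MvPolynomial.le_totalDegree hα) hp
    have h0 := congrArg (MvPolynomial.coeff α) (hcomp _ hdeg)
    rw [MvPolynomial.coeff_homogeneousComponent, if_pos rfl, coeff_taylorPoly n α hdeg] at h0
    have hmult : (Nat.multinomial Finset.univ α : ℂ) ≠ 0 :=
      Nat.cast_ne_zero.2 (Nat.multinomial_pos _ _).ne'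
    have hpow : (-I) ^ α.degree / (α.degree.factorial : ℂ) ≠ 0 :=
      div_ne_zero (pow_ne_zero _ (neg_ne_zero.2 I_ne_zero))
        (Nat.cast_ne_zero.2 (Nat.factorial_ne_zero _))
    simp only [MvPolynomial.coeff_zero, mul_eq_zero, hmult, hpow, false_or] at h0
    rw [h0, mul_zero]
  · intro h
    have h0 : taylorPoly μ y g n = 0 := by
      refine Finset.sum_eq_zero fun k hk => Finset.sum_eq_zero fun α hα => ?_
      rw [Finset.mem_piAntidiag] at hα
      have h1 := h (MvPolynomial.monomial (Finsupp.equivFunOnFinite.symm α) 1) (by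
        rw [MvPolynomial.totalDegree_monomial _ one_ne_zero, Finsupp.sum_fintype _ _ (by simp)]
        simpa [hα.1] using hk)
      have h2 : moment μ y g α = 0 := by
        rw [← h1, moment]
        refine integral_congr_ae (Eventually.of_forall fun t => ?_)
        simp only [MvPolynomial.eval_monomial, Finsupp.prod_fintype _ _ (fun _ => pow_zero _),
          Finsupp.equivFunOnFinite_symm_apply_apply, one_mul]
      rw [h2, mul_zero, map_zero]
    simpa [h0] using hT

/-- The discrete form of `van_fourier_iff`: an exponential sum vanishes to order `n` at the origin
if and only if the corresponding combination of point evaluations annihilates all polynomials of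
degree less than `n`. -/
theorem van_expSum_iff {ι : Type*} [Fintype ι] (x : ι → Fin d → ℝ) (c : ι → ℂ) (n : ℕ) :
    (Van n fun ξ => ∑ i, c i * cexp (-(I * ((x i ⬝ᵥ ξ : ℝ) : ℂ)))) ↔
      ∀ p : MvPolynomial (Fin d) ℂ, p.totalDegree < n →
        ∑ i, MvPolynomial.eval (fun j => (x i j : ℂ)) p * c i = 0 := by
  let _ : MeasurableSpace ι := ⊤
  have hR : ∀ i, c i ≠ 0 → ‖x i‖ ≤ ∑ i, ‖x i‖ := fun i _ =>
    Finset.single_le_sum (f := fun i => ‖x i‖) (fun _ _ => norm_nonneg _) (Finset.mem_univ i)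
  have := van_fourier_iff (μ := Measure.count) (y := x) (g := c) measurable_from_top
    (Integrable.of_finite) hR n
  simpa [integral_fintype, Measure.real] using this

theorem approx_exp (y : Fin d → ℝ) (n : ℕ) :
    Approx n fun ξ => cexp (-(I * ((y ⬝ᵥ ξ : ℝ) : ℂ))) := by
  have := approx_fourier (μ := Measure.dirac ()) (y := fun _ => y) (g := fun _ => 1)
    measurable_const (integrable_const _) (R := ‖y‖) (fun _ _ => le_rfl) n
  simpa using this

end Moments

/-! ### Dilation matrices and the finite group `ℤ^d / M ℤ^d` -/

section Dilation
variable {d : ℕ} {M : Matrix (Fin d) (Fin d) ℤ}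

theorem IsDilation.det_ne_zero (hM : IsDilation M) : M.det ≠ 0 := by
  intro h0
  have : (0 : ℂ) ∈ spectrum ℂ (M.map (Int.cast : ℤ → ℂ)) := by
    rw [spectrum.zero_mem_iff, Matrix.isUnit_iff_isUnit_det]
    have h1 : (M.map (Int.cast : ℤ → ℂ)).det = (M.det : ℂ) := by
      rw [Int.cast_det (R := ℂ) M]
    simp [h1, h0]
  have h1 := hM 0 this
  rw [norm_zero] at h1
  exact absurd h1 (by norm_num)

theorem realMat_isUnit_det (hM : M.det ≠ 0) : IsUnit (realMat M).det := by
  rw [realMat_det, isUnit_iff_ne_zero]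
  exact_mod_cast hM

theorem realMat_inv_mulVec (hM : M.det ≠ 0) (x : Fin d → ℝ) :
    (realMat M)⁻¹ *ᵥ (realMat M *ᵥ x) = x := by
  rw [mulVec_mulVec, Matrix.nonsing_inv_mul _ (realMat_isUnit_det hM), one_mulVec]

theorem realMat_mulVec_inv (hM : M.det ≠ 0) (x : Fin d → ℝ) :
    realMat M *ᵥ ((realMat M)⁻¹ *ᵥ x) = x := by
  rw [mulVec_mulVec, Matrix.mul_nonsing_inv _ (realMat_isUnit_det hM), one_mulVec]

theorem mulVec_injective_of_det (hM : M.det ≠ 0) :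
    Function.Injective fun k : Fin d → ℤ => M *ᵥ k := by
  intro k l h
  apply realVec_injective
  have := congrArg realVec h
  simp only [← realMat_mulVec] at this
  rw [← realMat_inv_mulVec hM (realVec k), this, realMat_inv_mulVec hM]

theorem norm_mulVec_le_of_entry {A : Matrix (Fin d) (Fin d) ℝ} {c : ℝ} (h : ∀ i j, |A i j| ≤ c)
    (hc : 0 ≤ c) (x : Fin d → ℝ) : ‖A *ᵥ x‖ ≤ d * c * ‖x‖ := by
  refine (pi_norm_le_iff_of_nonneg (by positivity)).2 fun i => ?_
  rw [mulVec, dotProduct]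
  refine (norm_sum_le _ _).trans ?_
  have : ∀ j ∈ Finset.univ, ‖A i j * x j‖ ≤ c * ‖x‖ := fun j _ => by
    rw [norm_mul]
    exact mul_le_mul (h i j) (norm_le_pi_norm x j) (norm_nonneg _) hc
  refine (Finset.sum_le_sum this).trans (le_of_eq ?_)
  simp [mul_assoc]

section
attribute [local instance] Matrix.linftyOpNormedRing Matrix.linftyOpNormedAlgebra

theorem exists_norm_pow_le {A : Matrix (Fin d) (Fin d) ℂ} (hA : ∀ z ∈ spectrum ℂ A, ‖z‖ < 1) :
    ∃ C ρ : ℝ, 0 < C ∧ 0 < ρ ∧ ρ < 1 ∧ ∀ k i j, ‖(A ^ k) i j‖ ≤ C * ρ ^ k := by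
  rcases Nat.eq_zero_or_pos d with rfl | hd
  · exact ⟨1, 1 / 2, by norm_num, by norm_num, by norm_num, fun k i => i.elim0⟩
  have : Nonempty (Fin d) := ⟨⟨0, hd⟩⟩
  have h1 : spectralRadius ℂ A < (1 : ℝ≥0) :=
    spectrum.spectralRadius_lt_of_forall_lt A fun z hz => hA z hz
  obtain ⟨q, hq1, hq2⟩ := ENNReal.lt_iff_exists_nnreal_btwn.1 h1
  have hq2' : q < 1 := by exact_mod_cast hq2
  have hq0 : 0 < q := by
    rw [pos_iff_ne_zero]
    rintro rfl
    simp at hq1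
  have hev := (spectrum.pow_nnnorm_pow_one_div_tendsto_nhds_spectralRadius A).eventually
    (gt_mem_nhds hq1)
  obtain ⟨n₀, hn₀⟩ := eventually_atTop.1 hev
  have hbig : ∀ k, n₀ + 1 ≤ k → ‖A ^ k‖ ≤ (q : ℝ) ^ k := by
    intro k hk
    have h2 := hn₀ k (by omega)
    have hk0 : (k : ℝ) ≠ 0 := by
      have : k ≠ 0 := by omega
      exact_mod_cast this
    have h3 := ENNReal.rpow_lt_rpow h2 (z := (k : ℝ)) (by positivity)
    rw [← ENNReal.rpow_mul, one_div, inv_mul_cancel₀ hk0, ENNReal.rpow_one,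
      ENNReal.rpow_natCast] at h3
    have h4 : ‖A ^ k‖₊ < q ^ k := by exact_mod_cast h3
    exact_mod_cast h4.le
  have hentry : ∀ (B : Matrix (Fin d) (Fin d) ℂ) i j, ‖B i j‖ ≤ ‖B‖ := by
    intro B i j
    rw [Matrix.linfty_opNorm_def]
    have h5 : ‖B i j‖₊ ≤ Finset.univ.sup fun i => ∑ j, ‖B i j‖₊ :=
      (Finset.single_le_sum (f := fun j => ‖B i j‖₊) (fun _ _ => zero_le) (Finset.mem_univ j)).trans
        (Finset.le_sup (f := fun i => ∑ j, ‖B i j‖₊) (Finset.mem_univ i))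
    exact_mod_cast h5
  have hqr : (0 : ℝ) < q := by exact_mod_cast hq0
  refine ⟨1 + ∑ k ∈ Finset.range (n₀ + 1), ‖A ^ k‖ / (q : ℝ) ^ k, q, by positivity, hqr,
    by exact_mod_cast hq2', fun k i j => (hentry _ i j).trans ?_⟩
  rcases lt_or_ge k (n₀ + 1) with hk | hk
  · have h6 := Finset.single_le_sum (f := fun k => ‖A ^ k‖ / (q : ℝ) ^ k)
      (fun _ _ => by positivity) (Finset.mem_range.2 hk)
    rw [← div_le_iff₀ (by positivity)]
    exact h6.trans (by linarith)
  · refine (hbig k hk).trans (le_mul_of_one_le_left (by positivity) ?_)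
    have : (0 : ℝ) ≤ ∑ k ∈ Finset.range (n₀ + 1), ‖A ^ k‖ / (q : ℝ) ^ k := by positivity
    linarith

end

/-- The powers of the inverse of a dilation matrix decay geometrically. -/
theorem IsDilation.exists_decay (hM : IsDilation M) :
    ∃ C ρ : ℝ, 0 < C ∧ 0 < ρ ∧ ρ < 1 ∧ ∀ k i j, |(((realMat M)⁻¹) ^ k) i j| ≤ C * ρ ^ k := by
  have hdet := hM.det_ne_zero
  set A : Matrix (Fin d) (Fin d) ℂ := M.map (Int.cast : ℤ → ℂ) with hA
  have hAdet : IsUnit A := by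
    rw [Matrix.isUnit_iff_isUnit_det]
    have h1 : A.det = (M.det : ℂ) := by
      rw [Int.cast_det (R := ℂ) M]
    rw [h1, isUnit_iff_ne_zero]; exact_mod_cast hdet
  obtain ⟨U, hU⟩ := hAdet
  have hinv : ∀ z ∈ spectrum ℂ ((U⁻¹ : (Matrix (Fin d) (Fin d) ℂ)ˣ) : Matrix (Fin d) (Fin d) ℂ),
      ‖z‖ < 1 := by
    intro z hz
    rw [← spectrum.map_inv, Set.mem_inv, hU] at hz
    have h2 := hM _ hz
    rw [norm_inv] at h2
    by_contra h3
    exact absurd (inv_le_one_of_one_le₀ (not_lt.1 h3)) (not_le.2 h2)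
  obtain ⟨C, ρ, hC, hρ, hρ1, h⟩ := exists_norm_pow_le hinv
  refine ⟨C, ρ, hC, hρ, hρ1, fun k i j => ?_⟩
  have hmap : ((realMat M)⁻¹).map ((↑) : ℝ → ℂ)
      = ((U⁻¹ : (Matrix (Fin d) (Fin d) ℂ)ˣ) : Matrix (Fin d) (Fin d) ℂ) := by
    have h1 : ((realMat M)⁻¹).map ((↑) : ℝ → ℂ) * (U : Matrix (Fin d) (Fin d) ℂ) = 1 := by
      have h2 : (U : Matrix (Fin d) (Fin d) ℂ) = (realMat M).map ((↑) : ℝ → ℂ) := by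
        rw [hU, hA]; ext i j; simp [realMat]
      have h3 := congrArg (fun B : Matrix (Fin d) (Fin d) ℝ => B.map Complex.ofRealHom)
        (Matrix.nonsing_inv_mul _ (realMat_isUnit_det hdet))
      simp only [Matrix.map_mul] at h3
      rw [h2]
      refine h3.trans ?_
      exact Matrix.map_one _ (map_zero _) (map_one _)
    rw [← mul_one (((realMat M)⁻¹).map ((↑) : ℝ → ℂ)), ← U.mul_inv, ← mul_assoc, h1, one_mul]
  have hpow : (((realMat M)⁻¹) ^ k).map ((↑) : ℝ → ℂ)
      = (((U⁻¹ : (Matrix (Fin d) (Fin d) ℂ)ˣ) : Matrix (Fin d) (Fin d) ℂ)) ^ k := by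
    rw [← hmap]
    exact Matrix.map_pow _ Complex.ofRealHom k
  have := h k i j
  rw [← hpow, Matrix.map_apply, norm_real] at this
  exact this

theorem IsDilation.exists_norm_decay (hM : IsDilation M) :
    ∃ C ρ : ℝ, 0 < C ∧ 0 < ρ ∧ ρ < 1 ∧ (∀ k x, ‖((realMat M)⁻¹ ^ k) *ᵥ x‖ ≤ C * ρ ^ k * ‖x‖) ∧
      ∀ k x, ‖(((realMat M)ᵀ)⁻¹ ^ k) *ᵥ x‖ ≤ C * ρ ^ k * ‖x‖ := by
  obtain ⟨C, ρ, hC, hρ, hρ1, h⟩ := hM.exists_decay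
  refine ⟨(d + 1) * C, ρ, by positivity, hρ, hρ1, fun k x => ?_, fun k x => ?_⟩
  · refine (norm_mulVec_le_of_entry (h k) (by positivity) x).trans ?_
    have : 0 ≤ C * ρ ^ k * ‖x‖ := by positivity
    nlinarith
  · have h' : ∀ i j, |((((realMat M)ᵀ)⁻¹) ^ k) i j| ≤ C * ρ ^ k := by
      intro i j
      rw [← Matrix.transpose_nonsing_inv, ← Matrix.transpose_pow]
      exact h k j i
    refine (norm_mulVec_le_of_entry h' (by positivity) x).trans ?_
    have : 0 ≤ C * ρ ^ k * ‖x‖ := by positivity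
    nlinarith

/-- The finite group `ℤ^d / M ℤ^d`. -/
abbrev LatticeQuot (M : Matrix (Fin d) (Fin d) ℤ) : Type :=
  (Fin d → ℤ) ⧸ LinearMap.range M.mulVecLin

theorem card_latticeQuot (hM : M.det ≠ 0) : Nat.card (LatticeQuot M) = M.det.natAbs := by
  have hinj : Function.Injective M.mulVecLin := mulVec_injective_of_det hM
  rw [← Submodule.natAbs_det_equiv _ (LinearEquiv.ofInjective M.mulVecLin hinj)]
  have h : (LinearMap.range M.mulVecLin).subtype ∘ₗ
      AddMonoidHom.toIntLinearMap
        ((LinearEquiv.ofInjective M.mulVecLin hinj : (Fin d → ℤ) ≃ₗ[ℤ] _) : (Fin d → ℤ) →+ _)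
      = Matrix.toLin' M := by
    ext; rfl
  rw [h, LinearMap.det_toLin']

theorem finite_latticeQuot (hM : M.det ≠ 0) : Finite (LatticeQuot M) :=
  Nat.finite_of_card_ne_zero (by rw [card_latticeQuot hM]; exact Int.natAbs_ne_zero.2 hM)

theorem latticeQuot_eq_iff {k l : Fin d → ℤ} :
    (Submodule.Quotient.mk k : LatticeQuot M) = Submodule.Quotient.mk l ↔
      ∃ n, k - l = M *ᵥ n := by
  rw [Submodule.Quotient.eq]
  exact ⟨fun ⟨n, hn⟩ => ⟨n, hn.symm⟩, fun ⟨n, hn⟩ => ⟨n, hn.symm⟩⟩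

/-- Every integer vector is congruent modulo `M ℤ^d` to the chosen representative of its class. -/
theorem latticeQuot_out (k : Fin d → ℤ) :
    ∃ n, k = Quotient.out (Submodule.Quotient.mk k : LatticeQuot M) + M *ᵥ n := by
  obtain ⟨n, hn⟩ := (latticeQuot_eq_iff (M := M) (k := k)
    (l := Quotient.out (Submodule.Quotient.mk k : LatticeQuot M))).1 (Quotient.out_eq _).symm
  exact ⟨n, by rw [← hn]; abel⟩

/-- The character `k ↦ e^{-2πi k·M^{-T}n}` is trivial on `M ℤ^d`. -/
theorem chr_dual_lattice (hM : M.det ≠ 0) (k n : Fin d → ℤ) :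
    chr (M *ᵥ k) ((2 * Real.pi) • (((realMat M)ᵀ)⁻¹ *ᵥ realVec n)) = 1 := by
  rw [← chr_mulVec, mulVec_smul, mulVec_mulVec, Matrix.mul_nonsing_inv, one_mulVec, chr_two_pi]
  rw [det_transpose]; exact realMat_isUnit_det hM

theorem chr_congr_dual (hM : M.det ≠ 0) {k l : Fin d → ℤ} (n : Fin d → ℤ)
    (h : (Submodule.Quotient.mk k : LatticeQuot M) = Submodule.Quotient.mk l) :
    chr k ((2 * Real.pi) • (((realMat M)ᵀ)⁻¹ *ᵥ realVec n))
      = chr l ((2 * Real.pi) • (((realMat M)ᵀ)⁻¹ *ᵥ realVec n)) := by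
  obtain ⟨j, hj⟩ := latticeQuot_eq_iff.1 h
  rw [← sub_add_cancel k l, chr_add, hj, chr_dual_lattice hM, one_mul]

theorem chr_two_pi_eq_one_iff (ω : Fin d → ℝ) :
    (∀ k : Fin d → ℤ, chr k ((2 * Real.pi) • ω) = 1) ↔ ∃ l : Fin d → ℤ, ω = realVec l := by
  constructor
  · intro h
    have : ∀ i, ∃ l : ℤ, ω i = l := by
      intro i
      have hi := h (Pi.single i 1)
      rw [chr, Complex.exp_eq_one_iff] at hi
      obtain ⟨n, hn⟩ := hi
      refine ⟨-n, ?_⟩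
      have h1 : realVec (Pi.single i 1 : Fin d → ℤ) = Pi.single i 1 := by
        ext j; by_cases h : j = i
        · subst h; simp [realVec]
        · simp [realVec, h]
      rw [h1, single_one_dotProduct, Pi.smul_apply, smul_eq_mul] at hn
      have hpi : (Real.pi : ℂ) ≠ 0 := ofReal_ne_zero.2 Real.pi_ne_zero
      have h2 : ((ω i : ℝ) : ℂ) = ((-n : ℤ) : ℂ) := by
        have h3 : (2 * Real.pi * I : ℂ) ≠ 0 := by simp [hpi]
        apply mul_left_cancel₀ h3
        push_cast at hn ⊢
        linear_combination -hn
      exact_mod_cast h2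
    choose l hl using this
    exact ⟨l, funext hl⟩
  · rintro ⟨l, rfl⟩ k
    exact chr_two_pi k l

open scoped Classical in
/-- Orthogonality of the characters of `ℤ^d / M ℤ^d`. -/
theorem sum_chr_latticeQuot (hM : M.det ≠ 0) [Fintype (LatticeQuot M)] (n : Fin d → ℤ) :
    ∑ x : LatticeQuot M, chr (Quotient.out x) ((2 * Real.pi) • (((realMat M)ᵀ)⁻¹ *ᵥ realVec n))
      = if ∃ l, n = Mᵀ *ᵥ l then ((|(realMat M).det| : ℝ) : ℂ) else 0 := by
  set ω := ((realMat M)ᵀ)⁻¹ *ᵥ realVec n with hω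
  have hMt : Mᵀ.det ≠ 0 := by rwa [det_transpose]
  have hiff : (∃ l, n = Mᵀ *ᵥ l) ↔ ∃ l : Fin d → ℤ, ω = realVec l := by
    rw [hω, realMat_transpose]
    constructor
    · rintro ⟨l, rfl⟩
      exact ⟨l, by rw [← realMat_mulVec, realMat_inv_mulVec hMt]⟩
    · rintro ⟨l, hl⟩
      refine ⟨l, realVec_injective ?_⟩
      rw [← realMat_mulVec, ← hl, realMat_mulVec_inv hMt]
  split_ifs with h
  · have h1 := (chr_two_pi_eq_one_iff ω).2 (hiff.1 h)
    simp only [h1, Finset.sum_const, Finset.card_univ, nsmul_eq_mul, mul_one]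
    have h2 : ((M.det.natAbs : ℕ) : ℝ) = |(M.det : ℝ)| := by rw [Nat.cast_natAbs, Int.cast_abs]
    rw [← Nat.card_eq_fintype_card, card_latticeQuot hM, realMat_det, ← h2, ofReal_natCast]
  · have h1 : ¬ ∀ k : Fin d → ℤ, chr k ((2 * Real.pi) • ω) = 1 := fun h1 =>
      h (hiff.2 ((chr_two_pi_eq_one_iff ω).1 h1))
    push Not at h1
    obtain ⟨k, hk⟩ := h1
    -- translation by `k` permutes the classes and multiplies the sum by a factor other than `1`
    have h2 : ∑ x : LatticeQuot M, chr (Quotient.out x) ((2 * Real.pi) • ω)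
        = chr k ((2 * Real.pi) • ω) *
          ∑ x : LatticeQuot M, chr (Quotient.out x) ((2 * Real.pi) • ω) := by
      rw [Finset.mul_sum,
        ← Equiv.sum_comp (Equiv.addLeft (Submodule.Quotient.mk k : LatticeQuot M))]
      refine Finset.sum_congr rfl fun x _ => ?_
      rw [← chr_add]
      refine chr_congr_dual hM n ?_
      have e1 : ∀ z : LatticeQuot M, Submodule.Quotient.mk (Quotient.out z) = z :=
        fun z => Quotient.out_eq _
      rw [e1, Submodule.Quotient.mk_add, e1]; rfl
    have h3 : (1 - chr k ((2 * Real.pi) • ω)) *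
        ∑ x : LatticeQuot M, chr (Quotient.out x) ((2 * Real.pi) • ω) = 0 := by
      rw [sub_mul, one_mul, ← h2, sub_self]
    exact (mul_eq_zero.1 h3).resolve_left (sub_ne_zero.2 (Ne.symm hk))

end Dilation

/-! ### Normal form of a refinable vector and its matching filter -/

section NormalForm
variable {d r n m : ℕ}

theorem Approx.continuousAt {F : (Fin d → ℝ) → ℂ} (hF : Approx n F) (hn : n ≠ 0) :
    ContinuousAt F 0 := by
  obtain ⟨f, hf, hv⟩ := hF
  have h0 : F 0 - f 0 = 0 := hv.eval_zero hn
  have h1 : Tendsto (fun ξ => F ξ - f ξ) (𝓝 0) (𝓝 (F 0 - f 0)) := by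
    rw [h0]
    refine IsBigO.trans_tendsto hv ?_
    have : Continuous fun ξ : Fin d → ℝ => ‖ξ‖ ^ n := by fun_prop
    simpa [hn] using this.tendsto 0
  have h2 := h1.add ((trig_continuous hf).tendsto 0)
  simpa [ContinuousAt] using h2

/-- All entries of the vector function `F` vanish to order `n` at the origin. -/
def VanV (n : ℕ) (F : (Fin d → ℝ) → Fin r → ℂ) : Prop := ∀ i, Van n fun ξ => F ξ i

/-- All entries of the matrix function `F` are trigonometric polynomials. -/
def TrigM {s r : ℕ} (F : (Fin d → ℝ) → Matrix (Fin s) (Fin r) ℂ) : Prop :=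
  ∀ i j, (fun ξ => F ξ i j) ∈ trig d

section
variable {F G : (Fin d → ℝ) → Fin r → ℂ} {s t : ℕ}

theorem VanV.add (hF : VanV n F) (hG : VanV n G) : VanV n fun ξ => F ξ + G ξ :=
  fun i => (hF i).add (hG i)

theorem VanV.sub (hF : VanV n F) (hG : VanV n G) : VanV n fun ξ => F ξ - G ξ :=
  fun i => (hF i).sub (hG i)

theorem VanV.congr (hF : VanV n F) (h : ∀ ξ, F ξ = G ξ) : VanV n G := by rwa [← funext h]

theorem VanV.mono (hF : VanV n F) (h : m ≤ n) : VanV m F := fun i => (hF i).mono h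

theorem VanV.star (hF : VanV n F) : VanV n fun ξ => star (F ξ) := fun i => (hF i).conj

theorem VanV.dotProduct (hF : VanV n F) (hG : ContinuousAt G 0) : Van n fun ξ => F ξ ⬝ᵥ G ξ :=
  Van.sum _ fun i _ => (hF i).mul_right ((continuous_apply i).continuousAt.comp hG)

theorem VanV.mulVec {A : (Fin d → ℝ) → Matrix (Fin s) (Fin r) ℂ} (hF : VanV n F)
    (hA : ContinuousAt A 0) : VanV n fun ξ => A ξ *ᵥ F ξ := fun i =>
  Van.sum Finset.univ (f := fun j ξ => A ξ i j * F ξ j) fun j _ => (hF j).mul_left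
    ((continuous_id.matrix_elem i j).continuousAt.comp hA)

theorem VanV.vecMul {A : (Fin d → ℝ) → Matrix (Fin r) (Fin s) ℂ} (hF : VanV n F)
    (hA : ContinuousAt A 0) : VanV n fun ξ => F ξ ᵥ* A ξ := fun i =>
  Van.sum Finset.univ (f := fun j ξ => F ξ j * A ξ j i) fun j _ => (hF j).mul_right
    ((continuous_id.matrix_elem j i).continuousAt.comp hA)

theorem continuousAt_vecMul {A : (Fin d → ℝ) → Matrix (Fin r) (Fin s) ℂ} (hF : ContinuousAt F 0)
    (hA : ContinuousAt A 0) : ContinuousAt (fun ξ => F ξ ᵥ* A ξ) 0 :=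
  continuousAt_pi.2 fun i => tendsto_finsetSum Finset.univ fun j _ =>
    ((continuous_apply j).continuousAt.comp hF).mul
      ((continuous_id.matrix_elem j i).continuousAt.comp hA)

theorem VanV.comp_mulVec (hF : VanV n F) (A : Matrix (Fin d) (Fin d) ℝ) :
    VanV n fun ξ => F (A *ᵥ ξ) := fun i => (hF i).comp_mulVec A

theorem TrigM.continuous {F : (Fin d → ℝ) → Matrix (Fin s) (Fin r) ℂ} (hF : TrigM F) :
    Continuous F := continuous_matrix fun i j => trig_continuous (hF i j)

theorem TrigM.mul {F : (Fin d → ℝ) → Matrix (Fin s) (Fin r) ℂ}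
    {G : (Fin d → ℝ) → Matrix (Fin r) (Fin t) ℂ} (hF : TrigM F) (hG : TrigM G) :
    TrigM fun ξ => F ξ * G ξ := trig_matrix_mul hF hG

theorem TrigM.const (C : Matrix (Fin s) (Fin r) ℂ) : TrigM fun _ : Fin d → ℝ => C :=
  fun _ _ => const_mem_trig _

theorem TrigM.periodic {F : (Fin d → ℝ) → Matrix (Fin s) (Fin r) ℂ} (hF : TrigM F)
    (ξ : Fin d → ℝ) (l : Fin d → ℤ) : F (ξ + (2 * Real.pi) • realVec l) = F ξ := by
  ext i j; exact trig_periodic (hF i j) ξ l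

theorem TrigM.conjTranspose {F : (Fin d → ℝ) → Matrix (Fin s) (Fin r) ℂ} (hF : TrigM F) :
    TrigM fun ξ => (F ξ)ᴴ := fun i j => trig_conj (hF j i)

theorem TrigM.translate {F : (Fin d → ℝ) → Matrix (Fin s) (Fin r) ℂ} (hF : TrigM F)
    (η : Fin d → ℝ) : TrigM fun ξ => F (ξ + η) := fun i j => trig_translate (hF i j) η

theorem TrigM.dilate {F : (Fin d → ℝ) → Matrix (Fin s) (Fin r) ℂ} (hF : TrigM F)
    (M : Matrix (Fin d) (Fin d) ℤ) : TrigM fun ξ => F ((realMat M)ᵀ *ᵥ ξ) :=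
  fun i j => trig_dilate (hF i j) M

theorem TrigM.mulVec {A : (Fin d → ℝ) → Matrix (Fin s) (Fin r) ℂ} (hA : TrigM A)
    (hF : ∀ i, (fun ξ => F ξ i) ∈ trig d) (i : Fin s) : (fun ξ => (A ξ *ᵥ F ξ) i) ∈ trig d :=
  trig_sum Finset.univ (f := fun j ξ => A ξ i j * F ξ j) fun j _ => trig_mul (hA i j) (hF j)

theorem TrigM.vecMul {A : (Fin d → ℝ) → Matrix (Fin r) (Fin s) ℂ} (hA : TrigM A)
    (hF : ∀ i, (fun ξ => F ξ i) ∈ trig d) (i : Fin s) : (fun ξ => (F ξ ᵥ* A ξ) i) ∈ trig d :=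
  trig_sum Finset.univ (f := fun j ξ => F ξ j * A ξ j i) fun j _ => trig_mul (hF j) (hA j i)

theorem trigM_symb (u : Mask d s r) : TrigM (symb u) := symb_mem_trig u

end

/-- A rank one perturbation of the identity by mutually orthogonal vectors is unipotent. -/
theorem transvection_mul {p q : Fin r → ℂ} (h : q ⬝ᵥ p = 0) :
    (1 + vecMulVec p q) * (1 - vecMulVec p q) = 1 := by
  have h2 : vecMulVec p q * vecMulVec p q = 0 := by
    rw [vecMulVec_mul_vecMulVec, h]
    ext i j; simp [vecMulVec]
  rw [mul_sub, mul_one, add_mul, one_mul, h2]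
  abel

theorem trigM_transvection {p q : (Fin d → ℝ) → Fin r → ℂ} (hp : ∀ i, (fun ξ => p ξ i) ∈ trig d)
    (hq : ∀ i, (fun ξ => q ξ i) ∈ trig d) : TrigM fun ξ => 1 + vecMulVec (p ξ) (q ξ) := by
  intro i j
  exact trig_add (const_mem_trig ((1 : Matrix (Fin r) (Fin r) ℂ) i j)) (trig_mul (hp i) (hq j))

theorem trigM_transvection' {p q : (Fin d → ℝ) → Fin r → ℂ} (hp : ∀ i, (fun ξ => p ξ i) ∈ trig d)
    (hq : ∀ i, (fun ξ => q ξ i) ∈ trig d) : TrigM fun ξ => 1 - vecMulVec (p ξ) (q ξ) := by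
  intro i j
  exact trig_sub (const_mem_trig ((1 : Matrix (Fin r) (Fin r) ℂ) i j)) (trig_mul (hp i) (hq j))

theorem trig_ite {p : Prop} [Decidable p] {f g : (Fin d → ℝ) → ℂ} (hf : f ∈ trig d)
    (hg : g ∈ trig d) : (fun ξ => if p then f ξ else g ξ) ∈ trig d := by
  split_ifs <;> assumption

/-- Elementary operations over the trigonometric polynomials bring a column that does not vanish at
the origin to `e_{i₀}`, up to order `n`. Here the second index `i₁ ≠ i₀` is needed: after a constant
change of coordinates the entry at `i₁` is invertible, and a multiple of it makes the entry at `i₀`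
equal to `1` without dividing the latter by anything. -/
theorem exists_column_normal_form {i₀ i₁ : Fin r} (hi : i₁ ≠ i₀) (hn : n ≠ 0)
    {F : (Fin d → ℝ) → Fin r → ℂ} (hF : ∀ i, Approx n fun ξ => F ξ i) (hF0 : F 0 ≠ 0) :
    ∃ θ θ' : (Fin d → ℝ) → Matrix (Fin r) (Fin r) ℂ, TrigM θ ∧ TrigM θ' ∧
      (∀ ξ, θ ξ * θ' ξ = 1) ∧ VanV n fun ξ => θ ξ *ᵥ F ξ - Pi.single i₀ 1 := by
  choose f hf hfv using hF
  have hf0 : (fun i => f i 0) ≠ 0 := by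
    intro h
    apply hF0
    ext i
    have h1 : F 0 i - f i 0 = 0 := (hfv i).eval_zero hn
    rw [sub_eq_zero.1 h1]
    exact congrFun h i
  obtain ⟨L, hL⟩ := SeparatingDual.exists_continuousLinearEquiv_apply_eq (R := ℂ) hf0
    (show (Pi.single i₁ 1 : Fin r → ℂ) ≠ 0 by simp)
  set C := LinearMap.toMatrix' (L.toLinearEquiv : (Fin r → ℂ) →ₗ[ℂ] (Fin r → ℂ)) with hC
  set C' := LinearMap.toMatrix' (L.symm.toLinearEquiv : (Fin r → ℂ) →ₗ[ℂ] (Fin r → ℂ)) with hC'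
  have hCC : C * C' = 1 := by
    rw [hC, hC', ← LinearMap.toMatrix'_comp, ← LinearMap.toMatrix'_id]
    congr 1
    ext x; simp
  have hC0 : C *ᵥ (fun i => f i 0) = Pi.single i₁ 1 := by
    rw [hC, LinearMap.toMatrix'_mulVec, ← hL]; rfl
  -- the column after the constant change of coordinates
  set f1 : (Fin d → ℝ) → Fin r → ℂ := fun ξ => C *ᵥ fun i => f i ξ with hf1
  have hf1t : ∀ i, (fun ξ => f1 ξ i) ∈ trig d := 
    (TrigM.const C).mulVec hf
  have hf10 : f1 0 i₁ = 1 := by simp [hf1, hC0]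
  obtain ⟨g, hg, hgv⟩ := exists_trig_inverse n (hf1t i₁) (by rw [hf10]; exact one_ne_zero)
  set q1 : (Fin d → ℝ) → Fin r → ℂ := fun ξ => Pi.single i₁ ((1 - f1 ξ i₀) * g ξ) with hq1
  have hq1t : ∀ i, (fun ξ => q1 ξ i) ∈ trig d := fun i => by
    simp only [hq1, Pi.single_apply]
    exact trig_ite (trig_mul (trig_sub (const_mem_trig 1) (hf1t i₀)) hg) (const_mem_trig 0)
  have hq1p : ∀ ξ, q1 ξ ⬝ᵥ (Pi.single i₀ 1 : Fin r → ℂ) = 0 := fun ξ => by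
    simp [hq1, hi.symm]
  set f2 : (Fin d → ℝ) → Fin r → ℂ := fun ξ => (1 + vecMulVec (Pi.single i₀ 1) (q1 ξ)) *ᵥ f1 ξ
    with hf2
  have hp1t : ∀ i, (fun _ : Fin d → ℝ => (Pi.single i₀ 1 : Fin r → ℂ) i) ∈ trig d :=
    fun i => const_mem_trig _
  have hθ1 := trigM_transvection hp1t hq1t
  have hf2t : ∀ i, (fun ξ => f2 ξ i) ∈ trig d := hθ1.mulVec hf1t
  have hf2v : Van n fun ξ => f2 ξ i₀ - 1 := by
    refine (hgv.mul_left (g := fun ξ => 1 - f1 ξ i₀)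
      (trig_continuous (trig_sub (const_mem_trig 1) (hf1t i₀))).continuousAt).congr fun ξ => ?_
    simp only [hf2, add_mulVec, one_mulVec, vecMulVec_mulVec, hq1, single_dotProduct,
      Pi.add_apply, Pi.smul_apply, Pi.single_eq_same, op_smul_eq_smul, smul_eq_mul]
    ring
  set p2 : (Fin d → ℝ) → Fin r → ℂ := fun ξ i => if i = i₀ then 0 else -f2 ξ i with hp2
  have hp2t : ∀ i, (fun ξ => p2 ξ i) ∈ trig d := fun i =>
    trig_ite (const_mem_trig 0) ((trig d).neg_mem (hf2t i))
  have hp2q : ∀ ξ, (Pi.single i₀ 1 : Fin r → ℂ) ⬝ᵥ p2 ξ = 0 := fun ξ => by simp [hp2]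
  have hθ2 := trigM_transvection hp2t hp1t
  have hf3 : VanV n fun ξ =>
      (1 + vecMulVec (p2 ξ) (Pi.single i₀ 1)) *ᵥ f2 ξ - Pi.single i₀ 1 := by
    intro i
    have hform : ∀ ξ,
        ((1 + vecMulVec (p2 ξ) (Pi.single i₀ 1)) *ᵥ f2 ξ - Pi.single i₀ 1 : Fin r → ℂ) i
        = f2 ξ i + f2 ξ i₀ * p2 ξ i - (Pi.single i₀ 1 : Fin r → ℂ) i := fun ξ => by
      simp [add_mulVec, vecMulVec_mulVec]
    by_cases hii : i = i₀
    · subst hii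
      exact hf2v.congr fun ξ => by refine Eq.trans ?_ (hform ξ).symm; simp [hp2]
    · refine (hf2v.mul_left (g := fun ξ => -f2 ξ i)
        (trig_continuous ((trig d).neg_mem (hf2t i))).continuousAt).congr fun ξ => ?_
      refine Eq.trans ?_ (hform ξ).symm; simp [hp2, hii]; ring
  have hθt : TrigM fun ξ => (1 + vecMulVec (p2 ξ) (Pi.single i₀ 1)) *
      ((1 + vecMulVec (Pi.single i₀ 1) (q1 ξ)) * C) := hθ2.mul (hθ1.mul (TrigM.const C))
  refine ⟨_, fun ξ => C' * (1 - vecMulVec (Pi.single i₀ 1) (q1 ξ)) *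
    (1 - vecMulVec (p2 ξ) (Pi.single i₀ 1)), hθt,
    ((TrigM.const C').mul (trigM_transvection' hp1t hq1t)).mul (trigM_transvection' hp2t hp1t),
    fun ξ => ?_, ?_⟩
  · have e1 := transvection_mul (hq1p ξ)
    have e2 := transvection_mul (hp2q ξ)
    calc _ = (1 + vecMulVec (p2 ξ) (Pi.single i₀ 1)) * ((1 + vecMulVec (Pi.single i₀ 1) (q1 ξ)) *
          (C * C') * (1 - vecMulVec (Pi.single i₀ 1) (q1 ξ))) *
          (1 - vecMulVec (p2 ξ) (Pi.single i₀ 1)) := by simp only [mul_assoc]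
      _ = 1 := by rw [hCC, mul_one, e1, mul_one, e2]
  · have h1 : VanV n fun ξ => F ξ - fun i => f i ξ := fun i => hfv i
    refine ((h1.mulVec hθt.continuous.continuousAt).add hf3).congr fun ξ => ?_
    simp only [hf2, hf1, mulVec_mulVec, mulVec_sub]
    abel

/-- Given a column `F` and a row `G` with `G F = 1 + O(‖ξ‖^m)`, a strongly invertible matrix brings
`F` to `e_{i₀}` and `G` to its transpose, up to the orders `n` and `m`. -/
theorem exists_normal_form (hr : 2 ≤ r) (i₀ : Fin r) (hm : m ≠ 0) (hmn : m ≤ n)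
    {F G : (Fin d → ℝ) → Fin r → ℂ} (hF : ∀ i, Approx n fun ξ => F ξ i) (hF0 : F 0 ≠ 0)
    (hG : ∀ i, Approx m fun ξ => G ξ i) (hGF : Van m fun ξ => G ξ ⬝ᵥ F ξ - 1) :
    ∃ θ θ' : (Fin d → ℝ) → Matrix (Fin r) (Fin r) ℂ, TrigM θ ∧ TrigM θ' ∧
      (∀ ξ, θ ξ * θ' ξ = 1) ∧ (VanV n fun ξ => θ ξ *ᵥ F ξ - Pi.single i₀ 1) ∧
      VanV m fun ξ => G ξ ᵥ* θ' ξ - Pi.single i₀ 1 := by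
  obtain ⟨i₁, hi⟩ : ∃ i₁ : Fin r, i₁ ≠ i₀ := by
    have : Nontrivial (Fin r) := Fin.nontrivial_iff_two_le.2 hr
    exact exists_ne i₀
  have hn : n ≠ 0 := by omega
  obtain ⟨A, A', hA, hA', hAA, hAF⟩ := exists_column_normal_form hi hn hF hF0
  have hAA' : ∀ ξ, A' ξ * A ξ = 1 := fun ξ => mul_eq_one_comm.1 (hAA ξ)
  have hGc : ContinuousAt G 0 := continuousAt_pi.2 fun i => (hG i).continuousAt hm
  -- the row in the coordinates of the normalized column
  set H : (Fin d → ℝ) → Fin r → ℂ := fun ξ => G ξ ᵥ* A' ξ with hH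
  have hHc : ContinuousAt H 0 := continuousAt_vecMul hGc hA'.continuous.continuousAt
  have hHa : ∀ i, Approx m fun ξ => H ξ i := fun i =>
    Approx.sum _ fun j _ => (hG j).mul (Approx.of_trig (hA' j i))
  have hH0 : Van m fun ξ => H ξ i₀ - 1 := by
    have h1 := ((hAF.mono hmn).dotProduct hHc)
    refine (hGF.sub h1).congr fun ξ => ?_
    rw [dotProduct_comm (A ξ *ᵥ F ξ - Pi.single i₀ 1), dotProduct_sub, dotProduct_mulVec]
    simp only [hH, vecMul_vecMul, hAA', vecMul_one, dotProduct_single, mul_one]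
    ring
  choose w hw hwv using hHa
  set q : (Fin d → ℝ) → Fin r → ℂ := fun ξ i => if i = i₀ then 0 else w i ξ with hq
  have hqt : ∀ i, (fun ξ => q ξ i) ∈ trig d := fun i => trig_ite (const_mem_trig 0) (hw i)
  have hqp : ∀ ξ, q ξ ⬝ᵥ (Pi.single i₀ 1 : Fin r → ℂ) = 0 := fun ξ => by simp [hq]
  have hpt : ∀ i, (fun _ : Fin d → ℝ => (Pi.single i₀ 1 : Fin r → ℂ) i) ∈ trig d :=
    fun i => const_mem_trig _
  have hT := trigM_transvection hpt hqt
  have hT' := trigM_transvection' hpt hqt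
  refine ⟨_, _, hT.mul hA, hA'.mul hT', fun ξ => ?_, ?_, fun j => ?_⟩
  · calc _ = (1 + vecMulVec (Pi.single i₀ 1) (q ξ)) * (A ξ * A' ξ) *
        (1 - vecMulVec (Pi.single i₀ 1) (q ξ)) := by simp only [mul_assoc]
      _ = 1 := by rw [hAA, mul_one, transvection_mul (hqp ξ)]
  · refine (hAF.mulVec hT.continuous.continuousAt).congr fun ξ => ?_
    rw [mulVec_sub, mulVec_mulVec]
    congr 1
    rw [add_mulVec, one_mulVec, vecMulVec_mulVec, hqp]
    simp
  · have hform : ∀ ξ, (G ξ ᵥ* (A' ξ * (1 - vecMulVec (Pi.single i₀ 1) (q ξ)))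
        - Pi.single i₀ 1 : Fin r → ℂ) j
          = H ξ j - H ξ i₀ * q ξ j - (Pi.single i₀ 1 : Fin r → ℂ) j := by
      intro ξ
      rw [← vecMul_vecMul, vecMul_sub, vecMul_one, vecMul_vecMulVec]
      simp [hH]
    by_cases hj : j = i₀
    · subst hj
      exact hH0.congr fun ξ => by refine Eq.trans ?_ (hform ξ).symm; simp [hq]
    · refine ((hwv j).sub (hH0.mul_right (trig_continuous (hw j)).continuousAt)).congr fun ξ => ?_
      refine Eq.trans ?_ (hform ξ).symm; simp [hq, hj]; ring

end NormalForm

/-! ### Indefinite factorization with prescribed vanishing -/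

section Factorization
variable {d r : ℕ}

/-- The frequency `2π M^{-T} k`. -/
noncomputable def dualFreq (M : Matrix (Fin d) (Fin d) ℤ) (k : Fin d → ℤ) : Fin d → ℝ :=
  (2 * Real.pi) • (((realMat M)ᵀ)⁻¹ *ᵥ realVec k)

/-- `k` lies in `Mᵀ ℤ^d`, that is, `M^{-T} k` is an integer vector. -/
def InDual (M : Matrix (Fin d) (Fin d) ℤ) (k : Fin d → ℤ) : Prop := ∃ l, k = Mᵀ *ᵥ l

variable {M : Matrix (Fin d) (Fin d) ℤ}

theorem dualFreq_add (k l : Fin d → ℤ) : dualFreq M (k + l) = dualFreq M k + dualFreq M l := by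
  rw [dualFreq, realVec_add, mulVec_add, smul_add]; rfl

theorem dualFreq_zero : dualFreq M 0 = 0 := by simp [dualFreq]

theorem dualFreq_neg (k : Fin d → ℤ) : dualFreq M (-k) = -dualFreq M k := by
  rw [dualFreq, realVec_neg, mulVec_neg, smul_neg]; rfl

theorem dualFreq_dual (hM : M.det ≠ 0) (l : Fin d → ℤ) :
    dualFreq M (Mᵀ *ᵥ l) = (2 * Real.pi) • realVec l := by
  rw [dualFreq, realMat_transpose, ← realMat_mulVec, realMat_inv_mulVec (by rwa [det_transpose])]

theorem InDual.add {k l : Fin d → ℤ} (hk : InDual M k) (hl : InDual M l) : InDual M (k + l) := by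
  obtain ⟨a, rfl⟩ := hk
  obtain ⟨b, rfl⟩ := hl
  exact ⟨a + b, (mulVec_add _ _ _).symm⟩

theorem InDual.neg {k : Fin d → ℤ} (hk : InDual M k) : InDual M (-k) := by
  obtain ⟨a, rfl⟩ := hk
  exact ⟨-a, (mulVec_neg _ _).symm⟩

theorem inDual_zero : InDual M 0 := ⟨0, (mulVec_zero _).symm⟩

theorem inDual_neg_iff {k : Fin d → ℤ} : InDual M (-k) ↔ InDual M k :=
  ⟨fun h => by simpa using h.neg, InDual.neg⟩

theorem InDual.add_iff {k l : Fin d → ℤ} (hl : InDual M l) : InDual M (k + l) ↔ InDual M k :=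
  ⟨fun h => by simpa using h.add hl.neg, fun h => h.add hl⟩

theorem TrigM.dual_periodic (hM : M.det ≠ 0) {s t : ℕ}
    {F : (Fin d → ℝ) → Matrix (Fin s) (Fin t) ℂ} (hF : TrigM F) (ξ : Fin d → ℝ) (k : Fin d → ℤ)
    {l : Fin d → ℤ} (hl : InDual M l) : F (ξ + dualFreq M (k + l)) = F (ξ + dualFreq M k) := by
  obtain ⟨j, rfl⟩ := hl
  rw [dualFreq_add, dualFreq_dual hM, ← add_assoc, hF.periodic]

theorem trig_dual_periodic (hM : M.det ≠ 0) {f : (Fin d → ℝ) → ℂ} (hf : f ∈ trig d)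
    (ξ : Fin d → ℝ) (k : Fin d → ℤ) {l : Fin d → ℤ} (hl : InDual M l) :
    f (ξ + dualFreq M (k + l)) = f (ξ + dualFreq M k) := by
  obtain ⟨j, rfl⟩ := hl
  rw [dualFreq_add, dualFreq_dual hM, ← add_assoc, trig_periodic hf]

/-- Families of matrix functions indexed by the dual lattice points `M^{-T} k`. -/
abbrev Kern (d r : ℕ) : Type := (Fin d → ℤ) → (Fin d → ℝ) → Matrix (Fin r) (Fin r) ℂ

/-- The kernel `v(ξ)ᴴ w(ξ + 2π M^{-T} k)` of two row vectors of functions. -/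
noncomputable def tensorKern (M : Matrix (Fin d) (Fin d) ℤ) (v w : (Fin d → ℝ) → Fin r → ℂ) :
    Kern d r :=
  fun k ξ => vecMulVec (star (v ξ)) (w (ξ + dualFreq M k))

/-- The adjoint of a kernel, for which `v ⊗ w` becomes `w ⊗ v`. -/
noncomputable def adjKern (M : Matrix (Fin d) (Fin d) ℤ) (K : Kern d r) : Kern d r :=
  fun k ξ => (K (-k) (ξ + dualFreq M k))ᴴ

theorem adjKern_tensorKern (v w : (Fin d → ℝ) → Fin r → ℂ) :
    adjKern M (tensorKern M v w) = tensorKern M w v := by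
  funext k ξ
  simp only [adjKern, tensorKern, dualFreq_neg, add_neg_cancel_right, conjTranspose_vecMulVec,
    star_star]

/-- The rows of trigonometric polynomials annihilating `u` to order `m` at the origin. -/
def annRows (m : ℕ) (u : (Fin d → ℝ) → Fin r → ℂ) : Set ((Fin d → ℝ) → Fin r → ℂ) :=
  {v | (∀ i, (fun ξ => v ξ i) ∈ trig d) ∧ Van m fun ξ => v ξ ⬝ᵥ u ξ}

/-- The sums of the kernels `v ⊗ w` with rows `v`, `w` annihilating `u` to order `m`. -/
noncomputable def kernSpan (M : Matrix (Fin d) (Fin d) ℤ) (m : ℕ)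
    (u : (Fin d → ℝ) → Fin r → ℂ) : AddSubmonoid (Kern d r) :=
  AddSubmonoid.closure {K | ∃ v ∈ annRows m u, ∃ w ∈ annRows m u, K = tensorKern M v w}

/-- Polarization: the Hermitian part of a sum of kernels `v ⊗ w` is a signed sum of kernels
`b ⊗ b`. -/
theorem exists_signed_squares {m : ℕ} {u : (Fin d → ℝ) → Fin r → ℂ} {K : Kern d r}
    (hK : K ∈ kernSpan M m u) :
    ∃ (s : ℕ) (B : Fin s → (Fin d → ℝ) → Fin r → ℂ) (ε : Fin s → ℂ),
      (∀ l, ε l = 1 ∨ ε l = -1) ∧ (∀ l, B l ∈ annRows m u) ∧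
      ∀ k ξ, (1 / 2 : ℂ) • (K k ξ + adjKern M K k ξ) = ∑ l, ε l • tensorKern M (B l) (B l) k ξ := by
  refine AddSubmonoid.closure_induction (motive := fun K _ =>
    ∃ (s : ℕ) (B : Fin s → (Fin d → ℝ) → Fin r → ℂ) (ε : Fin s → ℂ),
      (∀ l, ε l = 1 ∨ ε l = -1) ∧ (∀ l, B l ∈ annRows m u) ∧
      ∀ k ξ, (1 / 2 : ℂ) • (K k ξ + adjKern M K k ξ)
        = ∑ l, ε l • tensorKern M (B l) (B l) k ξ) ?_ ?_ ?_ hK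
  · rintro _ ⟨v, ⟨hv, hvu⟩, w, ⟨hw, hwu⟩, rfl⟩
    refine ⟨2, ![fun ξ => (1 / 2 : ℂ) • (v ξ + w ξ), fun ξ => (1 / 2 : ℂ) • (v ξ - w ξ)],
      ![1, -1], ?_, ?_, ?_⟩
    · intro l; fin_cases l <;> simp
    · intro l
      fin_cases l
      · refine ⟨fun i => trig_mul (const_mem_trig _) (trig_add (hv i) (hw i)), ?_⟩
        refine ((hvu.add hwu).mul_left (g := fun _ => 1 / 2) continuousAt_const).congr fun ξ => ?_
        simp [smul_dotProduct, add_dotProduct, mul_add]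
      · refine ⟨fun i => trig_mul (const_mem_trig _) (trig_sub (hv i) (hw i)), ?_⟩
        refine ((hvu.sub hwu).mul_left (g := fun _ => 1 / 2) continuousAt_const).congr fun ξ => ?_
        simp [smul_dotProduct, sub_dotProduct]
    · intro k ξ
      rw [adjKern_tensorKern]
      ext i j
      simp [tensorKern, Fin.sum_univ_two, vecMulVec_apply]
      ring
  · exact ⟨0, Fin.elim0, Fin.elim0, fun l => l.elim0, fun l => l.elim0, fun k ξ => by
      simp [adjKern]⟩
  · rintro K L - - ⟨s, B, ε, h1, h2, h3⟩ ⟨s', B', ε', h1', h2', h3'⟩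
    refine ⟨s + s', Fin.append B B', Fin.append ε ε', fun l => ?_, fun l => ?_, fun k ξ => ?_⟩
    · induction l using Fin.addCases with
      | left l => simpa using h1 l
      | right l => simpa using h1' l
    · induction l using Fin.addCases with
      | left l => simpa using h2 l
      | right l => simpa using h2' l
    · have e : (1 / 2 : ℂ) • ((K + L) k ξ + adjKern M (K + L) k ξ)
          = (1 / 2 : ℂ) • (K k ξ + adjKern M K k ξ) + (1 / 2 : ℂ) • (L k ξ + adjKern M L k ξ) := by
        simp only [adjKern, Pi.add_apply, conjTranspose_add]
        rw [← smul_add]; congr 1; abel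
      rw [e, h3, h3']
      simp [Fin.sum_univ_add]

open scoped Classical in
/-- The kernel that equals `p(ξ)̄ q(ξ + 2π M^{-T}k₀) R(ξ)ᴴ S(ξ + 2π M^{-T}k₀)` on the class of `k₀`
and vanishes on all other classes lies in the span: the indicator of a class is a combination of
characters. -/
theorem class_kern_mem (hM : M.det ≠ 0) {m : ℕ} {u : (Fin d → ℝ) → Fin r → ℂ} (k₀ : Fin d → ℤ)
    {p q : (Fin d → ℝ) → ℂ} {R S : (Fin d → ℝ) → Fin r → ℂ}
    (hp : (fun ξ => p ξ • R ξ) ∈ annRows m u) (hq : (fun ξ => q ξ • S ξ) ∈ annRows m u)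
    (hqt : q ∈ trig d) :
    (fun k ξ => if InDual M (k - k₀) then
      (conj (p ξ) * q (ξ + dualFreq M k₀)) • vecMulVec (star (R ξ)) (S (ξ + dualFreq M k))
      else 0) ∈ kernSpan M m u := by
  have := finite_latticeQuot hM
  let _ : Fintype (LatticeQuot M) := Fintype.ofFinite _
  set D : ℂ := ((|(realMat M).det| : ℝ) : ℂ) with hD
  have hD0 : D ≠ 0 := by
    rw [hD, ofReal_ne_zero, abs_ne_zero]
    exact (realMat_isUnit_det hM).ne_zero
  have hmul : ∀ {v : (Fin d → ℝ) → Fin r → ℂ} (c : ℂ) (x : Fin d → ℤ), v ∈ annRows m u →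
      (fun ξ => (c * chr x ξ) • v ξ) ∈ annRows m u := by
    rintro v c x ⟨h1, h2⟩
    have ht : (fun ξ => c * chr x ξ) ∈ trig d := trig_mul (const_mem_trig c) (chr_mem_trig x)
    refine ⟨fun i => trig_mul ht (h1 i), ?_⟩
    refine (h2.mul_left (trig_continuous ht).continuousAt).congr fun ξ => ?_
    rw [smul_dotProduct, smul_eq_mul]
  have hsum : ∑ x : LatticeQuot M, tensorKern M
      (fun ξ => (1 * chr (Quotient.out x) ξ) • (p ξ • R ξ))
      (fun ξ => (D⁻¹ * conj (chr (Quotient.out x) (dualFreq M k₀)) * chr (Quotient.out x) ξ) •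
        (q ξ • S ξ)) ∈ kernSpan M m u :=
    sum_mem fun x _ => AddSubmonoid.subset_closure ⟨_, hmul _ _ hp, _, hmul _ _ hq, rfl⟩
  convert hsum using 1
  funext k ξ
  have hchr : ∀ x : LatticeQuot M, conj (chr (Quotient.out x) ξ) *
      (conj (chr (Quotient.out x) (dualFreq M k₀)) * chr (Quotient.out x) (ξ + dualFreq M k))
      = chr (Quotient.out x) ((2 * Real.pi) • (((realMat M)ᵀ)⁻¹ *ᵥ realVec (k - k₀))) := by
    intro x
    change _ = chr (Quotient.out x) (dualFreq M (k - k₀))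
    rw [sub_eq_add_neg, dualFreq_add, dualFreq_neg, chr_add_right, chr_add_right, conj_chr,
      conj_chr, chr_neg_right]
    linear_combination (chr (-Quotient.out x) (dualFreq M k₀) *
      chr (Quotient.out x) (dualFreq M k)) * chr_neg_mul (Quotient.out x) ξ
  have horth := sum_chr_latticeQuot hM (k - k₀)
  simp only [← hchr] at horth
  simp only [Finset.sum_apply, tensorKern]
  have hterm : ∀ x : LatticeQuot M, vecMulVec
      (star ((1 * chr (Quotient.out x) ξ) • (p ξ • R ξ)))
      ((D⁻¹ * conj (chr (Quotient.out x) (dualFreq M k₀)) *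
        chr (Quotient.out x) (ξ + dualFreq M k)) •
        (q (ξ + dualFreq M k) • S (ξ + dualFreq M k)))
      = (conj (chr (Quotient.out x) ξ) * (conj (chr (Quotient.out x) (dualFreq M k₀)) *
          chr (Quotient.out x) (ξ + dualFreq M k))) •
        ((D⁻¹ * (conj (p ξ) * q (ξ + dualFreq M k))) •
          vecMulVec (star (R ξ)) (S (ξ + dualFreq M k))) := by
    intro x
    ext i j
    simp [vecMulVec_apply]
    ring
  simp only [hterm, ← Finset.sum_smul, horth]
  by_cases hk : InDual M (k - k₀)
  · rw [if_pos hk, if_pos (show ∃ l, _ from hk), smul_smul, ← mul_assoc, ← hD,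
      mul_inv_cancel₀ hD0, one_mul]
    have := trig_dual_periodic hM hqt ξ k₀ hk
    rw [add_sub_cancel] at this
    rw [this]
  · rw [if_neg hk, if_neg (show ¬ ∃ l, _ from hk), zero_smul]

/-- A scalar function separating the origin from the point `-2π M^{-T} k`, for `M^{-T} k` not an
integer vector: it vanishes to order `m` at the origin, and it equals `1` to order `m` at the other
point. -/
theorem exists_separating (hM : M.det ≠ 0) (m : ℕ) {k : Fin d → ℤ} (hk : ¬ InDual M k) :
    ∃ η ∈ trig d, Van m η ∧ Van m fun ξ => 1 - η (ξ - dualFreq M k) := by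
  have h1 : ¬ ∀ j : Fin d → ℤ, chr j ((2 * Real.pi) • (-(((realMat M)ᵀ)⁻¹ *ᵥ realVec k))) = 1 := by
    rw [chr_two_pi_eq_one_iff]
    rintro ⟨l, hl⟩
    refine hk ⟨-l, realVec_injective ?_⟩
    have hMt : Mᵀ.det ≠ 0 := by rwa [det_transpose]
    rw [← realMat_mulVec, realVec_neg, ← hl, neg_neg, realMat_transpose, realMat_mulVec_inv hMt]
  push Not at h1
  obtain ⟨j, hj⟩ := h1
  have hω : (2 * Real.pi) • (-(((realMat M)ᵀ)⁻¹ *ᵥ realVec k)) = -dualFreq M k := by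
    rw [smul_neg]; rfl
  rw [hω] at hj
  -- `g` is `0` at the origin and `1` at the other point; `1 - (1 - g ^ m) ^ m` raises both orders
  set g : (Fin d → ℝ) → ℂ := fun ξ => (1 - chr j (-dualFreq M k))⁻¹ * (1 - chr j ξ) with hg
  have hgt : g ∈ trig d :=
    trig_mul (const_mem_trig _) (trig_sub (const_mem_trig 1) (chr_mem_trig j))
  have hg0 : Van 1 g := trig_van_one hgt (by simp [hg, chr_zero_right])
  have hgm : (fun ξ => 1 - g ξ ^ m) ∈ trig d := trig_sub (const_mem_trig 1) (trig_pow hgt m)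
  refine ⟨fun ξ => 1 - (1 - g ξ ^ m) ^ m, trig_sub (const_mem_trig 1) (trig_pow hgm m), ?_, ?_⟩
  · have h2 : Van m fun ξ => g ξ ^ m := by simpa using hg0.pow m
    have h3 : (fun ξ => ∑ i ∈ Finset.range m, (1 - g ξ ^ m) ^ i) ∈ trig d :=
      trig_sum _ fun i _ => trig_pow hgm i
    refine (h2.mul_left (trig_continuous h3).continuousAt).congr fun ξ => ?_
    have := geom_sum_mul_neg (1 - g ξ ^ m) m
    rw [sub_sub_cancel] at this
    exact this
  · have ht : (fun ξ => 1 - g (ξ - dualFreq M k) ^ m) ∈ trig d := by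
      simpa only [sub_eq_add_neg] using trig_translate hgm (-dualFreq M k)
    have h4 : g (-dualFreq M k) = 1 := inv_mul_cancel₀ (sub_ne_zero.2 (Ne.symm hj))
    have h2 : Van 1 fun ξ => 1 - g (ξ - dualFreq M k) ^ m := trig_van_one ht (by simp [h4])
    have h3 : Van m fun ξ => (1 - g (ξ - dualFreq M k) ^ m) ^ m := by simpa using h2.pow m
    exact h3.congr fun ξ => by ring

open scoped Classical in
/-- The kernel `δ(ω) I - A(ξ)ᴴ A(ξ + 2πω)` is the indefinite square of a matrix of trigonometric
polynomials whose rows annihilate `u` to order `m`. Here `u` is a unit vector which `A` reproduces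
to order `2m` and whose adjoint is a matching filter of order `m`. In the coordinates given by `T`,
where `u` becomes `e_{i₀}`, the entries of the kernel vanish to the orders needed to write them as
products: order `2m` on the diagonal class, and order `m` at two different points on the others. -/
theorem exists_factorization (hM : M.det ≠ 0) {m : ℕ} {i₀ : Fin r}
    {A T T' : (Fin d → ℝ) → Matrix (Fin r) (Fin r) ℂ} (hA : TrigM A) (hT : TrigM T)
    (hT' : TrigM T') (hTT : ∀ ξ, T ξ * T' ξ = 1) {u : (Fin d → ℝ) → Fin r → ℂ}
    (huc : Continuous u) (hu : ∀ ξ, star (u ξ) ⬝ᵥ u ξ = 1)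
    (hTu : VanV (m + m) fun ξ => T ξ *ᵥ u ξ - Pi.single i₀ 1)
    (hAu : VanV (m + m) fun ξ => A ξ *ᵥ u ξ - u ((realMat M)ᵀ *ᵥ ξ))
    (hsr : ∀ k, VanV m fun ξ => star (u ((realMat M)ᵀ *ᵥ ξ)) ᵥ* A (ξ + dualFreq M k)
      - if InDual M k then star (u ξ) else 0) :
    ∃ (s : ℕ) (B : (Fin d → ℝ) → Matrix (Fin s) (Fin r) ℂ) (ε : Fin s → ℂ), TrigM B ∧
      (∀ l, ε l = 1 ∨ ε l = -1) ∧ (VanV m fun ξ => B ξ *ᵥ u ξ) ∧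
      ∀ k ξ, (A ξ)ᴴ * A (ξ + dualFreq M k) + (B ξ)ᴴ * Matrix.diagonal ε * B (ξ + dualFreq M k)
        = if InDual M k then 1 else 0 := by
  have hTT' : ∀ ξ, T' ξ * T ξ = 1 := fun ξ => mul_eq_one_comm.1 (hTT ξ)
  set K : Kern d r := fun k ξ =>
    (if InDual M k then (1 : Matrix (Fin r) (Fin r) ℂ) else 0) - (A ξ)ᴴ * A (ξ + dualFreq M k)
    with hK
  set K1 : Kern d r := fun k ξ => (T' ξ)ᴴ * K k ξ * T' (ξ + dualFreq M k) with hK1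
  have hKadj : adjKern M K = K := by
    funext k ξ
    simp only [adjKern, hK, inDual_neg_iff, dualFreq_neg, add_neg_cancel_right, conjTranspose_sub,
      conjTranspose_mul, conjTranspose_conjTranspose]
    split_ifs <;> simp
  have hK1adj : adjKern M K1 = K1 := by
    funext k ξ
    have h1 : (K (-k) (ξ + dualFreq M k))ᴴ = K k ξ := congrFun (congrFun hKadj k) ξ
    simp only [adjKern, hK1, dualFreq_neg, add_neg_cancel_right, conjTranspose_mul,
      conjTranspose_conjTranspose, h1, mul_assoc]
  have hKt : ∀ k, TrigM (K k) := fun k i j =>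
    trig_sub (const_mem_trig ((if InDual M k then (1 : Matrix (Fin r) (Fin r) ℂ) else 0) i j))
      ((hA.conjTranspose.mul (hA.translate _)) i j)
  have hK1t : ∀ k, TrigM (K1 k) := fun k =>
    (hT'.conjTranspose.mul (hKt k)).mul (hT'.translate _)
  have hK1per : ∀ k l ξ, InDual M l → K1 (k + l) ξ = K1 k ξ := by
    intro k l ξ hl
    simp only [hK1, hK, hA.dual_periodic hM ξ k hl, hT'.dual_periodic hM ξ k hl, hl.add_iff]
  -- the column `T' e_{i₀}` agrees with `u` to order `2m`
  set x : (Fin d → ℝ) → Fin r → ℂ := fun ξ => T' ξ *ᵥ Pi.single i₀ 1 with hx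
  have hxc : Continuous x := hT'.continuous.matrix_mulVec continuous_const
  have hxu : VanV (m + m) fun ξ => x ξ - u ξ := by
    have h1 : VanV (m + m) fun ξ => -(T' ξ *ᵥ (T ξ *ᵥ u ξ - Pi.single i₀ 1)) := fun i =>
      (hTu.mulVec hT'.continuous.continuousAt i).neg
    refine h1.congr fun ξ => ?_
    rw [mulVec_sub, mulVec_mulVec, hTT', one_mulVec, neg_sub]
  have hAx : VanV (m + m) fun ξ => A ξ *ᵥ x ξ - u ((realMat M)ᵀ *ᵥ ξ) := by
    refine ((hxu.mulVec hA.continuous.continuousAt).add hAu).congr fun ξ => ?_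
    rw [mulVec_sub]; abel
  have hrow : ∀ k, VanV m fun ξ => star (x ξ) ᵥ* K k ξ := by
    intro k
    have h1 := (hsr k)
    have h2 := ((hxu.mono (Nat.le_add_right m m)).star.vecMul
      (A := fun _ => if InDual M k then (1 : Matrix (Fin r) (Fin r) ℂ) else 0) continuousAt_const)
    have h3 := ((hAx.mono (Nat.le_add_right m m)).star.vecMul
      (hA.translate (dualFreq M k)).continuous.continuousAt)
    refine ((h2.sub h1).sub h3).congr fun ξ => ?_
    simp only [hK, vecMul_sub, ← vecMul_vecMul, star_sub, sub_vecMul, star_mulVec]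
    split_ifs
    · simp
    · simp; abel
  -- the orders of vanishing of the entries in the new coordinates
  have hC1 : ∀ k j, Van m fun ξ => K1 k ξ i₀ j := by
    intro k j
    have h1 := (hrow k).vecMul (hT'.translate (dualFreq M k)).continuous.continuousAt
    refine (h1 j).congr fun ξ => ?_
    have h2 : star (x ξ) = (T' ξ)ᴴ i₀ := by
      ext i; simp [hx]
    simp only [hK1, h2]
    rfl
  have hC2 : ∀ k i, Van m fun ξ => K1 k (ξ - dualFreq M k) i i₀ := by
    intro k i
    refine (hC1 (-k) i).conj.congr fun ξ => ?_
    have h1 := congrFun (congrFun hK1adj k) (ξ - dualFreq M k)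
    rw [← h1]
    simp [adjKern]
  have hC3 : Van (m + m) fun ξ => K1 0 ξ i₀ i₀ := by
    have h1 : Van (m + m) fun ξ => star (x ξ) ⬝ᵥ x ξ - 1 := by
      have e1 := (hxu.star.dotProduct (G := x) hxc.continuousAt)
      have e2 := (hxu.dotProduct (G := fun ξ => star (u ξ)) huc.star.continuousAt)
      refine (e1.add e2).congr fun ξ => ?_
      rw [star_sub, sub_dotProduct, dotProduct_comm (x ξ - u ξ), dotProduct_sub, hu]
      ring
    have h2 : Van (m + m) fun ξ => star (A ξ *ᵥ x ξ) ⬝ᵥ (A ξ *ᵥ x ξ) - 1 := by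
      have hc1 : Continuous fun ξ => A ξ *ᵥ x ξ := hA.continuous.matrix_mulVec hxc
      have hc2 : Continuous fun ξ : Fin d → ℝ => u ((realMat M)ᵀ *ᵥ ξ) :=
        huc.comp (by fun_prop)
      have e1 := (hAx.star.dotProduct (G := fun ξ => A ξ *ᵥ x ξ) hc1.continuousAt)
      have e2 := (hAx.dotProduct (G := fun ξ => star (u ((realMat M)ᵀ *ᵥ ξ)))
        hc2.star.continuousAt)
      refine (e1.add e2).congr fun ξ => ?_
      rw [star_sub, sub_dotProduct, dotProduct_comm (A ξ *ᵥ x ξ - _), dotProduct_sub, hu]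
      ring
    refine (h1.sub h2).congr fun ξ => ?_
    have e : K1 0 ξ i₀ i₀ = star (x ξ) ⬝ᵥ (K 0 ξ *ᵥ x ξ) := by
      have h3 : star (x ξ) = (T' ξ)ᴴ i₀ := by
        ext i; simp [hx]
      have h4 : x ξ = fun i => T' ξ i i₀ := by
        ext i; simp [hx]
      rw [dotProduct_mulVec, h3, h4]
      simp only [hK1, dualFreq_zero, add_zero]
      rfl
    rw [e]
    simp only [hK, if_pos inDual_zero, dualFreq_zero, add_zero, sub_mulVec, one_mulVec,
      dotProduct_sub, ← mulVec_mulVec]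
    rw [dotProduct_mulVec _ (A ξ)ᴴ, ← star_mulVec]
    ring
  -- rows in the new coordinates
  have hrow0 : ∀ {p : (Fin d → ℝ) → ℂ}, p ∈ trig d → Van m p →
      (fun ξ => p ξ • T ξ i₀) ∈ annRows m u := by
    intro p hp hpv
    refine ⟨fun j => trig_mul hp (hT i₀ j), ?_⟩
    have hc : Continuous fun ξ => T ξ i₀ ⬝ᵥ u ξ := by
      refine Continuous.dotProduct ?_ huc
      exact continuous_pi fun j => hT.continuous.matrix_elem i₀ j
    refine (hpv.mul_right hc.continuousAt).congr fun ξ => ?_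
    rw [smul_dotProduct, smul_eq_mul]
  have hrow1 : ∀ {p : (Fin d → ℝ) → ℂ} {i : Fin r}, i ≠ i₀ → p ∈ trig d →
      (fun ξ => p ξ • T ξ i) ∈ annRows m u := by
    intro p i hi hp
    refine ⟨fun j => trig_mul hp (hT i j), ?_⟩
    have hv : Van m fun ξ => T ξ i ⬝ᵥ u ξ :=
      ((hTu i).mono (Nat.le_add_right m m)).congr fun ξ => by
        simp [hi, mulVec]
    refine (hv.mul_left (trig_continuous hp).continuousAt).congr fun ξ => ?_
    rw [smul_dotProduct, smul_eq_mul]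
  have hone : (fun _ : Fin d → ℝ => (1 : ℂ)) ∈ trig d := const_mem_trig 1
  have hback : ∀ (k₀ : Fin d → ℤ) {f : (Fin d → ℝ) → ℂ}, f ∈ trig d →
      (fun ξ => f (ξ - dualFreq M k₀)) ∈ trig d := fun k₀ f hf => by
    simpa only [sub_eq_add_neg] using trig_translate hf (-dualFreq M k₀)
  -- each entry on each class belongs to the span
  have hentry : ∀ (k₀ : Fin d → ℤ) (i j : Fin r),
      (fun k ξ => if InDual M (k - k₀) then
        (K1 k₀ ξ i j) • vecMulVec (star (T ξ i)) (T (ξ + dualFreq M k) j) else 0)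
        ∈ kernSpan M m u := by
    intro k₀ i j
    set κ : (Fin d → ℝ) → ℂ := fun ξ => K1 k₀ ξ i j with hκ
    have hκt : κ ∈ trig d := hK1t k₀ i j
    by_cases hi : i = i₀
    · subst hi
      have hκ0 : Van m κ := hC1 k₀ j
      by_cases hj : j = i
      · subst hj
        by_cases hk₀ : InDual M k₀
        · have hκ2 : Van (m + m) κ := by
            refine hC3.congr fun ξ => ?_
            rw [hκ]
            have := hK1per 0 k₀ ξ hk₀
            rw [zero_add] at this
            simp only [this]
          obtain ⟨n, P, Q, hP, hQ, hPQ⟩ := exists_sum_mul_of_van hκt hκ2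
          have hsum := sum_mem (S := kernSpan M m u) (t := Finset.univ) fun t _ =>
            class_kern_mem hM (m := m) (u := u) k₀ (p := fun ξ => conj (P t ξ)) (q := Q t)
              (hrow0 (trig_conj (hP t).1) (hP t).2.conj) (hrow0 (hQ t).1 (hQ t).2) (hQ t).1
          convert hsum using 1
          funext k ξ
          simp only [Finset.sum_apply]
          by_cases hk : InDual M (k - k₀)
          · simp only [if_pos hk, ← Finset.sum_smul]
            congr 1
            change κ ξ = _
            rw [hPQ]
            refine Finset.sum_congr rfl fun t _ => ?_
            have := trig_dual_periodic hM (hQ t).1 ξ 0 hk₀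
            rw [zero_add, dualFreq_zero, add_zero] at this
            rw [this, conj_conj]
          · simp [hk]
        · obtain ⟨η, hη, hη0, hη1⟩ := exists_separating hM m hk₀
          have hκ1 : Van m fun ξ => κ (ξ - dualFreq M k₀) := hC2 k₀ j
          have h1 := class_kern_mem hM (m := m) (u := u) k₀ (p := fun ξ => conj (η ξ))
            (q := fun ξ => κ (ξ - dualFreq M k₀)) (hrow0 (trig_conj hη) hη0.conj)
            (hrow0 (hback k₀ hκt) hκ1) (hback k₀ hκt)
          have hη' : (fun ξ => 1 - η (ξ - dualFreq M k₀)) ∈ trig d :=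
            trig_sub hone (hback k₀ hη)
          have h2 := class_kern_mem hM (m := m) (u := u) k₀ (p := fun ξ => conj (κ ξ))
            (q := fun ξ => 1 - η (ξ - dualFreq M k₀)) (hrow0 (trig_conj hκt) hκ0.conj)
            (hrow0 hη' hη1) hη'
          convert add_mem h1 h2 using 1
          funext k ξ
          simp only [Pi.add_apply]
          by_cases hk : InDual M (k - k₀)
          · simp only [if_pos hk, ← add_smul, add_sub_cancel_right, conj_conj]
            congr 1
            ring
          · simp [hk]
      · have h1 := class_kern_mem hM (m := m) (u := u) k₀ (p := fun ξ => conj (κ ξ))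
          (q := fun _ => 1) (hrow0 (trig_conj hκt) hκ0.conj) (hrow1 hj hone) hone
        convert h1 using 1
        funext k ξ
        simp [hκ]
    · have hq : (fun ξ => κ (ξ - dualFreq M k₀) • T ξ j) ∈ annRows m u := by
        by_cases hj : j = i₀
        · subst hj
          exact hrow0 (hback k₀ hκt) (hC2 k₀ i)
        · exact hrow1 hj (hback k₀ hκt)
      have h1 := class_kern_mem hM (m := m) (u := u) k₀ (p := fun _ => 1)
        (q := fun ξ => κ (ξ - dualFreq M k₀)) (hrow1 hi hone) hq (hback k₀ hκt)
      convert h1 using 1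
      funext k ξ
      simp [hκ]
  -- sum over the entries and the classes
  have hMt : Mᵀ.det ≠ 0 := by rwa [det_transpose]
  have := finite_latticeQuot hMt
  let _ : Fintype (LatticeQuot Mᵀ) := Fintype.ofFinite _
  have hKmem : K ∈ kernSpan M m u := by
    have hsum := sum_mem (S := kernSpan M m u) (t := Finset.univ) fun (c : LatticeQuot Mᵀ) _ =>
      sum_mem (t := Finset.univ) fun (i : Fin r) _ => sum_mem (t := Finset.univ)
        fun (j : Fin r) _ => hentry (Quotient.out c) i j
    convert hsum using 1
    funext k ξ
    simp only [Finset.sum_apply]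
    obtain ⟨l, hl⟩ := latticeQuot_out (M := Mᵀ) k
    set c₀ : LatticeQuot Mᵀ := Submodule.Quotient.mk k with hc₀
    rw [Finset.sum_eq_single c₀]
    · have hd : InDual M (k - Quotient.out c₀) := ⟨l, by nth_rw 1 [hl]; abel⟩
      simp only [if_pos hd]
      have hper : K1 (Quotient.out c₀) ξ = K1 k ξ := by
        have := hK1per (Quotient.out c₀) _ ξ hd
        rw [add_sub_cancel] at this
        exact this.symm
      rw [hper]
      have h1 : K k ξ = (T ξ)ᴴ * K1 k ξ * T (ξ + dualFreq M k) := by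
        simp only [hK1]
        have e1 : (T ξ)ᴴ * (T' ξ)ᴴ = 1 := by rw [← conjTranspose_mul, hTT', conjTranspose_one]
        calc K k ξ = ((T ξ)ᴴ * (T' ξ)ᴴ) * K k ξ *
            (T' (ξ + dualFreq M k) * T (ξ + dualFreq M k)) := by rw [e1, hTT']; simp
          _ = _ := by simp only [mul_assoc]
      rw [h1]
      ext a b
      simp only [Matrix.mul_apply, Matrix.sum_apply, Matrix.smul_apply, vecMulVec_apply,
        conjTranspose_apply, Pi.star_apply, smul_eq_mul, Finset.sum_mul]
      rw [Finset.sum_comm]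
      refine Finset.sum_congr rfl fun i _ => Finset.sum_congr rfl fun j _ => ?_
      ring
    · intro c _ hc
      have hd : ¬ InDual M (k - Quotient.out c) := by
        rintro ⟨l', hl'⟩
        apply hc
        rw [hc₀, ← Quotient.out_eq c]
        exact ((latticeQuot_eq_iff (M := Mᵀ)).2 ⟨l', hl'⟩).symm
      simp [hd]
    · intro h; exact absurd (Finset.mem_univ _) h
  obtain ⟨s, B, ε, h1, h2, h3⟩ := exists_signed_squares hKmem
  refine ⟨s, fun ξ => Matrix.of fun l i => B l ξ i, ε, fun l i => (h2 l).1 i, h1,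
    fun l => (h2 l).2, fun k ξ => ?_⟩
  have h4 := h3 k ξ
  rw [hKadj] at h4
  have h5 : K k ξ = ∑ l, ε l • tensorKern M (B l) (B l) k ξ := by
    rw [← h4, ← two_smul ℂ, smul_smul]; norm_num
  have h6 : (Matrix.of fun l i => B l ξ i : Matrix (Fin s) (Fin r) ℂ)ᴴ * Matrix.diagonal ε *
      (Matrix.of fun l i => B l (ξ + dualFreq M k) i) = K k ξ := by
    rw [h5]
    ext a b
    rw [Matrix.mul_apply, Matrix.sum_apply]
    refine Finset.sum_congr rfl fun l _ => ?_
    rw [Matrix.mul_diagonal]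
    simp only [Matrix.smul_apply, tensorKern, vecMulVec_apply, conjTranspose_apply,
      Matrix.of_apply, smul_eq_mul, Pi.star_apply]
    ring
  rw [h6]
  simp only [hK]
  abel

end Factorization

/-! ### Perfect reconstruction by the discrete transform -/

section Transform
variable {d r s : ℕ} {M : Matrix (Fin d) (Fin d) ℤ}

/-- The symbol at a given frequency, as an additive map. -/
noncomputable def symbHom (ξ : Fin d → ℝ) : Mask d s r →+ Matrix (Fin s) (Fin r) ℂ :=
  Finsupp.liftAddHom fun k => DistribSMul.toAddMonoidHom _ (chr k ξ)

theorem symbHom_apply (u : Mask d s r) (ξ : Fin d → ℝ) : symbHom ξ u = symb u ξ := rfl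

theorem symbHom_single (k : Fin d → ℤ) (A : Matrix (Fin s) (Fin r) ℂ) (ξ : Fin d → ℝ) :
    symbHom ξ (Finsupp.single k A) = chr k ξ • A := by
  rw [symbHom, Finsupp.liftAddHom_apply_single]; rfl

theorem symb_eq_sum (u : Mask d s r) (ξ : Fin d → ℝ) :
    symb u ξ = ∑ k ∈ u.support, chr k ξ • u k := rfl

theorem symb_injective {u v : Mask d s r} (h : ∀ ξ, symb u ξ = symb v ξ) : u = v := by
  rw [← sub_eq_zero]
  set w := u - v
  have hw : ∀ ξ, symb w ξ = 0 := fun ξ => by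
    rw [← symbHom_apply, map_sub, symbHom_apply, symbHom_apply, h, sub_self]
  ext k i j
  obtain ⟨e, he⟩ : ∃ e : Matrix (Fin s) (Fin r) ℂ → ℂ, ∀ A, e A = A i j := ⟨_, fun _ => rfl⟩
  have he0 : e 0 = 0 := by rw [he]; rfl
  have h1 := chr_coeff_unique (w.mapRange e he0) fun ξ => by
    rw [Finsupp.sum_mapRange_index (by simp)]
    simp only [he]
    rw [← symb_apply, hw]; rfl
  have h2 := DFunLike.congr_fun h1 k
  rwa [Finsupp.mapRange_apply, he] at h2

theorem chr_dualFreq_swap (k l : Fin d → ℤ) :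
    chr k (dualFreq M l) = chr l ((2 * Real.pi) • ((realMat M)⁻¹ *ᵥ realVec k)) := by
  simp only [chr, dualFreq, dotProduct_smul]
  congr 5
  rw [dotProduct_mulVec, ← Matrix.transpose_nonsing_inv, vecMul_transpose, dotProduct_comm]

open scoped Classical in
/-- The time-domain form of the filter bank identity. -/
theorem time_identity (hM : M.det ≠ 0) {A : Mask d r r} {B : Mask d s r} {ε : Fin s → ℂ}
    (hFB : ∀ k ξ, (symb A ξ)ᴴ * symb A (ξ + dualFreq M k)
      + (symb B ξ)ᴴ * Matrix.diagonal ε * symb B (ξ + dualFreq M k) = if InDual M k then 1 else 0)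
    (n : Fin d → ℤ) (w : RowSeq d r) :
    (∑ j ∈ A.support, ∑ p ∈ A.support, (if ∃ l, j - n = M *ᵥ l then
        ((|(realMat M).det| : ℝ) : ℂ) else 0) • (w (p - j) ᵥ* ((A p)ᴴ * A j)))
      + (∑ j ∈ B.support, ∑ p ∈ B.support, (if ∃ l, j - n = M *ᵥ l then
        ((|(realMat M).det| : ℝ) : ℂ) else 0) •
          (w (p - j) ᵥ* ((B p)ᴴ * Matrix.diagonal ε * B j))) = w 0 := by
  have hMt : Mᵀ.det ≠ 0 := by rwa [det_transpose]
  have := finite_latticeQuot hMt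
  let _ : Fintype (LatticeQuot Mᵀ) := Fintype.ofFinite _
  set c : (Fin d → ℤ) → ℂ := fun j =>
    ∑ q : LatticeQuot Mᵀ, chr (j - n) (dualFreq M (Quotient.out q)) with hc
  have hcj : ∀ j, (if ∃ l, j - n = M *ᵥ l then ((|(realMat M).det| : ℝ) : ℂ) else 0) = c j := by
    intro j
    have := sum_chr_latticeQuot hMt (j - n)
    rw [← realMat_transpose, transpose_transpose, transpose_transpose, det_transpose] at this
    simp only [hc, chr_dualFreq_swap]
    exact this.symm
  simp only [hcj]
  -- the correlation of a filter with itself, weighted by `c`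
  let corr : ∀ {t : ℕ} (a : Mask d t r) (E : Matrix (Fin t) (Fin t) ℂ), Mask d r r :=
    fun a E => ∑ j ∈ a.support, ∑ p ∈ a.support,
      Finsupp.single (j - p) (c j • ((a p)ᴴ * E * a j))
  have hcorr : ∀ {t : ℕ} (a : Mask d t r) (E : Matrix (Fin t) (Fin t) ℂ) (ξ : Fin d → ℝ),
      symb (corr a E) ξ = ∑ q : LatticeQuot Mᵀ, chr (-n) (dualFreq M (Quotient.out q)) •
        ((symb a ξ)ᴴ * E * symb a (ξ + dualFreq M (Quotient.out q))) := by
    intro t a E ξ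
    rw [← symbHom_apply]
    simp only [corr, map_sum, symbHom_single]
    have hq : ∀ q : LatticeQuot Mᵀ, chr (-n) (dualFreq M (Quotient.out q)) •
        ((symb a ξ)ᴴ * E * symb a (ξ + dualFreq M (Quotient.out q)))
        = ∑ j ∈ a.support, ∑ p ∈ a.support, (chr (j - p) ξ *
          chr (j - n) (dualFreq M (Quotient.out q))) • ((a p)ᴴ * E * a j) := by
      intro q
      rw [symb_eq_sum a (ξ + _), Matrix.mul_sum, Finset.smul_sum]
      refine Finset.sum_congr rfl fun j _ => ?_
      rw [symb_eq_sum a ξ, conjTranspose_sum, Matrix.sum_mul, Matrix.sum_mul, Finset.smul_sum]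
      refine Finset.sum_congr rfl fun p _ => ?_
      rw [conjTranspose_smul, Matrix.smul_mul, Matrix.smul_mul, Matrix.mul_smul, smul_smul,
        smul_smul, sub_eq_add_neg, sub_eq_add_neg, chr_add, chr_add, chr_add_right, ← conj_chr p]
      congr 1
      simp only [RCLike.star_def]
      ring
    simp only [hq]
    refine Eq.trans (Finset.sum_congr rfl fun j _ => ?_) Finset.sum_comm
    refine Eq.trans (Finset.sum_congr rfl fun p _ => ?_) Finset.sum_comm
    rw [← Finset.sum_smul, ← Finset.mul_sum, smul_smul]
  have hsum : corr A 1 + corr B (Matrix.diagonal ε) = Finsupp.single 0 1 := by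
    refine symb_injective fun ξ => ?_
    rw [← symbHom_apply, map_add, symbHom_apply, symbHom_apply, hcorr, hcorr,
      ← Finset.sum_add_distrib]
    simp only [← smul_add, mul_one, hFB]
    rw [← symbHom_apply, symbHom_single, chr_zero, one_smul]
    rw [Finset.sum_eq_single (Submodule.Quotient.mk 0 : LatticeQuot Mᵀ)]
    · obtain ⟨l, hl⟩ := latticeQuot_out (M := Mᵀ) 0
      have h0 : InDual M (Quotient.out (Submodule.Quotient.mk 0 : LatticeQuot Mᵀ)) :=
        ⟨-l, by rw [mulVec_neg]; exact eq_neg_of_add_eq_zero_left hl.symm⟩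
      rw [if_pos h0]
      obtain ⟨l', hl'⟩ := h0
      rw [hl', dualFreq_dual hM, chr_two_pi, one_smul]
    · intro q _ hq
      rw [if_neg, smul_zero]
      rintro ⟨l, hl⟩
      apply hq
      rw [← Quotient.out_eq q]
      exact (latticeQuot_eq_iff (M := Mᵀ)).2 ⟨l, by rw [sub_zero]; exact hl⟩
    · intro h; exact absurd (Finset.mem_univ _) h
  let Λ : Mask d r r →+ (Fin r → ℂ) := Finsupp.liftAddHom fun t =>
    { toFun := fun C => w (-t) ᵥ* C
      map_zero' := vecMul_zero _
      map_add' := fun C C' => vecMul_add _ _ _ }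
  have hΛ : ∀ t C, Λ (Finsupp.single t C) = w (-t) ᵥ* C := fun t C =>
    Finsupp.liftAddHom_apply_single _ _ _
  have h := congrArg Λ hsum
  rw [map_add, hΛ, neg_zero, vecMul_one] at h
  rw [← h]
  simp only [corr, map_sum, hΛ, neg_sub, vecMul_smul, mul_one]

theorem conv_adjointMask (v : RowSeq d r) (a : Mask d s r) (n : Fin d → ℤ) :
    QuasiTight.conv v (adjointMask a) n = ∑ p ∈ a.support, v (n + p) ᵥ* (a p)ᴴ := by
  rw [QuasiTight.conv, adjointMask, Finsupp.equivMapDomain_eq_mapDomain,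
    Finsupp.sum_mapDomain_index (by simp) (by intros; rw [vecMul_add]),
    Finsupp.sum_mapRange_index (by simp)]
  simp [Finsupp.sum]

theorem transition_apply (a : Mask d s r) (v : RowSeq d r) (n : Fin d → ℤ) :
    transition M a v n = ((Real.sqrt |(realMat M).det| : ℝ) : ℂ) •
      ∑ p ∈ a.support, v (M *ᵥ n + p) ᵥ* (a p)ᴴ := by
  rw [transition, conv_adjointMask]

open scoped Classical in
theorem upsample_apply (hM : M.det ≠ 0) (f : (Fin d → ℤ) → Fin r → ℂ) (g : RowSeq d r)
    (hfg : ∀ l, f (M *ᵥ l) = g l) (n : Fin d → ℤ) :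
    upsample M g n = if ∃ l, n = M *ᵥ l then f n else 0 := by
  rw [upsample]
  split_ifs with h
  · obtain ⟨l, rfl⟩ := h
    rw [hfg]
    exact (mulVec_injective_of_det hM).extend_apply g 0 l
  · rw [Function.extend_apply']
    · rfl
    · rintro ⟨l, hl⟩
      exact h ⟨l, hl.symm⟩

open scoped Classical in
theorem subdivision_transition (hM : M.det ≠ 0) (a : Mask d s r) (E : Matrix (Fin s) (Fin s) ℂ)
    (v : RowSeq d r) (n : Fin d → ℤ) :
    (((Real.sqrt |(realMat M).det| : ℝ) : ℂ) • ∑ j ∈ a.support,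
      upsample M (transition M a v) (n - j) ᵥ* (E * a j))
    = ∑ j ∈ a.support, ∑ p ∈ a.support, (if ∃ l, j - n = M *ᵥ l then
        ((|(realMat M).det| : ℝ) : ℂ) else 0) • (v (n + (p - j)) ᵥ* ((a p)ᴴ * E * a j)) := by
  rw [Finset.smul_sum]
  refine Finset.sum_congr rfl fun j _ => ?_
  rw [upsample_apply hM (fun x => ((Real.sqrt |(realMat M).det| : ℝ) : ℂ) •
      ∑ p ∈ a.support, v (x + p) ᵥ* (a p)ᴴ) _ (fun l => (transition_apply a v l).symm)]
  have hiff : (∃ l, n - j = M *ᵥ l) ↔ ∃ l, j - n = M *ᵥ l :=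
    ⟨fun ⟨l, hl⟩ => ⟨-l, by rw [mulVec_neg, ← hl, neg_sub]⟩,
      fun ⟨l, hl⟩ => ⟨-l, by rw [mulVec_neg, ← hl, neg_sub]⟩⟩
  have hsq : ((Real.sqrt |(realMat M).det| : ℝ) : ℂ) * ((Real.sqrt |(realMat M).det| : ℝ) : ℂ)
      = ((|(realMat M).det| : ℝ) : ℂ) := by
    rw [← ofReal_mul, Real.mul_self_sqrt (abs_nonneg _)]
  by_cases h : ∃ l, j - n = M *ᵥ l
  · simp only [if_pos h, if_pos (hiff.2 h)]
    rw [smul_vecMul, smul_smul, hsq, sum_vecMul, Finset.smul_sum]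
    refine Finset.sum_congr rfl fun p _ => ?_
    rw [vecMul_vecMul, Matrix.mul_assoc]
    congr 3
    abel
  · simp only [if_neg h, if_neg (fun h' => h (hiff.1 h')), zero_vecMul, smul_zero, zero_smul,
      Finset.sum_const_zero]

/-- A quasi-tight filter bank recovers every sequence after one level. -/
theorem perfect_reconstruction (hM : M.det ≠ 0) {A : Mask d r r} {B : Mask d s r} {ε : Fin s → ℂ}
    (hFB : ∀ k ξ, (symb A ξ)ᴴ * symb A (ξ + dualFreq M k)
      + (symb B ξ)ᴴ * Matrix.diagonal ε * symb B (ξ + dualFreq M k)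
        = open scoped Classical in if InDual M k then 1 else 0)
    (v : RowSeq d r) :
    subdivision M A (transition M A v) + subdivision M (signedMask ε B) (transition M B v) = v := by
  classical
  funext n
  have h := time_identity hM (by simpa using hFB) n (fun t => v (n + t))
  simp only [add_zero] at h
  refine Eq.trans ?_ h
  have h1 := subdivision_transition hM A 1 v n
  have h2 := subdivision_transition hM B (Matrix.diagonal ε) v n
  simp only [one_mul, mul_one] at h1
  rw [Pi.add_apply, ← h1, ← h2]
  congr 1
  rw [subdivision, QuasiTight.conv, signedMask, Finsupp.sum_mapRange_index (by simp)]
  rfl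

theorem isCompactTransform_of_filterBank (hM : M.det ≠ 0) {A : Mask d r r} {B : Mask d s r}
    {ε : Fin s → ℂ} (hFB : ∀ k ξ, (symb A ξ)ᴴ * symb A (ξ + dualFreq M k)
      + (symb B ξ)ᴴ * Matrix.diagonal ε * symb B (ξ + dualFreq M k)
        = open scoped Classical in if InDual M k then 1 else 0) :
    IsCompactTransform M A B ε := by
  intro J v
  induction J with
  | zero => rfl
  | succ J ih =>
    refine Eq.trans ?_ ih
    simp only [reconstruct, lowPass, highPass]
    rw [perfect_reconstruction hM hFB]

end Transform

/-! ### Balancing -/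

section Balancing
variable {d r s : ℕ} {M N : Matrix (Fin d) (Fin d) ℤ} {κ : Fin r → Fin d → ℤ}

/-- The unit vector `r^{-1/2} (e^{-i N⁻¹κ_j·ξ})_j` of exponentials attached to the vector
conversion `E_N`. -/
noncomputable def balVec (N : Matrix (Fin d) (Fin d) ℤ) (κ : Fin r → Fin d → ℤ) (ξ : Fin d → ℝ) :
    Fin r → ℂ :=
  fun j => (Real.sqrt r : ℂ)⁻¹ *
    cexp (-(I * ((((realMat N)⁻¹ *ᵥ realVec (κ j)) ⬝ᵥ ξ : ℝ) : ℂ)))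

theorem conj_cexp_neg (t : ℝ) : conj (cexp (-(I * (t : ℂ)))) = cexp (-(I * ((-t : ℝ) : ℂ))) := by
  rw [← Complex.exp_conj]; simp

theorem balVec_unit (hr : r ≠ 0) (ξ : Fin d → ℝ) :
    star (balVec N κ ξ) ⬝ᵥ balVec N κ ξ = 1 := by
  have h1 : ∀ j, star (balVec N κ ξ) j * balVec N κ ξ j = (r : ℂ)⁻¹ := by
    intro j
    have h2 : star (balVec N κ ξ) j * balVec N κ ξ j
        = ((Complex.normSq (balVec N κ ξ j) : ℝ) : ℂ) := by
      rw [Complex.normSq_eq_conj_mul_self]; rfl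
    rw [h2, balVec, Complex.normSq_mul, Complex.normSq_inv, Complex.normSq_ofReal,
      Real.mul_self_sqrt (Nat.cast_nonneg r), Complex.normSq_eq_norm_sq (cexp _),
      Complex.norm_exp]
    simp
  rw [dotProduct, Finset.sum_congr rfl fun j _ => h1 j]
  simp [hr]

theorem continuous_balVec : Continuous (balVec N κ : (Fin d → ℝ) → Fin r → ℂ) := by
  unfold balVec dotProduct; fun_prop

theorem approx_balVec (n : ℕ) (j : Fin r) : Approx n fun ξ => balVec N κ ξ j :=
  (Approx.of_trig (const_mem_trig _)).mul (approx_exp _ n)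

/-- The exponential sum of `p ↦ ∑ p(Mn + k) b(k)ᴴ` on the sequences `E_N (e^{-i x·ζ})` is a multiple
of the conjugate of `b̂ u` at `-Nᵀζ`. -/
theorem expSum_eq (hr : r ≠ 0) (hN : N.det ≠ 0) (b : Mask d s r) (l : Fin s) (n : Fin d → ℤ)
    (ζ : Fin d → ℝ) :
    ∑ q : b.support × Fin r, conj (b q.1 l q.2) *
      cexp (-(I * ((realVec (N *ᵥ (n + q.1) + κ q.2) ⬝ᵥ ζ : ℝ) : ℂ)))
    = chr (N *ᵥ n) ζ * (Real.sqrt r : ℂ) *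
        conj ((symb b ((-(realMat N)ᵀ) *ᵥ ζ) *ᵥ balVec N κ ((-(realMat N)ᵀ) *ᵥ ζ)) l) := by
  have hr' : (Real.sqrt r : ℂ) ≠ 0 := by
    rw [ofReal_ne_zero]
    exact (Real.sqrt_pos.2 (by exact_mod_cast Nat.pos_of_ne_zero hr)).ne'
  have hbal : ∀ i, conj (balVec N κ ((-(realMat N)ᵀ) *ᵥ ζ) i)
      = (Real.sqrt r : ℂ)⁻¹ * chr (κ i) ζ := by
    intro i
    rw [balVec, map_mul, conj_cexp_neg, map_inv₀, conj_ofReal, chr]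
    congr 5
    rw [neg_mulVec, dotProduct_neg, neg_neg, dotProduct_mulVec, vecMul_transpose,
      realMat_mulVec_inv hN]
  have hsy : ∀ i, conj (symb b ((-(realMat N)ᵀ) *ᵥ ζ) l i)
      = ∑ p ∈ b.support, conj (b p l i) * chr (N *ᵥ p) ζ := by
    intro i
    rw [symb_apply, Finsupp.sum, map_sum]
    refine Finset.sum_congr rfl fun p _ => ?_
    rw [map_mul, neg_mulVec, chr_neg_right, conj_chr, neg_neg, chr_mulVec]
  rw [mulVec, dotProduct, map_sum, Finset.mul_sum, Fintype.sum_prod_type]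
  refine Finset.sum_comm.trans (Finset.sum_congr rfl fun i _ => ?_)
  rw [map_mul, hbal, hsy, Finset.sum_mul, Finset.mul_sum, ← Finset.sum_coe_sort b.support]
  refine Finset.sum_congr rfl fun p _ => ?_
  have : cexp (-(I * ((realVec (N *ᵥ (n + (p : Fin d → ℤ)) + κ i) ⬝ᵥ ζ : ℝ) : ℂ)))
      = chr (N *ᵥ n) ζ * chr (N *ᵥ (p : Fin d → ℤ)) ζ * chr (κ i) ζ := by
    rw [← chr_add, ← chr_add, ← mulVec_add]; rfl
  rw [this]
  field_simp

theorem transition_vecConv (b : Mask d s r) (P : MvPolynomial (Fin d) ℂ)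
    {p : (Fin d → ℤ) → ℂ} (hp : ∀ k, p k = MvPolynomial.eval (fun i => (k i : ℂ)) P)
    (n : Fin d → ℤ) (l : Fin s) :
    transition M b (vecConv N κ p) n l = ((Real.sqrt |(realMat M).det| : ℝ) : ℂ) *
      ∑ q : b.support × Fin r, MvPolynomial.eval
        (fun i => ((realVec (N *ᵥ (M *ᵥ n + q.1) + κ q.2) i : ℝ) : ℂ)) P * conj (b q.1 l q.2) := by
  rw [transition_apply, Pi.smul_apply, smul_eq_mul, Finset.sum_apply, Fintype.sum_prod_type,
    ← Finset.sum_coe_sort]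
  congr 1
  refine Finset.sum_congr rfl fun k _ => ?_
  rw [vecMul, dotProduct]
  refine Finset.sum_congr rfl fun i _ => ?_
  simp only [vecConv, hp, conjTranspose_apply, realVec, ofReal_intCast]
  rfl

theorem sqrt_det_ne_zero (hM : M.det ≠ 0) : ((Real.sqrt |(realMat M).det| : ℝ) : ℂ) ≠ 0 := by
  rw [ofReal_ne_zero]
  exact (Real.sqrt_pos.2 (abs_pos.2 (realMat_isUnit_det hM).ne_zero)).ne'

theorem hasBalancedVanishingMoments_iff (hr : r ≠ 0) (hM : M.det ≠ 0) (hN : N.det ≠ 0)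
    (b : Mask d s r) (m : ℕ) :
    HasBalancedVanishingMoments M N κ b m ↔ VanV m fun ξ => symb b ξ *ᵥ balVec N κ ξ := by
  have hr' : (Real.sqrt r : ℂ) ≠ 0 := by
    rw [ofReal_ne_zero]
    exact (Real.sqrt_pos.2 (by exact_mod_cast Nat.pos_of_ne_zero hr)).ne'
  constructor
  · intro h l
    have h1 : Van m fun ζ => ∑ q : b.support × Fin r, conj (b q.1 l q.2) *
        cexp (-(I * ((realVec (N *ᵥ (M *ᵥ (0 : Fin d → ℤ) + q.1) + κ q.2) ⬝ᵥ ζ : ℝ) : ℂ))) := by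
      refine (van_expSum_iff (fun q : b.support × Fin r =>
        realVec (N *ᵥ (M *ᵥ (0 : Fin d → ℤ) + q.1) + κ q.2)) _ m).2 fun P hP => ?_
      have h2 := congrFun (congrFun (h (fun k => MvPolynomial.eval (fun i => (k i : ℂ)) P)
        ⟨P, hP, fun _ => rfl⟩) 0) l
      rw [transition_vecConv b P (fun _ => rfl)] at h2
      exact (mul_eq_zero.1 h2).resolve_left (sqrt_det_ne_zero hM)
    simp only [expSum_eq hr hN, mulVec_zero, chr_zero, one_mul] at h1
    have h2 := (h1.comp_mulVec (-((realMat N)ᵀ)⁻¹)).conj.mul_left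
      (g := fun _ => (Real.sqrt r : ℂ)⁻¹) continuousAt_const
    refine h2.congr fun ξ => ?_
    have h3 : (-(realMat N)ᵀ) *ᵥ ((-((realMat N)ᵀ)⁻¹) *ᵥ ξ) = ξ := by
      rw [mulVec_mulVec, neg_mul_neg, Matrix.mul_nonsing_inv, one_mulVec]
      rw [det_transpose]; exact realMat_isUnit_det hN
    rw [h3, map_mul, conj_conj, conj_ofReal, ← mul_assoc, inv_mul_cancel₀ hr', one_mul]
  · rintro h p ⟨P, hP, hp⟩
    funext n l
    rw [transition_vecConv b P hp]
    have h1 : Van m fun ζ => ∑ q : b.support × Fin r, conj (b q.1 l q.2) *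
        cexp (-(I * ((realVec (N *ᵥ (M *ᵥ n + q.1) + κ q.2) ⬝ᵥ ζ : ℝ) : ℂ))) := by
      simp only [expSum_eq hr hN]
      refine ((h l).comp_mulVec (-(realMat N)ᵀ)).conj.mul_left
        (g := fun ζ => chr (N *ᵥ (M *ᵥ n)) ζ * (Real.sqrt r : ℂ)) ?_
      exact ((continuous_chr _).mul continuous_const).continuousAt
    rw [(van_expSum_iff _ _ m).1 h1 P hP, mul_zero]; rfl

/-- Linear substitutions do not raise the degree of a polynomial. -/
theorem exists_linear_subst (L : Matrix (Fin d) (Fin d) ℝ) (P : MvPolynomial (Fin d) ℂ) :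
    ∃ Q : MvPolynomial (Fin d) ℂ, Q.totalDegree ≤ P.totalDegree ∧
      ∀ x : Fin d → ℝ, MvPolynomial.eval (fun i => (x i : ℂ)) Q
        = MvPolynomial.eval (fun i => ((L *ᵥ x) i : ℂ)) P := by
  set ℓ : Fin d → MvPolynomial (Fin d) ℂ := fun i =>
    ∑ j, MvPolynomial.C ((L i j : ℝ) : ℂ) * MvPolynomial.X j
  have hℓ : ∀ i, (ℓ i).totalDegree ≤ 1 := fun i => by
    refine MvPolynomial.totalDegree_finsetSum_le fun j _ => ?_
    refine (MvPolynomial.totalDegree_mul _ _).trans ?_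
    simp
  refine ⟨MvPolynomial.aeval ℓ P, ?_, fun x => ?_⟩
  · rw [MvPolynomial.aeval_def, MvPolynomial.eval₂_eq]
    refine MvPolynomial.totalDegree_finsetSum_le fun α hα => ?_
    refine (MvPolynomial.totalDegree_mul _ _).trans ?_
    rw [show algebraMap ℂ (MvPolynomial (Fin d) ℂ) (MvPolynomial.coeff α P)
      = MvPolynomial.C (MvPolynomial.coeff α P) from rfl, MvPolynomial.totalDegree_C, zero_add]
    refine (MvPolynomial.totalDegree_finsetProd _ _).trans ?_
    refine le_trans (Finset.sum_le_sum fun i _ => ?_) (MvPolynomial.le_totalDegree hα)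
    refine (MvPolynomial.totalDegree_pow _ _).trans ?_
    exact (Nat.mul_le_mul_left _ (hℓ i)).trans (by simp)
  · have hx : ∀ i, MvPolynomial.eval (fun i => (x i : ℂ)) (ℓ i) = ((L *ᵥ x) i : ℂ) := fun i => by
      simp [ℓ, mulVec, dotProduct]
    induction P using MvPolynomial.induction_on with
    | C a => simp
    | add p q hp hq => simp only [map_add, hp, hq]
    | mul_X p i hp => simp only [map_mul, hp, MvPolynomial.aeval_X, MvPolynomial.eval_X, hx]

/-- If `a` reproduces the vector `u` of exponentials to order `m`, then `T_a` maps `E_N p` to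
`|det M|^{1/2} E_N (p(N M N⁻¹ ·))` for all polynomials `p` of degree less than `m`. -/
theorem transition_balanced (hr : r ≠ 0) (hN : N.det ≠ 0) (a : Mask d r r)
    {m : ℕ} (ha : VanV m fun ξ => symb a ξ *ᵥ balVec N κ ξ - balVec N κ ((realMat M)ᵀ *ᵥ ξ))
    {p : (Fin d → ℤ) → ℂ} (hp : p ∈ PolySeq d m) :
    ∃ q ∈ PolySeq d m, transition M a (vecConv N κ p) = vecConv N κ q := by
  obtain ⟨P, hP, hp⟩ := hp
  have hr' : (Real.sqrt r : ℂ) ≠ 0 := by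
    rw [ofReal_ne_zero]
    exact (Real.sqrt_pos.2 (by exact_mod_cast Nat.pos_of_ne_zero hr)).ne'
  set L := realMat N * realMat M * (realMat N)⁻¹ with hL
  obtain ⟨Q, hQ, hQe⟩ := exists_linear_subst L P
  set D : ℂ := ((Real.sqrt |(realMat M).det| : ℝ) : ℂ)
  refine ⟨fun k => D * MvPolynomial.eval (fun i => (k i : ℂ)) Q,
    ⟨MvPolynomial.C D * Q, ?_, fun k => by simp⟩, ?_⟩
  · refine lt_of_le_of_lt ((MvPolynomial.totalDegree_mul _ _).trans ?_) hP
    simpa using hQ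
  funext n l
  rw [transition_vecConv a P hp, vecConv]
  congr 1
  have hpt : (L *ᵥ realVec (N *ᵥ n + κ l))
      = realVec (N *ᵥ (M *ᵥ n)) + L *ᵥ realVec (κ l) := by
    rw [realVec_add, mulVec_add, ← realMat_mulVec, hL, mulVec_mulVec, mul_assoc,
      Matrix.nonsing_inv_mul _ (realMat_isUnit_det hN), mul_one, ← mulVec_mulVec, realMat_mulVec,
      realMat_mulVec]
  have h1 : Van m fun ζ => ∑ q : (a.support × Fin r) ⊕ Unit,
      Sum.elim (fun q : a.support × Fin r => conj (a q.1 l q.2)) (fun _ => (-1 : ℂ)) q *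
      cexp (-(I * ((Sum.elim (fun q : a.support × Fin r =>
        realVec (N *ᵥ (M *ᵥ n + q.1) + κ q.2))
        (fun _ => L *ᵥ realVec (N *ᵥ n + κ l)) q ⬝ᵥ ζ : ℝ) : ℂ))) := by
    simp only [Fintype.sum_sum_type, Sum.elim_inl, Sum.elim_inr, expSum_eq hr hN,
      Finset.univ_unique, Finset.sum_singleton]
    have h2 := ((ha l).comp_mulVec (-(realMat N)ᵀ)).conj.mul_left
      (g := fun ζ => chr (N *ᵥ (M *ᵥ n)) ζ * (Real.sqrt r : ℂ))
      ((continuous_chr _).mul continuous_const).continuousAt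
    refine h2.congr fun ζ => ?_
    beta_reduce
    rw [Pi.sub_apply, map_sub, mul_sub, neg_one_mul, ← sub_eq_add_neg]
    congr 1
    rw [hpt, add_dotProduct, ofReal_add, mul_add, neg_add, Complex.exp_add, balVec, map_mul,
      conj_cexp_neg, map_inv₀, conj_ofReal, mul_assoc, mul_inv_cancel_left₀ hr']
    congr 1
    congr 4
    rw [neg_mulVec, mulVec_neg, dotProduct_neg, neg_neg, dotProduct_mulVec, dotProduct_mulVec,
      vecMul_transpose, vecMul_transpose, hL, mulVec_mulVec, mulVec_mulVec, mul_assoc]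
  have h3 := (van_expSum_iff _ _ m).1 h1 P hP
  simp only [Fintype.sum_sum_type, Sum.elim_inl, Sum.elim_inr, Finset.univ_unique,
    Finset.sum_singleton, mul_neg, mul_one] at h3
  rw [add_neg_eq_zero] at h3
  rw [h3, ← hQe]
  rfl

end Balancing

/-! ### Almost orthogonal families in a Hilbert space -/

section Hilbert

theorem exists_geometric_bound {u : ℕ → ℝ} {N : ℕ} (hN : N ≠ 0) (hu0 : ∀ n, 0 ≤ u n)
    (hu : ∀ n, u (n + N) ≤ 1 / 2 * u n) :
    ∃ C ρ : ℝ, 0 ≤ C ∧ 0 < ρ ∧ ρ < 1 ∧ ∀ n, u n ≤ C * ρ ^ n := by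
  set ρ : ℝ := (1 / 2 : ℝ) ^ ((N : ℝ)⁻¹) with hρ
  have hρ0 : 0 < ρ := Real.rpow_pos_of_pos (by norm_num) _
  have hN0 : (0 : ℝ) < N := by exact_mod_cast Nat.pos_of_ne_zero hN
  have hρ1 : ρ < 1 := Real.rpow_lt_one (by norm_num) (by norm_num) (inv_pos.2 hN0)
  have hρN : ρ ^ N = 1 / 2 := Real.rpow_inv_natCast_pow (by norm_num) hN
  set C : ℝ := ∑ t ∈ Finset.range N, u t / ρ ^ t
  have hterm : ∀ t, 0 ≤ u t / ρ ^ t := fun t => div_nonneg (hu0 t) (pow_pos hρ0 t).le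
  refine ⟨C, ρ, Finset.sum_nonneg fun t _ => hterm t, hρ0, hρ1, fun n => ?_⟩
  induction n using Nat.strong_induction_on with
  | _ n ih =>
    rcases lt_or_ge n N with h | h
    · rw [← div_le_iff₀ (pow_pos hρ0 n)]
      exact Finset.single_le_sum (f := fun t => u t / ρ ^ t) (fun t _ => hterm t)
        (Finset.mem_range.2 h)
    · obtain ⟨k, rfl⟩ := Nat.exists_eq_add_of_le' h
      refine (hu k).trans ?_
      rw [pow_add, hρN]
      have := ih k (by omega)
      linarith

/-- In finite dimension, an orbit of a linear map that tends to zero does so geometrically. -/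
theorem exists_geometric_decay {E : Type*} [NormedAddCommGroup E] [NormedSpace ℂ E]
    [FiniteDimensional ℂ E] (A : E →ₗ[ℂ] E) {v : E}
    (hv : Tendsto (fun n => (A ^ n) v) atTop (𝓝 0)) :
    ∃ C ρ : ℝ, 0 ≤ C ∧ 0 < ρ ∧ ρ < 1 ∧ ∀ n, ‖(A ^ n) v‖ ≤ C * ρ ^ n := by
  -- the stable subspace of `A`
  let X : Submodule ℂ E :=
    { carrier := {x | Tendsto (fun n => (A ^ n) x) atTop (𝓝 0)}
      zero_mem' := by simp
      add_mem' := fun {x y} hx hy => by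
        simpa using (show Tendsto _ _ _ from hx).add (show Tendsto _ _ _ from hy)
      smul_mem' := fun c x hx => by
        simpa using (show Tendsto _ _ _ from hx).const_smul c }
  have hX : ∀ x ∈ X, A x ∈ X := fun x hx => by
    have := (tendsto_add_atTop_iff_nat 1).2 (show Tendsto _ _ _ from hx)
    simp only [pow_succ, Module.End.mul_apply] at this
    exact this
  let L : X →L[ℂ] X := LinearMap.toContinuousLinearMap (A.restrict hX)
  have hL : ∀ n (x : X), ((L ^ n) x : E) = (A ^ n) x := by
    intro n
    induction n with
    | zero => intro x; rfl
    | succ n ih =>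
      intro x
      rw [pow_succ, pow_succ, mul_apply_eq_comp, ih]; rfl
  let b := Module.finBasis ℂ X
  obtain ⟨K, hK, hop⟩ := b.exists_opNorm_le (F := X)
  have hev : ∀ i, ∀ᶠ n in atTop, ‖(L ^ n) (b i)‖ ≤ 1 / (2 * K) := fun i => by
    have h1 : Tendsto (fun n => ‖(A ^ n) (b i : E)‖) atTop (𝓝 0) := by
      simpa using (show Tendsto (fun n => (A ^ n) (b i : E)) atTop (𝓝 0) from (b i).2).norm
    filter_upwards [h1.eventually
      (ge_mem_nhds (show (0 : ℝ) < 1 / (2 * K) by positivity))] with n hn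
    rw [Submodule.coe_norm, hL]
    exact hn
  obtain ⟨N, hN, hN0⟩ := ((eventually_all.2 hev).and (eventually_ne_atTop 0)).exists
  have hLN : ‖L ^ N‖ ≤ 1 / 2 := by
    refine (hop (by positivity) hN).trans (le_of_eq ?_)
    field_simp
  refine exists_geometric_bound (u := fun n => ‖(A ^ n) v‖) hN0 (fun n => norm_nonneg _) fun n => ?_
  have h2 : ∀ k, ‖(A ^ k) v‖ = ‖(L ^ k) (⟨v, hv⟩ : X)‖ := fun k => by
    rw [Submodule.coe_norm, hL]
  rw [h2, h2, add_comm, pow_add, mul_apply_eq_comp]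
  exact (ContinuousLinearMap.le_opNorm _ _).trans
    (mul_le_mul_of_nonneg_right hLN (norm_nonneg _))

variable {H : Type*} [NormedAddCommGroup H] [InnerProductSpace ℂ H]

local notation "⟪" x ", " y "⟫" => inner ℂ x y

theorem norm_sum_sq_le_of_almost_orthogonal {A ρ : ℝ} (hA : 0 ≤ A) (hρ : 0 < ρ) (hρ1 : ρ < 1)
    (y : ℕ → H) (t : ℕ → ℝ) (h : ∀ i n, ‖⟪y i, y (i + n)⟫‖ ≤ A * ρ ^ n * (t i * t (i + n)))
    (J : ℕ) :
    ‖∑ i ∈ Finset.range J, y i‖ ^ 2 ≤ 2 * A / (1 - ρ) * ∑ i ∈ Finset.range J, t i ^ 2 := by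
  have h1ρ : 0 < 1 - ρ := sub_pos.2 hρ1
  have hgeo : ∀ n, ∑ k ∈ Finset.range n, ρ ^ k ≤ 1 / (1 - ρ) := fun n => by
    rw [one_div, ← tsum_geometric_of_lt_one hρ.le hρ1]
    exact (summable_geometric_of_lt_one hρ.le hρ1).sum_le_tsum _ fun k _ => (pow_pos hρ k).le
  -- the weight of the pair `(i, j)`
  have hsym : ∀ i j,
      ‖⟪y i, y j⟫‖ ≤ A * (ρ ^ (j - i) * ρ ^ (i - j)) * ((t i ^ 2 + t j ^ 2) / 2) := by
    intro i j
    have hle : ∀ i n, ‖⟪y i, y (i + n)⟫‖ ≤ A * ρ ^ n * ((t i ^ 2 + t (i + n) ^ 2) / 2) := fun i n =>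
      (h i n).trans (mul_le_mul_of_nonneg_left (by nlinarith [sq_nonneg (t i - t (i + n))])
        (by positivity))
    rcases le_total i j with hij | hij
    · obtain ⟨n, rfl⟩ := Nat.exists_eq_add_of_le hij
      simpa using hle i n
    · obtain ⟨n, rfl⟩ := Nat.exists_eq_add_of_le hij
      rw [norm_inner_symm, add_comm (t (j + n) ^ 2)]
      simpa using hle j n
  have hrow : ∀ i ∈ Finset.range J, ∑ j ∈ Finset.range J, ρ ^ (j - i) * ρ ^ (i - j)
      ≤ 2 / (1 - ρ) := by
    intro i hi
    rw [Finset.mem_range] at hi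
    have hsplit : ∑ j ∈ Finset.range J, ρ ^ (j - i) * ρ ^ (i - j)
        = ∑ j ∈ Finset.range i, ρ ^ (i - j) + ∑ j ∈ Finset.range (J - i), ρ ^ j := by
      obtain ⟨n, rfl⟩ := Nat.exists_eq_add_of_le hi.le
      rw [Finset.sum_range_add]
      congr 1
      · refine Finset.sum_congr rfl fun j hj => ?_
        rw [Nat.sub_eq_zero_of_le (Finset.mem_range.1 hj).le, pow_zero, one_mul]
      · rw [Nat.add_sub_cancel_left]
        refine Finset.sum_congr rfl fun j _ => ?_
        rw [Nat.add_sub_cancel_left, Nat.sub_eq_zero_of_le (Nat.le_add_right _ _),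
          pow_zero, mul_one]
    have hfirst : ∑ j ∈ Finset.range i, ρ ^ (i - j) ≤ ∑ j ∈ Finset.range i, ρ ^ j := by
      rw [← Finset.sum_range_reflect (fun j => ρ ^ j)]
      refine Finset.sum_le_sum fun j hj => ?_
      exact pow_le_pow_of_le_one hρ.le hρ1.le (by omega)
    rw [hsplit]
    calc _ ≤ 1 / (1 - ρ) + 1 / (1 - ρ) := add_le_add (hfirst.trans (hgeo _)) (hgeo _)
      _ = 2 / (1 - ρ) := by ring
  have hnorm : ‖∑ i ∈ Finset.range J, y i‖ ^ 2
      ≤ ∑ i ∈ Finset.range J, ∑ j ∈ Finset.range J, ‖⟪y i, y j⟫‖ := by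
    have h2 : ((‖∑ i ∈ Finset.range J, y i‖ : ℝ) ^ 2 : ℝ)
        = ‖⟪∑ i ∈ Finset.range J, y i, ∑ i ∈ Finset.range J, y i⟫‖ := by
      rw [inner_self_eq_norm_sq_to_K]; simp
    rw [h2, sum_inner]
    refine (norm_sum_le _ _).trans (Finset.sum_le_sum fun i _ => ?_)
    rw [inner_sum]
    exact norm_sum_le _ _
  refine hnorm.trans ?_
  calc ∑ i ∈ Finset.range J, ∑ j ∈ Finset.range J, ‖⟪y i, y j⟫‖
      ≤ ∑ i ∈ Finset.range J, ∑ j ∈ Finset.range J,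
        (A / 2 * (ρ ^ (j - i) * ρ ^ (i - j) * t i ^ 2)
          + A / 2 * (ρ ^ (i - j) * ρ ^ (j - i) * t j ^ 2)) := by
        refine Finset.sum_le_sum fun i _ => Finset.sum_le_sum fun j _ => (hsym i j).trans ?_
        exact le_of_eq (by ring)
    _ = A * ∑ i ∈ Finset.range J, ∑ j ∈ Finset.range J, ρ ^ (j - i) * ρ ^ (i - j) * t i ^ 2 := by
        simp only [Finset.sum_add_distrib, ← Finset.mul_sum]
        rw [Finset.sum_comm (f := fun i j => ρ ^ (i - j) * ρ ^ (j - i) * t j ^ 2)]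
        ring
    _ ≤ A * ∑ i ∈ Finset.range J, 2 / (1 - ρ) * t i ^ 2 := by
        refine mul_le_mul_of_nonneg_left (Finset.sum_le_sum fun i hi => ?_) hA
        rw [← Finset.sum_mul]
        exact mul_le_mul_of_nonneg_right (hrow i hi) (sq_nonneg _)
    _ = _ := by rw [← Finset.mul_sum]; ring

/-- A bilinear form with at most `K` non-zero entries per column and rows of norm at most `√B`. -/
theorem bilinear_le {α β : Type*} (P : Finset α) (Q : Finset β) (g : α → β → ℝ) (a : α → ℝ)
    (b : β → ℝ) {K B : ℝ} (hB : 0 ≤ B) (hK0 : 0 ≤ K)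
    (hK : ∀ q ∈ Q, ((P.filter fun p => g p q ≠ 0).card : ℝ) ≤ K)
    (hg : ∀ p ∈ P, ∑ q ∈ Q, g p q ^ 2 ≤ B) :
    |∑ p ∈ P, ∑ q ∈ Q, a p * b q * g p q| ≤
      Real.sqrt (K * B) * (Real.sqrt (∑ p ∈ P, a p ^ 2) * Real.sqrt (∑ q ∈ Q, b q ^ 2)) := by
  rw [← Real.sqrt_mul (Finset.sum_nonneg fun _ _ => sq_nonneg _), ← Real.sqrt_mul (by positivity)]
  refine Real.abs_le_sqrt ?_
  have hcs := Finset.sum_mul_sq_le_sq_mul_sq (P ×ˢ Q)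
    (fun z => if g z.1 z.2 ≠ 0 then b z.2 else 0) (fun z => a z.1 * g z.1 z.2)
  have hl : ∑ z ∈ P ×ˢ Q, (if g z.1 z.2 ≠ 0 then b z.2 else 0) * (a z.1 * g z.1 z.2)
      = ∑ p ∈ P, ∑ q ∈ Q, a p * b q * g p q := by
    rw [Finset.sum_product]
    refine Finset.sum_congr rfl fun p _ => Finset.sum_congr rfl fun q _ => ?_
    dsimp only
    split_ifs with h
    · ring
    · rw [not_not.1 h]; ring
  rw [hl] at hcs
  refine hcs.trans ?_
  have h1 : ∑ z ∈ P ×ˢ Q, (if g z.1 z.2 ≠ 0 then b z.2 else 0) ^ 2 ≤ K * ∑ q ∈ Q, b q ^ 2 := by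
    rw [Finset.sum_product_right, Finset.mul_sum]
    refine Finset.sum_le_sum fun q hq => ?_
    have : ∀ p, (if g p q ≠ 0 then b q else 0) ^ 2 = if g p q ≠ 0 then b q ^ 2 else 0 := fun p => by
      split_ifs <;> simp
    simp only [this]
    rw [← Finset.sum_filter, Finset.sum_const, nsmul_eq_mul]
    exact mul_le_mul_of_nonneg_right (hK q hq) (sq_nonneg _)
  have h2 : ∑ z ∈ P ×ˢ Q, (a z.1 * g z.1 z.2) ^ 2 ≤ B * ∑ p ∈ P, a p ^ 2 := by
    rw [Finset.sum_product, Finset.mul_sum]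
    refine Finset.sum_le_sum fun p hp => ?_
    simp only [mul_pow, ← Finset.mul_sum]
    rw [mul_comm]
    exact mul_le_mul_of_nonneg_right (hg p hp) (sq_nonneg _)
  calc _ ≤ (K * ∑ q ∈ Q, b q ^ 2) * (B * ∑ p ∈ P, a p ^ 2) :=
        mul_le_mul h1 h2 (Finset.sum_nonneg fun _ _ => sq_nonneg _)
          (mul_nonneg hK0 (Finset.sum_nonneg fun _ _ => sq_nonneg _))
    _ = _ := by ring

open scoped Classical in
/-- A family `x i p` indexed by levels `i` is Bessel if its Gram matrix is banded inside every pair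
of levels and its blocks decay geometrically away from the diagonal. -/
theorem bessel_of_gram {κ : Type*} (x : ℕ → κ → H) {K B ρ : ℝ} (hK0 : 0 ≤ K) (hB : 0 ≤ B)
    (hρ : 0 < ρ) (hρ1 : ρ < 1)
    (hK : ∀ i n q (P : Finset κ), ((P.filter fun p => ⟪x i p, x (i + n) q⟫ ≠ 0).card : ℝ) ≤ K)
    (hg : ∀ i n p (Q : Finset κ), ∑ q ∈ Q, ‖⟪x i p, x (i + n) q⟫‖ ^ 2 ≤ B * (ρ ^ n) ^ 2) :
    ∀ (f : H) (S : Finset (ℕ × κ)),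
      ∑ z ∈ S, ‖⟪x z.1 z.2, f⟫‖ ^ 2 ≤ 2 * Real.sqrt (K * B) / (1 - ρ) * ‖f‖ ^ 2 := by
  intro f S
  set C : ℝ := 2 * Real.sqrt (K * B) / (1 - ρ) with hC
  have hC0 : 0 ≤ C := div_nonneg (by positivity) (sub_pos.2 hρ1).le
  -- enlarge `S` to a rectangle
  set Q : Finset κ := S.image Prod.snd
  set J : ℕ := S.sup Prod.fst + 1
  have hsub : S ⊆ Finset.range J ×ˢ Q := fun z hz => Finset.mem_product.2
    ⟨Finset.mem_range.2 (Nat.lt_succ_of_le (Finset.le_sup (f := Prod.fst) hz)),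
      Finset.mem_image_of_mem _ hz⟩
  refine (Finset.sum_le_sum_of_subset_of_nonneg hsub fun _ _ _ => sq_nonneg _).trans ?_
  rw [Finset.sum_product]
  set T : ℝ := ∑ i ∈ Finset.range J, ∑ q ∈ Q, ‖⟪x i q, f⟫‖ ^ 2 with hT
  have hT0 : 0 ≤ T := Finset.sum_nonneg fun _ _ => Finset.sum_nonneg fun _ _ => sq_nonneg _
  set y : ℕ → H := fun i => ∑ q ∈ Q, ⟪x i q, f⟫ • x i q with hy
  set t : ℕ → ℝ := fun i => Real.sqrt (∑ q ∈ Q, ‖⟪x i q, f⟫‖ ^ 2) with ht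
  have hort := norm_sum_sq_le_of_almost_orthogonal (Real.sqrt_nonneg (K * B)) hρ hρ1 y t
    (fun i n => by
      have h1 := bilinear_le Q Q (fun p q => ‖⟪x i p, x (i + n) q⟫‖) (fun p => ‖⟪x i p, f⟫‖)
        (fun q => ‖⟪x (i + n) q, f⟫‖) (K := K) (B := B * (ρ ^ n) ^ 2) (by positivity) hK0
        (fun q _ => by simpa only [ne_eq, norm_eq_zero] using hK i n q Q)
        (fun p _ => hg i n p Q)
      rw [← mul_assoc K B, Real.sqrt_mul (by positivity), Real.sqrt_sq (by positivity)] at h1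
      refine le_trans ?_ ((le_abs_self _).trans h1)
      simp only [hy, sum_inner, inner_sum, inner_smul_left, inner_smul_right, Finset.mul_sum]
      refine (norm_sum_le _ _).trans ?_
      rw [Finset.sum_comm]
      refine Finset.sum_le_sum fun p _ => (norm_sum_le _ _).trans (Finset.sum_le_sum fun q _ => ?_)
      rw [norm_mul, norm_mul, RCLike.norm_conj]
      exact le_of_eq (by ring)) J
  have ht2 : ∑ i ∈ Finset.range J, t i ^ 2 = T :=
    Finset.sum_congr rfl fun i _ => Real.sq_sqrt (Finset.sum_nonneg fun _ _ => sq_nonneg _)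
  rw [ht2, ← hC] at hort
  have hTf : T ≤ ‖∑ i ∈ Finset.range J, y i‖ * ‖f‖ := by
    have h1 : (T : ℂ) = ⟪∑ i ∈ Finset.range J, y i, f⟫ := by
      rw [hT]
      simp only [hy, sum_inner, inner_smul_left]
      push_cast
      refine Finset.sum_congr rfl fun i _ => Finset.sum_congr rfl fun q _ => ?_
      rw [← Complex.mul_conj']; ring
    have h2 := norm_inner_le_norm (𝕜 := ℂ) (∑ i ∈ Finset.range J, y i) f
    rwa [← h1, Complex.norm_real, Real.norm_of_nonneg hT0] at h2
  rcases hT0.eq_or_lt with h0 | h0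
  · rw [← h0]; positivity
  · have h3 : T * T ≤ T * (C * ‖f‖ ^ 2) := by
      calc T * T ≤ (‖∑ i ∈ Finset.range J, y i‖ * ‖f‖) * (‖∑ i ∈ Finset.range J, y i‖ * ‖f‖) :=
            mul_self_le_mul_self hT0 hTf
        _ = ‖∑ i ∈ Finset.range J, y i‖ ^ 2 * ‖f‖ ^ 2 := by ring
        _ ≤ (C * T) * ‖f‖ ^ 2 := mul_le_mul_of_nonneg_right hort (sq_nonneg _)
        _ = _ := by ring
    exact le_of_mul_le_mul_left h3 h0

/-- The analysis operator of a Bessel family. -/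
theorem exists_analysis {ι : Type*} (x : ι → H) {C : ℝ} (hC : 0 ≤ C)
    (hB : ∀ (f : H) (S : Finset ι), ∑ i ∈ S, ‖⟪x i, f⟫‖ ^ 2 ≤ C * ‖f‖ ^ 2) :
    ∃ T : H →L[ℂ] lp (fun _ : ι => ℂ) 2, ∀ f i, T f i = ⟪x i, f⟫ := by
  have hmem : ∀ f : H, Memℓp (fun i => ⟪x i, f⟫ : ι → ℂ) 2 := fun f =>
    memℓp_gen' (C := C * ‖f‖ ^ 2) fun S => by simpa using hB f S
  let T₀ : H →ₗ[ℂ] lp (fun _ : ι => ℂ) 2 :=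
    { toFun := fun f => ⟨fun i => ⟪x i, f⟫, hmem f⟩
      map_add' := fun f g => by ext i; exact inner_add_right _ _ _
      map_smul' := fun c f => by ext i; exact inner_smul_right _ _ _ }
  refine ⟨T₀.mkContinuous (Real.sqrt C) fun f => ?_, fun f i => rfl⟩
  refine lp.norm_le_of_forall_sum_le (by simp) (by positivity) fun S => ?_
  have := hB f S
  simp only [ENNReal.toReal_ofNat, Real.rpow_ofNat, mul_pow, Real.sq_sqrt hC]
  exact this

/-- A Bessel family with signs `σ` that satisfies the signed Parseval identity on a dense set
reproduces every vector. -/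
theorem hasSum_of_dense [CompleteSpace H] {ι : Type*} (x : ι → H) {σ : ι → ℂ}
    (hσ : ∀ i, σ i = 1 ∨ σ i = -1) {C : ℝ} (hC : 0 ≤ C)
    (hB : ∀ (f : H) (S : Finset ι), ∑ i ∈ S, ‖⟪x i, f⟫‖ ^ 2 ≤ C * ‖f‖ ^ 2) {D : Set H}
    (hD : Dense D)
    (h : ∀ f ∈ D, HasSum (fun i => σ i * ((‖⟪x i, f⟫‖ ^ 2 : ℝ) : ℂ)) ((‖f‖ ^ 2 : ℝ) : ℂ)) (f : H) :
    HasSum (fun i => (σ i * ⟪x i, f⟫) • x i) f := by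
  classical
  have hσ1 : ∀ i, ‖σ i‖ = 1 := fun i => by rcases hσ i with h | h <;> simp [h]
  have hσ2 : ∀ i, conj (σ i) = σ i := fun i => by rcases hσ i with h | h <;> simp [h]
  obtain ⟨T, hT⟩ := exists_analysis x hC hB
  obtain ⟨T', hT'⟩ := exists_analysis (fun i => σ i • x i) hC fun f S => by
    simpa only [inner_smul_left, norm_mul, RCLike.norm_conj, hσ1, one_mul] using hB f S
  simp only [inner_smul_left, hσ2] at hT'
  have hsingle : ∀ (i : ι) (c : ℂ), ContinuousLinearMap.adjoint T (lp.single 2 i c) = c • x i := by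
    intro i c
    refine ext_inner_right ℂ fun g => ?_
    rw [ContinuousLinearMap.adjoint_inner_left, lp.inner_single_left, hT, inner_smul_left]
    simp [mul_comm]
  set R : H →L[ℂ] H := (ContinuousLinearMap.adjoint T).comp T' with hR
  have hsum : ∀ g, HasSum (fun i => (σ i * ⟪x i, g⟫) • x i) (R g) := fun g => by
    have h1 := (lp.hasSum_single (by simp) (T' g)).mapL (ContinuousLinearMap.adjoint T)
    simp only [hsingle, hT'] at h1
    exact h1
  have hself : ∀ g, ⟪R g, g⟫ = ⟪g, g⟫ := by
    have hcl : IsClosed {g : H | ⟪R g, g⟫ = ⟪g, g⟫} :=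
      isClosed_eq (by fun_prop) (by fun_prop)
    have hDs : D ⊆ {g : H | ⟪R g, g⟫ = ⟪g, g⟫} := fun g hg => by
      have h1 := (hsum g).mapL (innerSL ℂ g)
      simp only [innerSL_apply_apply, inner_smul_right] at h1
      have h2 : ∀ i, σ i * ⟪x i, g⟫ * ⟪g, x i⟫ = σ i * ((‖⟪x i, g⟫‖ ^ 2 : ℝ) : ℂ) := fun i => by
        rw [← inner_conj_symm g (x i), mul_assoc, Complex.mul_conj']
        push_cast; rfl
      simp only [h2] at h1
      have h3 := h1.unique (h g hg)
      have h4 : ⟪g, g⟫ = ((‖g‖ ^ 2 : ℝ) : ℂ) := by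
        rw [inner_self_eq_norm_sq_to_K]; push_cast; rfl
      change ⟪R g, g⟫ = ⟪g, g⟫
      rw [← inner_conj_symm (R g), h3, h4, Complex.conj_ofReal]
    intro g
    have := hcl.closure_subset_iff.2 hDs (hD g)
    exact this
  have h0 : ((R - 1 : H →L[ℂ] H) : H →ₗ[ℂ] H) = 0 := by
    rw [← inner_map_self_eq_zero]
    intro g
    change ⟪R g - g, g⟫ = 0
    rw [inner_sub_left, hself, sub_self]
  have h1 : R f = f := by
    have := LinearMap.congr_fun h0 f
    exact sub_eq_zero.1 this
  simpa only [h1] using hsum f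

end Hilbert

/-! ### Dilates and shifts of functions -/

section Atoms
variable {d : ℕ} {M : Matrix (Fin d) (Fin d) ℤ}

theorem measurableEmbedding_mulVec {A : Matrix (Fin d) (Fin d) ℝ} (hA : A.det ≠ 0) :
    MeasurableEmbedding fun x : Fin d → ℝ => A *ᵥ x := by
  refine Continuous.measurableEmbedding (by fun_prop) ?_
  exact mulVec_injective_iff_isUnit.2 ((isUnit_iff_isUnit_det A).2 (isUnit_iff_ne_zero.2 hA))

theorem map_mulVec_volume {A : Matrix (Fin d) (Fin d) ℝ} (hA : A.det ≠ 0) :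
    Measure.map (fun x : Fin d → ℝ => A *ᵥ x) volume
      = ENNReal.ofReal |A.det⁻¹| • (volume : Measure (Fin d → ℝ)) :=
  Real.map_matrix_volume_pi_eq_smul_volume_pi hA

theorem integral_comp_mulVec {A : Matrix (Fin d) (Fin d) ℝ} (hA : A.det ≠ 0)
    {E : Type*} [NormedAddCommGroup E] [NormedSpace ℝ E] (F : (Fin d → ℝ) → E) :
    ∫ x, F (A *ᵥ x) = |A.det|⁻¹ • ∫ x, F x := by
  rw [← (measurableEmbedding_mulVec hA).integral_map F, map_mulVec_volume hA,
    integral_smul_measure, ENNReal.toReal_ofReal (abs_nonneg _), abs_inv]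

theorem memLp_comp_mulVec {A : Matrix (Fin d) (Fin d) ℝ} (hA : A.det ≠ 0)
    {p : ℝ≥0∞} {F : (Fin d → ℝ) → ℂ} (hF : MemLp F p volume) :
    MemLp (fun x => F (A *ᵥ x)) p volume := by
  refine ((measurableEmbedding_mulVec hA).memLp_map_measure_iff (g := F)).1 ?_
  rw [map_mulVec_volume hA]
  exact hF.smul_measure ENNReal.ofReal_ne_top

theorem ae_comp_mulVec {A : Matrix (Fin d) (Fin d) ℝ} (hA : A.det ≠ 0)
    {F G : (Fin d → ℝ) → ℂ} (h : F =ᵐ[volume] G) :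
    (fun x => F (A *ᵥ x)) =ᵐ[volume] fun x => G (A *ᵥ x) := by
  refine (MeasureTheory.ae_of_ae_map (measurableEmbedding_mulVec hA).measurable.aemeasurable
    (p := fun y => F y = G y) ?_)
  rw [map_mulVec_volume hA]
  exact Measure.ae_smul_measure h _

theorem memLp_comp_sub {p : ℝ≥0∞} {F : (Fin d → ℝ) → ℂ} (hF : MemLp F p volume)
    (t : Fin d → ℝ) : MemLp (fun x => F (x - t)) p volume :=
  hF.comp_measurePreserving (measurePreserving_sub_right volume t)

/-- The function `|det M|^{j/2} f(M^j x - k)`. -/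
noncomputable def atom (M : Matrix (Fin d) (Fin d) ℤ) (j : ℕ) (k : Fin d → ℤ)
    (f : (Fin d → ℝ) → ℂ) (x : Fin d → ℝ) : ℂ :=
  ((Real.sqrt |(realMat M).det| ^ j : ℝ) : ℂ) * f ((realMat M ^ j) *ᵥ x - realVec k)

theorem atom_zero (k : Fin d → ℤ) (f : (Fin d → ℝ) → ℂ) :
    atom M 0 k f = fun x => f (x - realVec k) := by
  funext x; simp [atom]

theorem atom_zero_zero (f : (Fin d → ℝ) → ℂ) : atom M 0 0 f = f := by
  rw [atom_zero, realVec_zero]; simp only [sub_zero]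

theorem atom_succ (j : ℕ) (k : Fin d → ℤ) (f : (Fin d → ℝ) → ℂ) (x : Fin d → ℝ) :
    atom M (j + 1) k f x
      = ((Real.sqrt |(realMat M).det| : ℝ) : ℂ) * atom M j k f (realMat M *ᵥ x) := by
  rw [atom, atom, mulVec_mulVec, ← pow_succ, pow_succ, ofReal_mul]; ring

theorem realMat_pow (M : Matrix (Fin d) (Fin d) ℤ) (n : ℕ) : realMat (M ^ n) = realMat M ^ n :=
  Matrix.map_pow M (Int.castRingHom ℝ) n

theorem atom_add (j : ℕ) (k p : Fin d → ℤ) (f : (Fin d → ℝ) → ℂ) (x : Fin d → ℝ) :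
    atom M j k f (x + realVec p) = atom M j (k - (M ^ j) *ᵥ p) f x := by
  rw [atom, atom, mulVec_add, ← realMat_pow, realMat_mulVec, sub_eq_add_neg k, realVec_add,
    realVec_neg]
  congr 2
  abel

theorem atom_sub (j : ℕ) (k p : Fin d → ℤ) (f : (Fin d → ℝ) → ℂ) (x : Fin d → ℝ) :
    atom M j k f (x - realVec p) = atom M j (k + (M ^ j) *ᵥ p) f x := by
  have h := atom_add (M := M) j (k + (M ^ j) *ᵥ p) p f (x - realVec p)
  rw [sub_add_cancel, add_sub_cancel_right] at h
  exact h.symm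

theorem memLp_atom (hM : M.det ≠ 0) {p : ℝ≥0∞} {f : (Fin d → ℝ) → ℂ} (hf : MemLp f p volume)
    (j : ℕ) (k : Fin d → ℤ) : MemLp (atom M j k f) p volume := by
  induction j with
  | zero => rw [atom_zero]; exact memLp_comp_sub hf _
  | succ j ih =>
    have h := (memLp_comp_mulVec (realMat_isUnit_det hM).ne_zero ih).const_mul
      ((Real.sqrt |(realMat M).det| : ℝ) : ℂ)
    exact h.congr_norm h.1 (ae_of_all _ fun x => rfl) |>.ae_eq
      (ae_of_all _ fun x => (atom_succ j k f x).symm)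

theorem atom_ae_eq (hM : M.det ≠ 0) {f g : (Fin d → ℝ) → ℂ} (h : f =ᵐ[volume] g) (j : ℕ)
    (k : Fin d → ℤ) : atom M j k f =ᵐ[volume] atom M j k g := by
  induction j with
  | zero =>
    rw [atom_zero, atom_zero]
    exact (measurePreserving_sub_right volume (realVec k)).quasiMeasurePreserving.ae_eq_comp h
  | succ j ih =>
    filter_upwards [ae_comp_mulVec (realMat_isUnit_det hM).ne_zero ih] with x hx
    rw [atom_succ, atom_succ, hx]

/-! ### Inner products -/

/-- The class of a square-integrable function in the Hilbert space `L²(ℝ^d)`, and `0` for a function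
that is not square-integrable. -/
noncomputable def toH (f : (Fin d → ℝ) → ℂ) : Lp ℂ 2 (volume : Measure (Fin d → ℝ)) :=
  open scoped Classical in if h : MemLp f 2 volume then h.toLp f else 0

theorem toH_eq {f : (Fin d → ℝ) → ℂ} (h : MemLp f 2 volume) : toH f = h.toLp f := dif_pos h

theorem innerL2_eq_inner {f g : (Fin d → ℝ) → ℂ} (hf : MemLp f 2 volume)
    (hg : MemLp g 2 volume) : innerL2 f g = inner ℂ (toH g) (toH f) := by
  rw [toH_eq hf, toH_eq hg, L2.inner_def, innerL2]
  refine integral_congr_ae ?_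
  filter_upwards [hf.coeFn_toLp, hg.coeFn_toLp] with x h1 h2
  rw [h1, h2]; rfl

theorem toH_finset_sum {ι : Type*} (s : Finset ι) (c : ι → ℂ) (f : ι → (Fin d → ℝ) → ℂ)
    (hf : ∀ i ∈ s, MemLp (f i) 2 volume) :
    toH (fun x => ∑ i ∈ s, c i * f i x) = ∑ i ∈ s, c i • toH (f i) := by
  classical
  induction s using Finset.induction_on with
  | empty =>
    simp only [Finset.sum_empty]
    have h0 : MemLp (fun _ : Fin d → ℝ => (0 : ℂ)) 2 volume := MemLp.zero'
    rw [toH_eq h0]; exact MemLp.toLp_zero h0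
  | insert i s hi ih =>
    have h1 : MemLp (fun x => c i * f i x) 2 volume :=
      (hf i (Finset.mem_insert_self _ _)).const_mul _
    have h2 : MemLp (fun x => ∑ i ∈ s, c i * f i x) 2 volume :=
      memLp_finsetSum _ fun j hj => (hf j (Finset.mem_insert_of_mem hj)).const_mul _
    simp only [Finset.sum_insert hi]
    rw [← ih fun j hj => hf j (Finset.mem_insert_of_mem hj), toH_eq h2,
      toH_eq (hf i (Finset.mem_insert_self _ _)), ← MemLp.toLp_const_smul, ← MemLp.toLp_add]
    exact toH_eq _

theorem toH_sub {f g : (Fin d → ℝ) → ℂ} (hf : MemLp f 2 volume) (hg : MemLp g 2 volume) :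
    toH (fun x => f x - g x) = toH f - toH g := by
  rw [toH_eq hf, toH_eq hg, ← MemLp.toLp_sub hf hg]; exact toH_eq _

theorem eLpNorm_eq_norm_toH {f : (Fin d → ℝ) → ℂ} (hf : MemLp f 2 volume) :
    eLpNorm f 2 volume = ENNReal.ofReal ‖toH f‖ := by
  rw [toH_eq hf, Lp.norm_toLp, ENNReal.ofReal_toReal hf.2.ne]

theorem norm_toH_sq {f : (Fin d → ℝ) → ℂ} (hf : MemLp f 2 volume) :
    (‖toH f‖ : ℝ) ^ 2 = ∫ x, ‖f x‖ ^ 2 := by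
  have h1 := innerL2_eq_inner hf hf
  rw [inner_self_eq_norm_sq_to_K] at h1
  have h2 : innerL2 f f = ((∫ x, ‖f x‖ ^ 2 : ℝ) : ℂ) := by
    refine Eq.trans ?_ integral_ofReal
    refine integral_congr_ae (ae_of_all _ fun x => ?_)
    simp only [Complex.mul_conj']
    norm_cast
  rw [h2] at h1
  exact (Complex.ofReal_injective (h1.trans (by norm_cast))).symm

theorem innerL2_dilate (hM : M.det ≠ 0) (F G : (Fin d → ℝ) → ℂ) :
    innerL2 (fun x => ((Real.sqrt |(realMat M).det| : ℝ) : ℂ) * F (realMat M *ᵥ x))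
      (fun x => ((Real.sqrt |(realMat M).det| : ℝ) : ℂ) * G (realMat M *ᵥ x)) = innerL2 F G := by
  have hD : |(realMat M).det| ≠ 0 := abs_ne_zero.2 (realMat_isUnit_det hM).ne_zero
  have h1 : ∀ x, ((Real.sqrt |(realMat M).det| : ℝ) : ℂ) * F (realMat M *ᵥ x) *
      conj (((Real.sqrt |(realMat M).det| : ℝ) : ℂ) * G (realMat M *ᵥ x))
      = |(realMat M).det| • (fun y => F y * conj (G y)) (realMat M *ᵥ x) := by
    intro x
    rw [map_mul, conj_ofReal, Complex.real_smul]
    nth_rewrite 3 [← Real.mul_self_sqrt (abs_nonneg (realMat M).det)]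
    push_cast
    ring
  simp only [innerL2, h1]
  rw [integral_smul, integral_comp_mulVec (realMat_isUnit_det hM).ne_zero
    (fun y => F y * conj (G y)), smul_smul, mul_inv_cancel₀ hD, one_smul]

theorem innerL2_atom_add (hM : M.det ≠ 0) (i j m : ℕ) (p k : Fin d → ℤ)
    (f g : (Fin d → ℝ) → ℂ) :
    innerL2 (atom M (i + m) p f) (atom M (j + m) k g) = innerL2 (atom M i p f) (atom M j k g) := by
  induction m with
  | zero => rfl
  | succ m ih =>
    rw [← ih, ← innerL2_dilate hM (atom M (i + m) p f)]
    simp only [← atom_succ]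
    rfl

theorem innerL2_comp_sub (F G : (Fin d → ℝ) → ℂ) (t : Fin d → ℝ) :
    innerL2 (fun x => F (x - t)) (fun x => G (x - t)) = innerL2 F G :=
  integral_sub_right_eq_self (fun x => F x * conj (G x)) t

theorem innerL2_atom_shift (i j : ℕ) (p k t : Fin d → ℤ) (f g : (Fin d → ℝ) → ℂ) :
    innerL2 (atom M i (p + (M ^ i) *ᵥ t) f) (atom M j (k + (M ^ j) *ᵥ t) g)
      = innerL2 (atom M i p f) (atom M j k g) := by
  rw [← innerL2_comp_sub (atom M i p f) (atom M j k g) (realVec t)]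
  simp only [atom_sub]

theorem norm_toH_atom (hM : M.det ≠ 0) {f : (Fin d → ℝ) → ℂ} (hf : MemLp f 2 volume) (j : ℕ)
    (k : Fin d → ℤ) : ‖toH (atom M j k f)‖ = ‖toH f‖ := by
  have h0 : innerL2 (atom M j k f) (atom M j k f) = innerL2 f f := by
    have h1 := innerL2_atom_add hM 0 0 j k k f f
    rw [zero_add] at h1
    rw [h1, atom_zero]
    exact innerL2_comp_sub f f _
  rw [innerL2_eq_inner (memLp_atom hM hf j k) (memLp_atom hM hf j k), innerL2_eq_inner hf hf,
    inner_self_eq_norm_sq_to_K, inner_self_eq_norm_sq_to_K] at h0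
  have h1 : ‖toH (atom M j k f)‖ ^ 2 = ‖toH f‖ ^ 2 := by exact_mod_cast h0
  exact (pow_left_inj₀ (norm_nonneg _) (norm_nonneg _) two_ne_zero).1 h1

/-! ### Supports and lattice points -/

theorem exists_lattice_bound (d : ℕ) (R : ℝ) : ∃ K : ℕ, ∀ y : Fin d → ℝ,
    {k : Fin d → ℤ | ‖realVec k - y‖ ≤ R}.Finite ∧
      {k : Fin d → ℤ | ‖realVec k - y‖ ≤ R}.ncard ≤ K := by
  set c : ℤ := ⌈R⌉ + 1
  set B : Set (Fin d → ℤ) := Set.Icc (fun _ => -c) (fun _ => c)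
  have hB : B.Finite := Set.finite_Icc _ _
  refine ⟨B.ncard, fun y => ?_⟩
  set t : Fin d → ℤ := fun i => ⌊y i⌋
  have hsub : {k : Fin d → ℤ | ‖realVec k - y‖ ≤ R} ⊆ (fun k => k + t) '' B := by
    intro k hk
    refine ⟨k - t, ?_, sub_add_cancel _ _⟩
    have hi : ∀ i, |(k i : ℝ) - y i| ≤ R := fun i =>
      (norm_le_pi_norm (realVec k - y) i).trans hk
    constructor <;> intro i
    · have h1 := (abs_le.1 (hi i)).1
      have h2 := Int.floor_le (y i)
      have h3 := Int.le_ceil R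
      have : ((-c : ℤ) : ℝ) ≤ ((k i - ⌊y i⌋ : ℤ) : ℝ) := by push_cast [c]; linarith
      exact_mod_cast this
    · have h1 := (abs_le.1 (hi i)).2
      have h2 := (Int.lt_floor_add_one (y i)).le
      have h3 := Int.le_ceil R
      have : ((k i - ⌊y i⌋ : ℤ) : ℝ) ≤ (c : ℝ) := by push_cast [c]; linarith
      exact_mod_cast this
  have hfin : ((fun k => k + t) '' B).Finite := hB.image _
  exact ⟨hfin.subset hsub, (Set.ncard_le_ncard hsub hfin).trans (Set.ncard_image_le hB)⟩

theorem exists_norm_mulVec_le (A : Matrix (Fin d) (Fin d) ℝ) :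
    ∃ c : ℝ, 0 ≤ c ∧ ∀ x, ‖A *ᵥ x‖ ≤ c * ‖x‖ :=
  ⟨_, norm_nonneg (LinearMap.toContinuousLinearMap (toLin' A)),
    (LinearMap.toContinuousLinearMap (toLin' A)).le_opNorm⟩

theorem realMat_inv_pow_mulVec (hM : M.det ≠ 0) (n : ℕ) (x : Fin d → ℝ) :
    ((realMat M)⁻¹ ^ n) *ᵥ ((realMat M ^ n) *ᵥ x) = x := by
  rw [mulVec_mulVec, Matrix.inv_pow', Matrix.nonsing_inv_mul, one_mulVec]
  rw [det_pow]; exact (realMat_isUnit_det hM).pow n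

theorem realMat_pow_mulVec_inv (hM : M.det ≠ 0) (n : ℕ) (x : Fin d → ℝ) :
    (realMat M ^ n) *ᵥ (((realMat M)⁻¹ ^ n) *ᵥ x) = x := by
  rw [mulVec_mulVec, Matrix.inv_pow', Matrix.mul_nonsing_inv, one_mulVec]
  rw [det_pow]; exact (realMat_isUnit_det hM).pow n

theorem finite_lattice_dilate (hM : M.det ≠ 0) (n : ℕ) (y : Fin d → ℝ) (R : ℝ) :
    {k : Fin d → ℤ | ‖y - ((realMat M)⁻¹ ^ n) *ᵥ realVec k‖ ≤ R}.Finite := by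
  obtain ⟨c, hc, h⟩ := exists_norm_mulVec_le (realMat M ^ n)
  obtain ⟨K, hK⟩ := exists_lattice_bound d (c * R)
  refine (hK ((realMat M ^ n) *ᵥ y)).1.subset fun k hk => ?_
  have h1 := (h (y - ((realMat M)⁻¹ ^ n) *ᵥ realVec k)).trans (mul_le_mul_of_nonneg_left hk hc)
  rw [mulVec_sub, realMat_pow_mulVec_inv hM] at h1
  change ‖_‖ ≤ _
  rw [norm_sub_rev]; exact h1

/-- The function `f` vanishes off the ball of radius `R` around the origin. -/
def SuppIn (R : ℝ) (f : (Fin d → ℝ) → ℂ) : Prop := ∀ x, f x ≠ 0 → ‖x‖ ≤ R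

theorem exists_suppIn {f : (Fin d → ℝ) → ℂ} (hf : HasCompactSupport f) :
    ∃ R, 0 ≤ R ∧ SuppIn R f := by
  obtain ⟨R, hR⟩ := hf.isCompact.isBounded.exists_norm_le
  exact ⟨max R 0, le_max_right _ _, fun x hx =>
    (hR x (subset_tsupport _ hx)).trans (le_max_left _ _)⟩

theorem SuppIn.mono {R R' : ℝ} {f : (Fin d → ℝ) → ℂ} (h : SuppIn R f) (hR : R ≤ R') :
    SuppIn R' f := fun x hx => (h x hx).trans hR

theorem SuppIn.hasCompactSupport {R : ℝ} {f : (Fin d → ℝ) → ℂ} (h : SuppIn R f) :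
    HasCompactSupport f :=
  HasCompactSupport.of_support_subset_isCompact (isCompact_closedBall (0 : Fin d → ℝ) R)
    fun x hx => by simpa using h x hx

/-- Functions at two levels are orthogonal if their centres are far from each other. -/
theorem norm_le_of_innerL2_ne_zero (hM : M.det ≠ 0) {C : ℝ} {n : ℕ}
    (hC : ∀ x, ‖((realMat M)⁻¹ ^ n) *ᵥ x‖ ≤ C * ‖x‖) (hC0 : 0 ≤ C) {R : ℝ}
    {f g : (Fin d → ℝ) → ℂ} (hf : SuppIn R f) (hg : SuppIn R g) {p k : Fin d → ℤ}
    (h : innerL2 (atom M 0 p f) (atom M n k g) ≠ 0) :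
    ‖realVec p - ((realMat M)⁻¹ ^ n) *ᵥ realVec k‖ ≤ R + C * R := by
  obtain ⟨x, hx⟩ : ∃ x, atom M 0 p f x * conj (atom M n k g x) ≠ 0 := by
    by_contra hcon
    push Not at hcon
    exact h (by simp only [innerL2, hcon, integral_zero])
  rw [atom_zero] at hx
  have h1 : ‖x - realVec p‖ ≤ R := hf _ (left_ne_zero_of_mul hx)
  have h2 : ‖(realMat M ^ n) *ᵥ x - realVec k‖ ≤ R := by
    have := right_ne_zero_of_mul hx
    rw [map_ne_zero, atom] at this
    exact hg _ (right_ne_zero_of_mul this)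
  have h3 := (hC ((realMat M ^ n) *ᵥ x - realVec k)).trans (mul_le_mul_of_nonneg_left h2 hC0)
  rw [mulVec_sub, realMat_inv_pow_mulVec hM] at h3
  calc ‖realVec p - ((realMat M)⁻¹ ^ n) *ᵥ realVec k‖
      = ‖(x - ((realMat M)⁻¹ ^ n) *ᵥ realVec k) - (x - realVec p)‖ := by congr 1; abel
    _ ≤ C * R + R := (norm_sub_le _ _).trans (add_le_add h3 h1)
    _ = _ := add_comm _ _

end Atoms

/-! ### The energy of one level -/

section Level
variable {d : ℕ} {M : Matrix (Fin d) (Fin d) ℤ}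

theorem integrable_of_memLp_two {f : (Fin d → ℝ) → ℂ} (hf : MemLp f 2 volume)
    (hs : HasCompactSupport f) : Integrable f := by
  have : IsFiniteMeasure (volume.restrict (tsupport f)) :=
    ⟨by rw [Measure.restrict_apply_univ]; exact hs.isCompact.measure_lt_top⟩
  refine (integrableOn_iff_integrable_of_support_subset (subset_tsupport f)).1 ?_
  exact memLp_one_iff_integrable.1 ((hf.restrict _).mono_exponent (by norm_num))

theorem finite_innerL2_atom_ne_zero (hM : M.det ≠ 0) {R : ℝ} {f g : (Fin d → ℝ) → ℂ}
    (hf : SuppIn R f) (hg : SuppIn R g) (p : Fin d → ℤ) (n : ℕ) :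
    {k | innerL2 (atom M 0 p f) (atom M n k g) ≠ 0}.Finite := by
  obtain ⟨c, hc, h⟩ := exists_norm_mulVec_le ((realMat M)⁻¹ ^ n)
  exact (finite_lattice_dilate hM n (realVec p) (R + c * R)).subset fun k hk =>
    norm_le_of_innerL2_ne_zero hM h hc hf hg hk

theorem finite_innerL2_ne_zero (hM : M.det ≠ 0) {R : ℝ} {f g : (Fin d → ℝ) → ℂ}
    (hf : SuppIn R f) (hg : SuppIn R g) (n : ℕ) :
    {k | innerL2 f (atom M n k g) ≠ 0}.Finite := by
  have := finite_innerL2_atom_ne_zero hM hf hg 0 n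
  rwa [atom_zero_zero] at this

theorem sum_le_of_card_filter_le {α : Type*} (Q : Finset α) (g : α → ℝ) {K B : ℝ} (hB : 0 ≤ B)
    (hK : ((Q.filter fun q => g q ≠ 0).card : ℝ) ≤ K) (hg : ∀ q ∈ Q, g q ≤ B) :
    ∑ q ∈ Q, g q ≤ K * B := by
  rw [← Finset.sum_filter_ne_zero]
  refine (Finset.sum_le_card_nsmul _ _ B fun q hq => hg q (Finset.mem_filter.1 hq).1).trans ?_
  rw [nsmul_eq_mul]
  exact mul_le_mul_of_nonneg_right hK hB

theorem card_filter_le_of_subset {α : Type*} (Q : Finset α) (p : α → Prop) [DecidablePred p]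
    {s : Set α} (hs : s.Finite) (h : ∀ q, p q → q ∈ s) : (Q.filter p).card ≤ s.ncard := by
  rw [← Set.ncard_coe_finset]
  exact Set.ncard_le_ncard (fun q hq => h q (Finset.mem_filter.1 hq).2) hs

/-- The shifts of a compactly supported function at one level form a Bessel sequence, with a bound
that does not depend on the level. -/
theorem level_bessel (hM : M.det ≠ 0) {R : ℝ} {η : (Fin d → ℝ) → ℂ} (hη : MemLp η 2 volume)
    (hR : SuppIn R η) : ∃ C : ℝ, 0 ≤ C ∧ ∀ n f (S : Finset (Fin d → ℤ)),
      ∑ k ∈ S, ‖inner ℂ (toH (atom M n k η)) f‖ ^ 2 ≤ C * ‖f‖ ^ 2 := by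
  classical
  obtain ⟨K, hK⟩ := exists_lattice_bound d (R + 1 * R)
  set B : ℝ := K * ((‖toH η‖ * ‖toH η‖) ^ 2)
  refine ⟨2 * Real.sqrt (K * B) / (1 - 1 / 2), by positivity, fun n f S => ?_⟩
  set x : ℕ → (Fin d → ℤ) → Lp ℂ 2 (volume : Measure (Fin d → ℝ)) := fun i p =>
    if i = 0 then toH (atom M n p η) else 0 with hx
  have hin : ∀ p q, inner ℂ (toH (atom M n p η)) (toH (atom M n q η)) ≠ (0 : ℂ) →
      ‖realVec p - realVec q‖ ≤ R + 1 * R := by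
    intro p q h
    rw [← innerL2_eq_inner (memLp_atom hM hη n q) (memLp_atom hM hη n p)] at h
    have h1 := innerL2_atom_add hM 0 0 n q p η η
    rw [zero_add] at h1
    rw [h1] at h
    have h2 := norm_le_of_innerL2_ne_zero hM (n := 0) (C := 1) (fun x => by simp) zero_le_one
      hR hR h
    rw [pow_zero, one_mulVec] at h2
    rwa [norm_sub_rev]
  have hcol : ∀ q (P : Finset (Fin d → ℤ)), ((P.filter fun p =>
      inner ℂ (toH (atom M n p η)) (toH (atom M n q η)) ≠ (0 : ℂ)).card : ℝ) ≤ K := by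
    intro q P
    have := card_filter_le_of_subset P _ (hK (realVec q)).1 (fun p hp => hin p q hp)
    exact_mod_cast this.trans (hK (realVec q)).2
  have h := bessel_of_gram x (K := K) (B := B) (ρ := 1 / 2) (Nat.cast_nonneg K) (by positivity)
    (by norm_num) (by norm_num) (fun i m q P => ?_) (fun i m p Q => ?_) f (S.image fun k => (0, k))
  · rw [Finset.sum_image (by intro a _ b _ hab; exact (Prod.mk.inj hab).2)] at h
    simpa only [hx, if_true] using h
  · by_cases hi : i = 0 ∧ m = 0
    · obtain ⟨rfl, rfl⟩ := hi
      simpa only [hx, add_zero, if_true] using hcol q P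
    · have : ∀ p, inner ℂ (x i p) (x (i + m) q) = (0 : ℂ) := fun p => by
        simp only [hx]
        by_cases h0 : i = 0
        · have : i + m ≠ 0 := by omega
          rw [if_neg this, inner_zero_right]
        · rw [if_neg h0, inner_zero_left]
      simp [this]
  · by_cases hi : i = 0 ∧ m = 0
    · obtain ⟨rfl, rfl⟩ := hi
      simp only [hx, add_zero, if_true, pow_zero, one_pow, mul_one]
      refine sum_le_of_card_filter_le Q _ (sq_nonneg _) ?_ fun q _ => ?_
      · have h1 := hcol p Q
        have h2 : (Q.filter fun q =>
            ‖(inner ℂ (toH (atom M n p η)) (toH (atom M n q η)) : ℂ)‖ ^ 2 ≠ 0)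
            = Q.filter fun q =>
              inner ℂ (toH (atom M n q η)) (toH (atom M n p η)) ≠ (0 : ℂ) := by
          refine Finset.filter_congr fun q _ => ?_
          rw [ne_eq, ne_eq, sq_eq_zero_iff, norm_eq_zero, inner_eq_zero_symm]
        rw [h2]; exact h1
      · refine pow_le_pow_left₀ (norm_nonneg _) ((norm_inner_le_norm _ _).trans ?_) 2
        rw [norm_toH_atom hM hη, norm_toH_atom hM hη]
    · have : ∀ q, inner ℂ (x i p) (x (i + m) q) = (0 : ℂ) := fun q => by
        simp only [hx]
        by_cases h0 : i = 0
        · have : i + m ≠ 0 := by omega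
          rw [if_neg this, inner_zero_right]
        · rw [if_neg h0, inner_zero_left]
      simp only [this, norm_zero, ne_eq, OfNat.ofNat_ne_zero, not_false_eq_true, zero_pow,
        Finset.sum_const_zero]
      positivity

/-- The integral part of a vector. -/
noncomputable def floorVec (x : Fin d → ℝ) : Fin d → ℤ := fun i => ⌊x i⌋

theorem measurable_floorVec : Measurable (floorVec : (Fin d → ℝ) → Fin d → ℤ) :=
  measurable_pi_iff.2 fun i => Int.measurable_floor.comp (measurable_pi_apply i)

theorem norm_sub_floorVec_le (x : Fin d → ℝ) : ‖x - realVec (floorVec x)‖ ≤ 1 := by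
  refine (pi_norm_le_iff_of_nonneg zero_le_one).2 fun i => ?_
  have h1 := Int.floor_le (x i)
  have h2 := (Int.lt_floor_add_one (x i)).le
  change |x i - (⌊x i⌋ : ℝ)| ≤ 1
  rw [abs_of_nonneg (sub_nonneg.2 h1)]
  linarith

theorem integral_floorVec {h : (Fin d → ℤ) → ℝ} (hh : (Function.support h).Finite) :
    ∫ y, h (floorVec y) = ∑' k, h k := by
  classical
  set S := hh.toFinset
  set cell : (Fin d → ℤ) → Set (Fin d → ℝ) := fun k =>
    Set.univ.pi fun i => Set.Ico (k i : ℝ) (k i + 1)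
  have hmem : ∀ k y, y ∈ cell k ↔ floorVec y = k := by
    intro k y
    simp only [cell, Set.mem_univ_pi, Set.mem_Ico, ← Int.floor_eq_iff]
    exact ⟨fun h => funext h, fun h i => congrFun h i⟩
  have hcell : ∀ k, MeasurableSet (cell k) := fun k =>
    MeasurableSet.univ_pi fun i => measurableSet_Ico
  have hvol : ∀ k, volume (cell k) = 1 := fun k => by
    simp [cell, Real.volume_pi_Ico]
  have heq : ∀ y, h (floorVec y) = ∑ k ∈ S, (cell k).indicator (fun _ => h k) y := by
    intro y
    by_cases hy : floorVec y ∈ S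
    · rw [Finset.sum_eq_single (floorVec y)]
      · rw [Set.indicator_of_mem ((hmem _ _).2 rfl)]
      · intro k _ hk
        exact Set.indicator_of_notMem (fun hc => hk ((hmem _ _).1 hc).symm) _
      · exact fun hc => absurd hy hc
    · have h0 : h (floorVec y) = 0 := by
        by_contra hc
        exact hy (hh.mem_toFinset.2 hc)
      rw [h0]
      refine (Finset.sum_eq_zero fun k hk => Set.indicator_of_notMem (fun hc => hy ?_) _).symm
      rw [(hmem _ _).1 hc]; exact hk
  simp only [heq]
  rw [integral_finsetSum, tsum_eq_sum (s := S) fun k hk => by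
    by_contra hc; exact hk (hh.mem_toFinset.2 hc)]
  · refine Finset.sum_congr rfl fun k _ => ?_
    rw [integral_indicator (hcell k), setIntegral_const, Measure.real, hvol]
    simp
  · intro k _
    refine (integrable_indicator_iff (hcell k)).2 (integrableOn_const (by rw [hvol]; simp))

/-- The inner products of a continuous function with the functions of level `n` behave like a
Riemann sum of `|f|²`. -/
theorem tendsto_level_energy (hM : IsDilation M) {f η : (Fin d → ℝ) → ℂ} (hf : Continuous f)
    (hfs : HasCompactSupport f) (hη : MemLp η 2 volume) (hηs : HasCompactSupport η) :
    Tendsto (fun n => ∑' k, ‖innerL2 f (atom M n k η)‖ ^ 2) atTop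
      (𝓝 (‖∫ x, η x‖ ^ 2 * ∫ x, ‖f x‖ ^ 2)) := by
  have hdet := hM.det_ne_zero
  have hD : 0 < |(realMat M).det| := abs_pos.2 (realMat_isUnit_det hdet).ne_zero
  obtain ⟨C, ρ, hC, hρ, hρ1, hdec, -⟩ := hM.exists_norm_decay
  have hdecC : ∀ n x, ‖((realMat M)⁻¹ ^ n) *ᵥ x‖ ≤ C * ‖x‖ := fun n x =>
    (hdec n x).trans (mul_le_mul_of_nonneg_right (mul_le_of_le_one_right hC.le
      (pow_le_one₀ hρ.le hρ1.le)) (norm_nonneg _))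
  obtain ⟨R₁, hR₁, hfR⟩ := exists_suppIn hfs
  obtain ⟨R₂, hR₂, hηR⟩ := exists_suppIn hηs
  have hη1 : Integrable η := integrable_of_memLp_two hη hηs
  obtain ⟨B, hB⟩ := hf.bounded_above_of_compact_support hfs
  have hB0 : 0 ≤ B := (norm_nonneg _).trans (hB 0)
  -- after the change of variables `y = M^n x - k`, the inner products are averages `g n k` of `f`
  -- near the point `M^{-n} k`, and the sum over `k` is an integral over the cells of `M^{-n} ℤ^d`
  set g : ℕ → (Fin d → ℤ) → ℂ := fun n k =>
    ∫ y, f (((realMat M)⁻¹ ^ n) *ᵥ (y + realVec k)) * conj (η y) with hg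
  have hginner : ∀ n k, innerL2 f (atom M n k η)
      = ((Real.sqrt |(realMat M).det| ^ n : ℝ) : ℂ) * ((|(realMat M ^ n).det|⁻¹ : ℝ) * g n k) := by
    intro n k
    have hdn : (realMat M ^ n).det ≠ 0 := by
      rw [det_pow]; exact pow_ne_zero _ (realMat_isUnit_det hdet).ne_zero
    have h1 := integral_comp_mulVec hdn
      (fun z => f (((realMat M)⁻¹ ^ n) *ᵥ z) * conj (η (z - realVec k)))
    have h2 : ∫ z, f (((realMat M)⁻¹ ^ n) *ᵥ z) * conj (η (z - realVec k)) = g n k := by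
      rw [← integral_add_right_eq_self _ (realVec k)]
      simp only [add_sub_cancel_right]; rfl
    rw [h2, Complex.real_smul] at h1
    rw [← h1, ← integral_const_mul, innerL2]
    refine integral_congr_ae (ae_of_all _ fun x => ?_)
    simp only [realMat_inv_pow_mulVec hdet, atom, map_mul, conj_ofReal]
    ring
  have hsq : ∀ n k, ‖innerL2 f (atom M n k η)‖ ^ 2 = |(realMat M ^ n).det|⁻¹ * ‖g n k‖ ^ 2 := by
    intro n k
    rw [hginner, norm_mul, norm_mul, Complex.norm_real, Complex.norm_real, Real.norm_of_nonneg
      (by positivity), Real.norm_of_nonneg (by positivity), det_pow, abs_pow, mul_pow, mul_pow,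
      ← pow_mul, mul_comm n 2, pow_mul, Real.sq_sqrt (abs_nonneg _)]
    field_simp
  have hgsupp : ∀ n, (Function.support fun k => ‖g n k‖ ^ 2).Finite := by
    intro n
    refine (finite_innerL2_ne_zero hdet (hfR.mono (le_max_left R₁ R₂))
      (hηR.mono (le_max_right R₁ R₂)) n).subset fun k hk h0 => hk ?_
    have h1 := hsq n k
    rw [h0, norm_zero] at h1
    have h2 : |(realMat M ^ n).det|⁻¹ ≠ 0 := by
      rw [det_pow, abs_pow]; positivity
    rw [zero_pow two_ne_zero] at h1
    exact (mul_eq_zero.1 h1.symm).resolve_left h2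
  have hint : ∀ n, ∑' k, ‖innerL2 f (atom M n k η)‖ ^ 2
      = ∫ x, ‖g n (floorVec ((realMat M ^ n) *ᵥ x))‖ ^ 2 := by
    intro n
    have hdn : (realMat M ^ n).det ≠ 0 := by
      rw [det_pow]; exact pow_ne_zero _ (realMat_isUnit_det hdet).ne_zero
    rw [integral_comp_mulVec hdn (fun z => ‖g n (floorVec z)‖ ^ 2),
      integral_floorVec (h := fun k => ‖g n k‖ ^ 2) (hgsupp n), smul_eq_mul, ← tsum_mul_left]
    exact tsum_congr fun k => hsq n k
  simp only [hint]
  have hlim : ‖∫ x, η x‖ ^ 2 * ∫ x, ‖f x‖ ^ 2 = ∫ x, ‖f x * conj (∫ y, η y)‖ ^ 2 := by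
    rw [← integral_const_mul]
    refine integral_congr_ae (ae_of_all _ fun x => ?_)
    simp only [norm_mul, RCLike.norm_conj, mul_pow]
    ring
  rw [hlim]
  -- dominated convergence, for the inner integrals and for the outer one
  have hηn : Integrable fun y => B * ‖η y‖ := hη1.norm.const_mul B
  have hbound : ∀ n k y, ‖f (((realMat M)⁻¹ ^ n) *ᵥ (y + realVec k)) * conj (η y)‖
      ≤ B * ‖η y‖ := fun n k y => by
    rw [norm_mul, RCLike.norm_conj]
    exact mul_le_mul_of_nonneg_right (hB _) (norm_nonneg _)
  have hgB : ∀ n k, ‖g n k‖ ≤ ∫ y, B * ‖η y‖ := fun n k =>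
    norm_integral_le_of_norm_le hηn (ae_of_all _ (hbound n k))
  set E : ℝ := ∫ y, B * ‖η y‖
  set R₃ : ℝ := R₁ + C * (R₂ + 1)
  refine tendsto_integral_of_dominated_convergence
    ((Metric.closedBall (0 : Fin d → ℝ) R₃).indicator fun _ => E ^ 2) ?_ ?_ ?_ ?_
  · intro n
    have hm : Measurable fun k => ‖g n k‖ ^ 2 := measurable_of_countable _
    exact (hm.comp (measurable_floorVec.comp (by fun_prop))).aestronglyMeasurable
  · refine (integrable_indicator_iff Metric.isClosed_closedBall.measurableSet).2
      (integrableOn_const ?_)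
    exact (isCompact_closedBall _ _).measure_lt_top.ne
  · intro n
    refine ae_of_all _ fun x => ?_
    rw [Real.norm_of_nonneg (sq_nonneg _)]
    by_cases hx : x ∈ Metric.closedBall (0 : Fin d → ℝ) R₃
    · rw [Set.indicator_of_mem hx]
      exact pow_le_pow_left₀ (norm_nonneg _) (hgB _ _) 2
    · rw [Set.indicator_of_notMem hx]
      have h0 : g n (floorVec ((realMat M ^ n) *ᵥ x)) = 0 := by
        refine integral_eq_zero_of_ae (ae_of_all _ fun y => ?_)
        by_contra hne
        have h1 := hfR _ (left_ne_zero_of_mul hne)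
        have h2 := hηR y (by simpa using right_ne_zero_of_mul hne)
        apply hx
        rw [mem_closedBall_zero_iff]
        set z := (realMat M ^ n) *ᵥ x with hz
        have h3 : x = ((realMat M)⁻¹ ^ n) *ᵥ (y + realVec (floorVec z))
            - ((realMat M)⁻¹ ^ n) *ᵥ (y - (z - realVec (floorVec z))) := by
          rw [← mulVec_sub, ← realMat_inv_pow_mulVec hdet n x, ← hz]
          congr 1; abel
        rw [h3]
        refine (norm_sub_le _ _).trans (add_le_add h1 ((hdecC n _).trans ?_))
        refine mul_le_mul_of_nonneg_left ((norm_sub_le _ _).trans ?_) hC.le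
        exact add_le_add h2 (norm_sub_floorVec_le _)
      rw [h0]; simp
  · refine ae_of_all _ fun x => ((Tendsto.norm ?_).pow 2)
    have hc : f x * conj (∫ y, η y) = ∫ y, f x * conj (η y) := by
      rw [integral_const_mul, integral_conj]
    rw [hc]
    refine tendsto_integral_of_dominated_convergence (fun y => B * ‖η y‖) (fun n => ?_) hηn
      (fun n => ae_of_all _ (hbound n _)) (ae_of_all _ fun y => Tendsto.mul_const _ ?_)
    · refine AEStronglyMeasurable.mul (Continuous.aestronglyMeasurable (by fun_prop)) ?_
      exact continuous_conj.comp_aestronglyMeasurable hη1.aestronglyMeasurable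
    · refine (hf.tendsto x).comp ?_
      rw [tendsto_iff_norm_sub_tendsto_zero]
      have hz : Tendsto (fun n => C * ρ ^ n * (‖y‖ + 1)) atTop (𝓝 0) := by
        simpa using ((tendsto_pow_atTop_nhds_zero_of_lt_one hρ.le hρ1).const_mul C).mul_const
          (‖y‖ + 1)
      refine squeeze_zero (fun _ => norm_nonneg _) (fun n => ?_) hz
      set z := (realMat M ^ n) *ᵥ x with hz
      have h3 : ((realMat M)⁻¹ ^ n) *ᵥ (y + realVec (floorVec z)) - x
          = ((realMat M)⁻¹ ^ n) *ᵥ (y - (z - realVec (floorVec z))) := by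
        refine (congrArg (fun t => _ - t) (realMat_inv_pow_mulVec hdet n x).symm).trans ?_
        rw [← hz, ← mulVec_sub]
        congr 1; abel
      rw [h3]
      refine (hdec n _).trans (mul_le_mul_of_nonneg_left ((norm_sub_le _ _).trans ?_)
        (by positivity))
      exact add_le_add le_rfl (norm_sub_floorVec_le _)

end Level

/-! ### Decay across levels and the Bessel property -/

section Decay
variable {d r s : ℕ} {M : Matrix (Fin d) (Fin d) ℤ}

/-- The functions `|det M| ∑ₖ c(k) f(M · - k)`. -/
noncomputable def refined (M : Matrix (Fin d) (Fin d) ℤ) (c : Mask d s r)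
    (f : Fin r → (Fin d → ℝ) → ℂ) (l : Fin s) (x : Fin d → ℝ) : ℂ :=
  ∑ z ∈ c.support ×ˢ Finset.univ,
    (((Real.sqrt |(realMat M).det| : ℝ) : ℂ) * c z.1 l z.2) * atom M 1 z.1 (f z.2) x

theorem memLp_refined (hM : M.det ≠ 0) {p : ℝ≥0∞} {c : Mask d s r} {f : Fin r → (Fin d → ℝ) → ℂ}
    (hf : ∀ i, MemLp (f i) p volume) (l : Fin s) : MemLp (refined M c f l) p volume :=
  memLp_finsetSum _ fun z _ => (memLp_atom hM (hf z.2) 1 z.1).const_mul _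

theorem atom_atom_one (j : ℕ) (k q : Fin d → ℤ) (f : (Fin d → ℝ) → ℂ) :
    atom M j k (atom M 1 q f) = atom M (j + 1) (q + M *ᵥ k) f := by
  funext x
  simp only [atom, pow_one, mulVec_sub, mulVec_mulVec, realMat_mulVec, realVec_add]
  rw [← pow_succ', sub_sub, add_comm (realVec q), pow_succ (Real.sqrt _), ofReal_mul,
    mul_assoc]

theorem atom_refined (c : Mask d s r) (f : Fin r → (Fin d → ℝ) → ℂ) (l : Fin s) (j : ℕ)
    (k : Fin d → ℤ) (x : Fin d → ℝ) :
    atom M j k (refined M c f l) x = ∑ z ∈ c.support ×ˢ Finset.univ,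
      (((Real.sqrt |(realMat M).det| : ℝ) : ℂ) * c z.1 l z.2)
        * atom M (j + 1) (z.1 + M *ᵥ k) (f z.2) x := by
  simp only [← atom_atom_one]
  rw [atom, refined, Finset.mul_sum]
  refine Finset.sum_congr rfl fun z _ => ?_
  rw [atom.eq_1 M j k]; ring

theorem innerL2_refined_left (hM : M.det ≠ 0) (c : Mask d s r) {f : Fin r → (Fin d → ℝ) → ℂ}
    (hf : ∀ i, MemLp (f i) 2 volume) {g : (Fin d → ℝ) → ℂ} (hg : MemLp g 2 volume) (l : Fin s)
    (j : ℕ) (k : Fin d → ℤ) :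
    innerL2 (atom M j k (refined M c f l)) g = ∑ z ∈ c.support ×ˢ Finset.univ,
      (((Real.sqrt |(realMat M).det| : ℝ) : ℂ) * c z.1 l z.2)
        * innerL2 (atom M (j + 1) (z.1 + M *ᵥ k) (f z.2)) g := by
  have h1 : toH (atom M j k (refined M c f l)) = ∑ z ∈ c.support ×ˢ Finset.univ,
      (((Real.sqrt |(realMat M).det| : ℝ) : ℂ) * c z.1 l z.2)
        • toH (atom M (j + 1) (z.1 + M *ᵥ k) (f z.2)) := by
    rw [← toH_finset_sum _ _ _ fun z _ => memLp_atom hM (hf z.2) _ _]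
    congr 1
    funext x
    exact atom_refined c f l j k x
  rw [innerL2_eq_inner (memLp_atom hM (memLp_refined hM hf l) j k) hg, h1, inner_sum]
  refine Finset.sum_congr rfl fun z _ => ?_
  rw [inner_smul_right, innerL2_eq_inner (memLp_atom hM (hf z.2) _ _) hg]

theorem innerL2_conj_symm (f g : (Fin d → ℝ) → ℂ) : conj (innerL2 f g) = innerL2 g f := by
  rw [innerL2, innerL2, ← integral_conj]
  refine integral_congr_ae (ae_of_all _ fun x => ?_)
  simp only [map_mul, conj_conj]
  ring

theorem innerL2_congr_left {f f' : (Fin d → ℝ) → ℂ} (h : f =ᵐ[volume] f') (g : (Fin d → ℝ) → ℂ) :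
    innerL2 f g = innerL2 f' g := by
  refine integral_congr_ae ?_
  filter_upwards [h] with x hx
  rw [hx]

theorem summable_level (hM : M.det ≠ 0) {f η : (Fin d → ℝ) → ℂ} (hf : MemLp f 2 volume)
    (hη : MemLp η 2 volume) (hηs : HasCompactSupport η) (n : ℕ) :
    Summable fun k => ‖innerL2 f (atom M n k η)‖ ^ 2 := by
  obtain ⟨R, -, hR⟩ := exists_suppIn hηs
  obtain ⟨C, -, hC⟩ := level_bessel hM hη hR
  refine summable_of_sum_le (c := C * ‖toH f‖ ^ 2) (fun k => sq_nonneg _) fun S => ?_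
  simp only [innerL2_eq_inner hf (memLp_atom hM hη n _)]
  exact hC n _ S

/-- The energy in level `n` of a square-integrable function with respect to a function of mean zero
tends to zero. -/
theorem tendsto_level_energy_zero (hM : IsDilation M) {f η : (Fin d → ℝ) → ℂ}
    (hf : MemLp f 2 volume) (hη : MemLp η 2 volume) (hηs : HasCompactSupport η)
    (hη0 : ∫ x, η x = 0) :
    Tendsto (fun n => ∑' k, ‖innerL2 f (atom M n k η)‖ ^ 2) atTop (𝓝 0) := by
  have hdet := hM.det_ne_zero
  obtain ⟨R, -, hR⟩ := exists_suppIn hηs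
  obtain ⟨C, hC0, hC⟩ := level_bessel hdet hη hR
  rw [Metric.tendsto_nhds]
  intro ε hε
  set δ : ℝ := Real.sqrt (ε / (4 * (C + 1))) with hδ
  have hδ0 : 0 < δ := Real.sqrt_pos.2 (by positivity)
  obtain ⟨g, hgs, hfg, hgc, hg⟩ := hf.exists_hasCompactSupport_eLpNorm_sub_le (by norm_num)
    (ε := ENNReal.ofReal δ) (by simpa using hδ0)
  have hlim := tendsto_level_energy hM hgc hgs hη hηs
  rw [hη0] at hlim
  simp only [norm_zero, ne_eq, OfNat.ofNat_ne_zero, not_false_eq_true, zero_pow, zero_mul] at hlim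
  have hfgH : ‖toH f - toH g‖ ≤ δ := by
    rw [← toH_sub hf hg]
    have h1 : eLpNorm (fun x => f x - g x) 2 volume ≤ ENNReal.ofReal δ := hfg
    rw [eLpNorm_eq_norm_toH (f := fun x => f x - g x) (hf.sub hg)] at h1
    exact (ENNReal.ofReal_le_ofReal_iff hδ0.le).1 h1
  filter_upwards [hlim.eventually (gt_mem_nhds (show (0 : ℝ) < ε / 4 by positivity))] with n hn
  rw [Real.dist_eq, sub_zero, abs_of_nonneg (tsum_nonneg fun k => sq_nonneg _)]
  have hle : ∑' k, ‖innerL2 f (atom M n k η)‖ ^ 2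
      ≤ 2 * (C * δ ^ 2) + 2 * ∑' k, ‖innerL2 g (atom M n k η)‖ ^ 2 := by
    refine Real.tsum_le_of_sum_le (fun k => sq_nonneg _) fun S => ?_
    have h1 : ∀ k ∈ S, ‖innerL2 f (atom M n k η)‖ ^ 2
        ≤ 2 * ‖inner ℂ (toH (atom M n k η)) (toH f - toH g)‖ ^ 2
          + 2 * ‖innerL2 g (atom M n k η)‖ ^ 2 := by
      intro k _
      rw [innerL2_eq_inner hf (memLp_atom hdet hη n k),
        innerL2_eq_inner hg (memLp_atom hdet hη n k),
        inner_sub_right]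
      set u : ℂ := inner ℂ (toH (atom M n k η)) (toH f)
      set v : ℂ := inner ℂ (toH (atom M n k η)) (toH g)
      have h2 : ‖u‖ ≤ ‖u - v‖ + ‖v‖ := by simpa using norm_add_le (u - v) v
      nlinarith [norm_nonneg u, norm_nonneg (u - v), norm_nonneg v, sq_nonneg (‖u - v‖ - ‖v‖)]
    refine (Finset.sum_le_sum h1).trans ?_
    rw [Finset.sum_add_distrib, ← Finset.mul_sum, ← Finset.mul_sum]
    refine add_le_add (mul_le_mul_of_nonneg_left ((hC n _ S).trans ?_) zero_le_two)
      (mul_le_mul_of_nonneg_left ?_ zero_le_two)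
    · exact mul_le_mul_of_nonneg_left (pow_le_pow_left₀ (norm_nonneg _) hfgH 2) hC0
    · exact (summable_level hdet hg hη hηs n).sum_le_tsum S fun k _ => sq_nonneg _
  have hCδ : C * δ ^ 2 ≤ ε / 4 := by
    rw [hδ, Real.sq_sqrt (by positivity), ← mul_div_assoc, div_le_div_iff₀ (by positivity)
      (by positivity)]
    nlinarith
  linarith

/-- For a refinable vector `φ` and a function `η` of mean zero, the inner products of `φ` with the
functions of level `n` decay geometrically. The correlations of these inner products at different
shifts evolve by a fixed linear map on a finite-dimensional space. -/
theorem level_decay (hM : IsDilation M) {a : Mask d r r} {φ : Fin r → (Fin d → ℝ) → ℂ} {R : ℝ}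
    (hφ : ∀ l, MemLp (φ l) 2 volume) (hφR : ∀ l, SuppIn R (φ l))
    (href : ∀ l, φ l =ᵐ[volume] refined M a φ l) {η : (Fin d → ℝ) → ℂ}
    (hη : MemLp η 2 volume) (hηR : SuppIn R η) (hη0 : ∫ x, η x = 0) :
    ∃ C ρ : ℝ, 0 ≤ C ∧ 0 < ρ ∧ ρ < 1 ∧ ∀ l n (Q : Finset (Fin d → ℤ)),
      ∑ k ∈ Q, ‖innerL2 (φ l) (atom M n k η)‖ ^ 2 ≤ C * ρ ^ n := by
  classical
  have hdet := hM.det_ne_zero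
  obtain ⟨C, ρ, hC, hρ, hρ1, hdec, -⟩ := hM.exists_norm_decay
  have hdecC : ∀ n x, ‖((realMat M)⁻¹ ^ n) *ᵥ x‖ ≤ C * ‖x‖ := fun n x =>
    (hdec n x).trans (mul_le_mul_of_nonneg_right (mul_le_of_le_one_right hC.le
      (pow_le_one₀ hρ.le hρ1.le)) (norm_nonneg _))
  set Z := a.support ×ˢ (Finset.univ : Finset (Fin r))
  set co : (Fin d → ℤ) × Fin r → Fin r → ℂ := fun z l =>
    ((Real.sqrt |(realMat M).det| : ℝ) : ℂ) * a z.1 l z.2 with hco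
  set G : ℕ → Fin r → (Fin d → ℤ) → (Fin d → ℤ) → ℂ := fun n l p k =>
    innerL2 (atom M 0 p (φ l)) (atom M n k η) with hG
  have hGfin : ∀ n l p, {k | G n l p k ≠ 0}.Finite := fun n l p =>
    finite_innerL2_atom_ne_zero hdet (hφR l) hηR p n
  have hGsucc : ∀ n l p k, G (n + 1) l p k = ∑ z ∈ Z, co z l * G n z.2 (z.1 + M *ᵥ p) k := by
    intro n l p k
    simp only [hG]
    rw [innerL2_congr_left (atom_ae_eq hdet (href l) 0 p),
      innerL2_refined_left hdet a hφ (memLp_atom hdet hη _ _)]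
    refine Finset.sum_congr rfl fun z _ => ?_
    rw [innerL2_atom_add hdet 0 n 1]
  have hGshift : ∀ n l p k u, G n l (p + u) (k + (M ^ n) *ᵥ u) = G n l p k := by
    intro n l p k u
    have := innerL2_atom_shift (M := M) 0 n p k u (φ l) η
    rwa [pow_zero, one_mulVec] at this
  -- the correlations, which depend on the difference of the shifts only
  set S : ℕ → Fin r → (Fin d → ℤ) → Fin r → (Fin d → ℤ) → ℂ := fun n l₁ p₁ l₂ p₂ =>
    ∑' k, G n l₁ p₁ k * conj (G n l₂ p₂ k) with hS
  have hSsum : ∀ n l₁ p₁ l₂ p₂, Summable fun k => G n l₁ p₁ k * conj (G n l₂ p₂ k) :=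
    fun n l₁ p₁ l₂ p₂ => summable_of_hasFiniteSupport
      ((hGfin n l₁ p₁).subset fun k hk => left_ne_zero_of_mul hk)
  have hSshift : ∀ n l₁ p₁ l₂ p₂ u, S n l₁ (p₁ + u) l₂ (p₂ + u) = S n l₁ p₁ l₂ p₂ := by
    intro n l₁ p₁ l₂ p₂ u
    simp only [hS]
    rw [← (Equiv.addRight ((M ^ n) *ᵥ u)).tsum_eq]
    simp only [Equiv.coe_addRight, hGshift]
  have hSsucc : ∀ n l₁ p₁ l₂ p₂, S (n + 1) l₁ p₁ l₂ p₂ = ∑ z ∈ Z, ∑ w ∈ Z,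
      co z l₁ * conj (co w l₂) * S n z.2 (z.1 + M *ᵥ p₁) w.2 (w.1 + M *ᵥ p₂) := by
    intro n l₁ p₁ l₂ p₂
    have h1 : ∀ k, G (n + 1) l₁ p₁ k * conj (G (n + 1) l₂ p₂ k) = ∑ z ∈ Z, ∑ w ∈ Z,
        co z l₁ * conj (co w l₂) *
          (G n z.2 (z.1 + M *ᵥ p₁) k * conj (G n w.2 (w.1 + M *ᵥ p₂) k)) := by
      intro k
      rw [hGsucc, hGsucc, map_sum, Finset.sum_mul_sum]
      refine Finset.sum_congr rfl fun z _ => Finset.sum_congr rfl fun w _ => ?_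
      rw [map_mul]; ring
    simp only [hS, h1]
    rw [Summable.tsum_finsetSum fun z _ => summable_sum fun w _ => (hSsum n _ _ _ _).mul_left _]
    refine Finset.sum_congr rfl fun z _ => ?_
    rw [Summable.tsum_finsetSum fun w _ => (hSsum n _ _ _ _).mul_left _]
    exact Finset.sum_congr rfl fun w _ => tsum_mul_left
  -- correlations of far shifts vanish
  set R' : ℝ := 2 * (R + C * R)
  obtain ⟨K, hK⟩ := exists_lattice_bound d R'
  set F : Finset (Fin d → ℤ) := (hK 0).1.toFinset
  have hSfar : ∀ n l₁ l₂ p, p ∉ F → S n l₁ 0 l₂ p = 0 := by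
    intro n l₁ l₂ p hp
    have h0 : ∀ k, G n l₁ 0 k * conj (G n l₂ p k) = 0 := by
      intro k
      by_contra hne
      have h1 := norm_le_of_innerL2_ne_zero hdet (hdecC n) hC.le (hφR l₁) hηR
        (left_ne_zero_of_mul hne)
      have h2 := norm_le_of_innerL2_ne_zero hdet (hdecC n) hC.le (hφR l₂) hηR
        (p := p) (k := k) (by simpa [hG] using right_ne_zero_of_mul hne)
      apply hp
      refine (hK 0).1.mem_toFinset.2 ?_
      change ‖realVec p - 0‖ ≤ R'
      rw [realVec_zero] at h1
      have h3 : realVec p - 0 = (realVec p - ((realMat M)⁻¹ ^ n) *ᵥ realVec k)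
          - (0 - ((realMat M)⁻¹ ^ n) *ᵥ realVec k) := by abel
      rw [h3]
      exact (norm_sub_le _ _).trans ((add_le_add h2 h1).trans_eq (two_mul _).symm)
    simp only [hS, h0, tsum_zero]
  have hF0 : (0 : Fin d → ℤ) ∈ F ∨ ∀ n l₁ l₂, S n l₁ 0 l₂ 0 = 0 := by
    by_cases h : (0 : Fin d → ℤ) ∈ F
    · exact Or.inl h
    · exact Or.inr fun n l₁ l₂ => hSfar n l₁ l₂ 0 h
  have hdiag : ∀ n l p, S n l p l p = ((∑' k, ‖G n l p k‖ ^ 2 : ℝ) : ℂ) := by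
    intro n l p
    rw [ofReal_tsum]
    refine tsum_congr fun k => ?_
    rw [Complex.mul_conj']; push_cast; rfl
  have hGsum : ∀ n l p, Summable fun k => ‖G n l p k‖ ^ 2 := fun n l p =>
    summable_of_hasFiniteSupport ((hGfin n l p).subset fun k hk h0 => hk (by simp [h0]))
  have hG0 : ∀ n l k, G n l 0 k = innerL2 (φ l) (atom M n k η) := fun n l k => by
    simp only [hG, atom_zero_zero]
  have hen : ∀ l, Tendsto (fun n => ∑' k, ‖G n l 0 k‖ ^ 2) atTop (𝓝 0) := by
    intro l
    simp only [hG0]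
    exact tendsto_level_energy_zero hM (hφ l) hη hηR.hasCompactSupport hη0
  have hdiag' : ∀ n l p, ∑' k, ‖G n l p k‖ ^ 2 = ∑' k, ‖G n l 0 k‖ ^ 2 := by
    intro n l p
    have := hSshift n l 0 l 0 p
    rw [zero_add, hdiag, hdiag] at this
    exact_mod_cast this
  have hSle : ∀ n l₁ l₂ p, ‖S n l₁ 0 l₂ p‖
      ≤ 1 / 2 * (∑' k, ‖G n l₁ 0 k‖ ^ 2) + 1 / 2 * (∑' k, ‖G n l₂ 0 k‖ ^ 2) := by
    intro n l₁ l₂ p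
    rw [← hdiag' n l₂ p, ← tsum_mul_left, ← tsum_mul_left,
      ← Summable.tsum_add ((hGsum _ _ _).mul_left _) ((hGsum _ _ _).mul_left _)]
    refine tsum_of_norm_bounded
      (((hGsum n l₁ 0).mul_left _).add ((hGsum n l₂ p).mul_left _)).hasSum fun k => ?_
    rw [norm_mul, RCLike.norm_conj]
    nlinarith [sq_nonneg (‖G n l₁ 0 k‖ - ‖G n l₂ p k‖)]
  -- the map `A` that takes the correlations of level `n` to those of level `n + 1`
  let ext : (Fin r × Fin r × F → ℂ) → Fin r → Fin r → (Fin d → ℤ) → ℂ := fun t i j p =>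
    if h : p ∈ F then t (i, j, ⟨p, h⟩) else 0
  let A : (Fin r × Fin r × F → ℂ) →ₗ[ℂ] (Fin r × Fin r × F → ℂ) :=
    { toFun := fun t y => ∑ z ∈ Z, ∑ w ∈ Z, co z y.1 * conj (co w y.2.1) *
        ext t z.2 w.2 (w.1 + M *ᵥ y.2.2.1 - z.1)
      map_add' := fun t t' => by
        funext y
        simp only [Pi.add_apply, ← Finset.sum_add_distrib]
        refine Finset.sum_congr rfl fun z _ => Finset.sum_congr rfl fun w _ => ?_
        simp only [ext]
        split_ifs
        · rw [Pi.add_apply]; ring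
        · ring
      map_smul' := fun c t => by
        funext y
        simp only [Pi.smul_apply, smul_eq_mul, Finset.mul_sum, RingHom.id_apply]
        refine Finset.sum_congr rfl fun z _ => Finset.sum_congr rfl fun w _ => ?_
        simp only [ext]
        split_ifs
        · rw [Pi.smul_apply, smul_eq_mul]; ring
        · ring }
  set t : ℕ → (Fin r × Fin r × F → ℂ) := fun n y => S n y.1 0 y.2.1 y.2.2.1 with ht
  have hext : ∀ n i j p, ext (t n) i j p = S n i 0 j p := by
    intro n i j p
    by_cases h : p ∈ F
    · simp only [ext, dif_pos h, ht]
    · simp only [ext, dif_neg h, hSfar n i j p h]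
  have hAt : ∀ n, A (t n) = t (n + 1) := by
    intro n
    funext y
    change ∑ z ∈ Z, ∑ w ∈ Z, co z y.1 * conj (co w y.2.1) *
        ext (t n) z.2 w.2 (w.1 + M *ᵥ y.2.2.1 - z.1) = S (n + 1) y.1 0 y.2.1 y.2.2.1
    rw [hSsucc]
    refine Finset.sum_congr rfl fun z _ => Finset.sum_congr rfl fun w _ => ?_
    rw [hext, ← hSshift n z.2 0 w.2 _ z.1, mulVec_zero, add_zero, zero_add, sub_add_cancel]
  have hpow : ∀ n, (A ^ n) (t 0) = t n := by
    intro n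
    induction n with
    | zero => rfl
    | succ n ih => rw [pow_succ', Module.End.mul_apply, ih, hAt]
  have htend : Tendsto (fun n => (A ^ n) (t 0)) atTop (𝓝 0) := by
    simp only [hpow]
    refine tendsto_pi_nhds.2 fun y => ?_
    refine squeeze_zero_norm (fun n => hSle n y.1 y.2.1 y.2.2.1) ?_
    have h0 := ((hen y.1).const_mul (1 / 2)).add ((hen y.2.1).const_mul (1 / 2))
    rwa [mul_zero, add_zero] at h0
  obtain ⟨C', ρ', hC', hρ', hρ1', hfinal⟩ := exists_geometric_decay A htend
  refine ⟨C', ρ', hC', hρ', hρ1', fun l n Q => ?_⟩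
  have h1 : ∑ k ∈ Q, ‖innerL2 (φ l) (atom M n k η)‖ ^ 2 ≤ ∑' k, ‖G n l 0 k‖ ^ 2 := by
    simp only [← hG0]
    exact (hGsum n l 0).sum_le_tsum Q fun k _ => sq_nonneg _
  have h2 : ‖S n l 0 l 0‖ = ∑' k, ‖G n l 0 k‖ ^ 2 := by
    rw [hdiag, Complex.norm_real, Real.norm_of_nonneg (tsum_nonneg fun k => sq_nonneg _)]
  rw [← h2] at h1
  refine h1.trans ?_
  rcases hF0 with h | h
  · have h3 := norm_le_pi_norm (t n) (l, l, ⟨0, h⟩)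
    have h4 := hfinal n
    rw [hpow] at h4
    exact h3.trans h4
  · rw [h, norm_zero]; positivity

/-- The dilates and shifts of the functions `ψ = |det M| ∑ₖ b(k) φ(M · - k)` of mean zero form a
Bessel sequence. -/
theorem wavelet_bessel (hM : IsDilation M) {a : Mask d r r} {b : Mask d s r}
    {φ : Fin r → (Fin d → ℝ) → ℂ} {R : ℝ}
    (hφ : ∀ l, MemLp (φ l) 2 volume) (hφR : ∀ l, SuppIn R (φ l))
    (href : ∀ l, φ l =ᵐ[volume] refined M a φ l) (hψR : ∀ l, SuppIn R (refined M b φ l))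
    (hψ0 : ∀ l, ∫ x, refined M b φ l x = 0) :
    ∃ C : ℝ, 0 ≤ C ∧ ∀ f (S : Finset (ℕ × Fin s × (Fin d → ℤ))),
      ∑ z ∈ S, ‖inner ℂ (toH (atom M z.1 z.2.2 (refined M b φ z.2.1))) f‖ ^ 2 ≤ C * ‖f‖ ^ 2 := by
  classical
  have hdet := hM.det_ne_zero
  obtain ⟨C, ρ, hC, hρ, hρ1, hdec, -⟩ := hM.exists_norm_decay
  have hdecC : ∀ n x, ‖((realMat M)⁻¹ ^ n) *ᵥ x‖ ≤ C * ‖x‖ := fun n x =>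
    (hdec n x).trans (mul_le_mul_of_nonneg_right (mul_le_of_le_one_right hC.le
      (pow_le_one₀ hρ.le hρ1.le)) (norm_nonneg _))
  set ψ : Fin s → (Fin d → ℝ) → ℂ := refined M b φ with hψdef
  have hψ : ∀ l, MemLp (ψ l) 2 volume := fun l => memLp_refined hdet hφ l
  choose C₁ ρ₁ hC₁ hρ₁ hρ₁1 hlev using fun l =>
    level_decay hM hφ hφR href (hψ l) (hψR l) (hψ0 l)
  choose C₂ hC₂ hbes using fun l => level_bessel hdet (hψ l) (hψR l)
  have : Nonempty (Set.Ioo (0 : ℝ) 1) := ⟨⟨1 / 2, by norm_num, by norm_num⟩⟩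
  obtain ⟨⟨q, hq0, hq1⟩, hq⟩ := Finite.exists_le
    (fun l => (⟨ρ₁ l, hρ₁ l, hρ₁1 l⟩ : Set.Ioo (0 : ℝ) 1))
  replace hq : ∀ l, ρ₁ l ≤ q := hq
  obtain ⟨K, hK⟩ := exists_lattice_bound d (R + C * R)
  set co : (Fin d → ℤ) × Fin r → Fin s → ℂ := fun z l =>
    ((Real.sqrt |(realMat M).det| : ℝ) : ℂ) * b z.1 l z.2 with hco
  set Z := b.support ×ˢ (Finset.univ : Finset (Fin r))
  -- `B₀` bounds the rows of the Gram matrix within a level, and `B₁ q ^ n` those between levels at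
  -- distance `n + 1`
  set B₀ : ℝ := ∑ l' : Fin s, C₂ l' * ∑ l, ‖toH (ψ l)‖ ^ 2 with hB₀
  set B₁ : ℝ := (∑ l, ∑ z ∈ Z, ‖co z l‖ ^ 2) * ((Z.card : ℝ) * ∑ l', C₁ l') with hB₁
  have hB₀0 : 0 ≤ B₀ := Finset.sum_nonneg fun l' _ => mul_nonneg (hC₂ l')
    (Finset.sum_nonneg fun l _ => sq_nonneg _)
  have hB₁0 : 0 ≤ B₁ := mul_nonneg (Finset.sum_nonneg fun l _ => Finset.sum_nonneg fun z _ =>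
    sq_nonneg _) (mul_nonneg (Nat.cast_nonneg _) (Finset.sum_nonneg fun l _ => hC₁ l))
  have hq0' : (0 : ℝ) < q := hq0
  set B : ℝ := B₀ + B₁ / q with hB
  have hB0 : 0 ≤ B := by positivity
  set x : ℕ → Fin s × (Fin d → ℤ) → Lp ℂ 2 (volume : Measure (Fin d → ℝ)) := fun i p =>
    toH (atom M i p.2 (ψ p.1)) with hx
  have hxin : ∀ i n (p p' : Fin s × (Fin d → ℤ)), ‖(inner ℂ (x i p) (x (i + n) p') : ℂ)‖
      = ‖innerL2 (atom M 0 p.2 (ψ p.1)) (atom M n p'.2 (ψ p'.1))‖ := by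
    intro i n p p'
    have h1 := innerL2_atom_add hdet 0 n i p.2 p'.2 (ψ p.1) (ψ p'.1)
    rw [zero_add, add_comm n i] at h1
    rw [← h1, innerL2_eq_inner (memLp_atom hdet (hψ _) _ _) (memLp_atom hdet (hψ _) _ _),
      norm_inner_symm]
  have hshift : ∀ l n (u : Fin d → ℤ) (f : (Fin d → ℝ) → ℂ) k,
      innerL2 (atom M 0 u f) (atom M n k (ψ l))
        = innerL2 f (atom M n (k - (M ^ n) *ᵥ u) (ψ l)) := by
    intro l n u f k
    have := innerL2_atom_shift (M := M) 0 n 0 (k - (M ^ n) *ᵥ u) u f (ψ l)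
    rwa [pow_zero, one_mulVec, zero_add, sub_add_cancel, atom_zero_zero] at this
  have hlev' : ∀ l n i u (Q : Finset (Fin d → ℤ)),
      ∑ k ∈ Q, ‖innerL2 (atom M 0 u (φ i)) (atom M n k (ψ l))‖ ^ 2 ≤ C₁ l * q ^ n := by
    intro l n i u Q
    have h1 := hlev l i n (Q.image fun k => k - (M ^ n) *ᵥ u)
    rw [Finset.sum_image (by intro k _ k' _ h; exact sub_left_injective h)] at h1
    simp only [hshift]
    exact h1.trans (mul_le_mul_of_nonneg_left (pow_le_pow_left₀ (hρ₁ l).le (hq l) n) (hC₁ l))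
  refine ⟨_, ?_, fun f S => bessel_of_gram x (K := (s * K : ℕ)) (B := B) (ρ := Real.sqrt q)
    (Nat.cast_nonneg _) hB0 (Real.sqrt_pos.2 hq0') ?_ (fun i n p' P => ?_) (fun i n p Q => ?_) f S⟩
  · refine div_nonneg (by positivity) (sub_nonneg.2 ?_)
    rw [Real.sqrt_le_one]; exact hq1.le
  · rw [Real.sqrt_lt' one_pos, one_pow]; exact hq1
  · set y := ((realMat M)⁻¹ ^ n) *ᵥ realVec p'.2
    have hfin : ((Set.univ : Set (Fin s)) ×ˢ
        {k : Fin d → ℤ | ‖realVec k - y‖ ≤ R + C * R}).Finite :=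
      Set.finite_univ.prod (hK y).1
    have h1 := card_filter_le_of_subset P (fun p => (inner ℂ (x i p) (x (i + n) p') : ℂ) ≠ 0) hfin
      (fun p hp => ⟨Set.mem_univ _, by
        rw [← norm_ne_zero_iff, hxin, norm_ne_zero_iff] at hp
        exact norm_le_of_innerL2_ne_zero hdet (hdecC n) hC.le (hψR _) (hψR _) hp⟩)
    rw [Set.ncard_prod, Set.ncard_univ, Nat.card_fin] at h1
    exact_mod_cast h1.trans (Nat.mul_le_mul_left s (hK y).2)
  · simp only [hxin]
    set Q₂ := Q.image Prod.snd
    have hsub : Q ⊆ Finset.univ ×ˢ Q₂ := fun z hz =>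
      Finset.mem_product.2 ⟨Finset.mem_univ _, Finset.mem_image_of_mem _ hz⟩
    refine (Finset.sum_le_sum_of_subset_of_nonneg hsub fun _ _ _ => sq_nonneg _).trans ?_
    rw [Finset.sum_product]
    dsimp only
    rw [← pow_mul, mul_comm n 2, pow_mul, Real.sq_sqrt hq0'.le]
    rcases n with _ | n
    · rw [pow_zero, mul_one]
      have h1 : ∑ l', ∑ k ∈ Q₂, ‖innerL2 (atom M 0 p.2 (ψ p.1)) (atom M 0 k (ψ l'))‖ ^ 2 ≤ B₀ := by
        refine Finset.sum_le_sum fun l' _ => ?_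
        have h2 := hbes l' 0 (toH (atom M 0 p.2 (ψ p.1))) Q₂
        simp only [← innerL2_eq_inner (memLp_atom hdet (hψ p.1) 0 p.2)
            (memLp_atom hdet (hψ l') 0 _),
          norm_toH_atom hdet (hψ p.1)] at h2
        refine h2.trans (mul_le_mul_of_nonneg_left ?_ (hC₂ l'))
        exact Finset.single_le_sum (f := fun l => ‖toH (ψ l)‖ ^ 2) (fun l _ => sq_nonneg _)
          (Finset.mem_univ p.1)
      exact h1.trans (le_add_of_nonneg_right (by positivity))
    · -- expand the coarser wavelet in shifts of `φ` at the next level and use the decay for those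
      have hexp : ∀ l' k, ‖innerL2 (atom M 0 p.2 (ψ p.1)) (atom M (n + 1) k (ψ l'))‖ ^ 2
          ≤ (∑ z ∈ Z, ‖co z p.1‖ ^ 2) * ∑ z ∈ Z,
            ‖innerL2 (atom M 0 (z.1 + M *ᵥ p.2) (φ z.2)) (atom M n k (ψ l'))‖ ^ 2 := by
        intro l' k
        have h1 := innerL2_refined_left hdet b hφ (memLp_atom hdet (hψ l') (n + 1) k) p.1 0 p.2
        rw [← hψdef] at h1
        rw [h1]
        have h2 : ∀ z ∈ Z,
            innerL2 (atom M (0 + 1) (z.1 + M *ᵥ p.2) (φ z.2)) (atom M (n + 1) k (ψ l'))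
            = innerL2 (atom M 0 (z.1 + M *ᵥ p.2) (φ z.2)) (atom M n k (ψ l')) := fun z _ =>
          innerL2_atom_add hdet 0 n 1 _ _ _ _
        rw [Finset.sum_congr rfl fun z hz => by rw [h2 z hz]]
        refine (pow_le_pow_left₀ (norm_nonneg _) (norm_sum_le _ _) 2).trans ?_
        simp only [norm_mul]
        have h3 := Finset.sum_mul_sq_le_sq_mul_sq Z (fun z => ‖co z p.1‖) fun z =>
          ‖innerL2 (atom M 0 (z.1 + M *ᵥ p.2) (φ z.2)) (atom M n k (ψ l'))‖
        simpa only [hco, norm_mul] using h3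
      have h1 : ∑ l', ∑ k ∈ Q₂, ‖innerL2 (atom M 0 p.2 (ψ p.1)) (atom M (n + 1) k (ψ l'))‖ ^ 2
          ≤ B₁ * q ^ n := by
        have hc0 : 0 ≤ ∑ z ∈ Z, ‖co z p.1‖ ^ 2 := Finset.sum_nonneg fun _ _ => sq_nonneg _
        calc _ ≤ ∑ l', (∑ z ∈ Z, ‖co z p.1‖ ^ 2) * ((Z.card : ℝ) * (C₁ l' * q ^ n)) := by
              refine Finset.sum_le_sum fun l' _ => ?_
              refine (Finset.sum_le_sum fun k _ => hexp l' k).trans ?_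
              rw [← Finset.mul_sum, Finset.sum_comm]
              refine mul_le_mul_of_nonneg_left ?_ hc0
              rw [← nsmul_eq_mul]
              exact Finset.sum_le_card_nsmul _ _ _ fun z _ => hlev' l' n z.2 _ Q₂
          _ = (∑ z ∈ Z, ‖co z p.1‖ ^ 2) * ((Z.card : ℝ) * ∑ l', C₁ l') * q ^ n := by
              rw [← Finset.mul_sum, ← Finset.mul_sum, ← Finset.sum_mul]; ring
          _ ≤ B₁ * q ^ n := by
              refine mul_le_mul_of_nonneg_right (mul_le_mul_of_nonneg_right ?_ ?_) (by positivity)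
              · exact Finset.single_le_sum (f := fun l => ∑ z ∈ Z, ‖co z l‖ ^ 2)
                  (fun l _ => Finset.sum_nonneg fun _ _ => sq_nonneg _) (Finset.mem_univ p.1)
              · exact mul_nonneg (Nat.cast_nonneg _) (Finset.sum_nonneg fun l _ => hC₁ l)
      refine h1.trans ?_
      have h2 : B₁ * q ^ n = B₁ / q * q ^ (n + 1) := by
        rw [pow_succ]; field_simp
      rw [h2]
      exact mul_le_mul_of_nonneg_right (le_add_of_nonneg_left hB₀0) (by positivity)

end Decay

/-! ### Energy identities and the quasi-tight framelet -/

section Energy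
variable {d r s : ℕ} {M : Matrix (Fin d) (Fin d) ℤ}

/-- The subdivision and the transition operator are adjoint to each other. -/
theorem tsum_subdivision (hM : M.det ≠ 0) (a : Mask d s r) (E : Matrix (Fin s) (Fin s) ℂ)
    (u : RowSeq d s) {v : RowSeq d r} (hv : (Function.support v).Finite) :
    ∑' n, (((Real.sqrt |(realMat M).det| : ℝ) : ℂ) • ∑ j ∈ a.support,
      upsample M u (n - j) ᵥ* (E * a j)) ⬝ᵥ star (v n)
      = ∑' k, (u k ᵥ* E) ⬝ᵥ star (transition M a v k) := by
  set D : ℂ := ((Real.sqrt |(realMat M).det| : ℝ) : ℂ) with hDdef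
  have hD : star D = D := conj_ofReal _
  have hl : ∀ n, (D • ∑ j ∈ a.support, upsample M u (n - j) ᵥ* (E * a j)) ⬝ᵥ star (v n)
      = D * ∑ j ∈ a.support, (upsample M u (n - j) ᵥ* (E * a j)) ⬝ᵥ star (v n) := fun n => by
    rw [smul_dotProduct, sum_dotProduct, smul_eq_mul]
  have hr : ∀ k, (u k ᵥ* E) ⬝ᵥ star (transition M a v k)
      = D * ∑ j ∈ a.support, (u k ᵥ* (E * a j)) ⬝ᵥ star (v (M *ᵥ k + j)) := fun k => by
    rw [transition_apply, star_smul, dotProduct_smul, star_sum, dotProduct_sum, hD, smul_eq_mul]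
    congr 1
    refine Finset.sum_congr rfl fun j _ => ?_
    rw [star_vecMul, conjTranspose_conjTranspose, dotProduct_mulVec, vecMul_vecMul]
  simp only [hl, hr]
  rw [tsum_mul_left, tsum_mul_left]
  congr 1
  rw [Summable.tsum_finsetSum, Summable.tsum_finsetSum]
  · refine Finset.sum_congr rfl fun j _ => ?_
    rw [← (Equiv.addRight j).tsum_eq]
    simp only [Equiv.coe_addRight, add_sub_cancel_right]
    rw [← (mulVec_injective_of_det hM).tsum_eq]
    · refine tsum_congr fun k => ?_
      rw [upsample, (mulVec_injective_of_det hM).extend_apply]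
    · intro n hn
      by_contra hc
      refine hn ?_
      dsimp only
      rw [upsample, Function.extend_apply' _ _ _ hc, Pi.zero_apply, zero_vecMul, zero_dotProduct]
  · intro j _
    refine summable_of_hasFiniteSupport ((hv.preimage (f := fun k => M *ᵥ k + j) ?_).subset ?_)
    · exact fun k _ k' _ h => mulVec_injective_of_det hM (add_right_cancel h)
    · intro k hk h0
      exact hk (by simp only [h0, star_zero, dotProduct_zero])
  · intro j _
    refine summable_of_hasFiniteSupport (hv.subset fun n hn h0 => hn ?_)
    simp only [h0, star_zero, dotProduct_zero]

/-- The signed energy identity of a quasi-tight filter bank. -/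
theorem energy_transition (hM : M.det ≠ 0) {A : Mask d r r} {B : Mask d s r} {ε : Fin s → ℂ}
    (hFB : ∀ k ξ, (symb A ξ)ᴴ * symb A (ξ + dualFreq M k)
      + (symb B ξ)ᴴ * Matrix.diagonal ε * symb B (ξ + dualFreq M k)
        = open scoped Classical in if InDual M k then 1 else 0)
    {v : RowSeq d r} (hv : (Function.support v).Finite) :
    ∑' n, v n ⬝ᵥ star (v n) = ∑' k, transition M A v k ⬝ᵥ star (transition M A v k)
      + ∑' k, (transition M B v k ᵥ* Matrix.diagonal ε) ⬝ᵥ star (transition M B v k) := by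
  have h := perfect_reconstruction hM hFB v
  have h1 : ∀ n, v n ⬝ᵥ star (v n) = subdivision M A (transition M A v) n ⬝ᵥ star (v n)
      + subdivision M (signedMask ε B) (transition M B v) n ⬝ᵥ star (v n) := fun n => by
    rw [← add_dotProduct, ← Pi.add_apply, h]
  have hsum : ∀ w : RowSeq d r, Summable fun n => w n ⬝ᵥ star (v n) := fun w =>
    summable_of_hasFiniteSupport (hv.subset fun n hn h0 => hn (by
      simp only [h0, star_zero, dotProduct_zero]))
  simp only [h1]
  rw [Summable.tsum_add (hsum _) (hsum _)]
  congr 1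
  · have := tsum_subdivision hM A 1 (transition M A v) hv
    simp only [one_mul, vecMul_one] at this
    exact this
  · rw [← tsum_subdivision hM B (Matrix.diagonal ε) (transition M B v) hv]
    refine tsum_congr fun n => ?_
    congr 1
    rw [subdivision, QuasiTight.conv, signedMask, Finsupp.sum_mapRange_index (by simp)]
    rfl

theorem innerL2_atom_refined_right (hM : M.det ≠ 0) (c : Mask d s r)
    {φ : Fin r → (Fin d → ℝ) → ℂ} (hφ : ∀ i, MemLp (φ i) 2 volume) {f : (Fin d → ℝ) → ℂ}
    (hf : MemLp f 2 volume) (n : ℕ) :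
    (fun k l => innerL2 f (atom M n k (refined M c φ l)))
      = transition M c fun k l => innerL2 f (atom M (n + 1) k (φ l)) := by
  funext k l
  rw [← innerL2_conj_symm, innerL2_refined_left hM c hφ hf, map_sum, transition_apply,
    Pi.smul_apply, smul_eq_mul, Finset.sum_apply, Finset.sum_product, Finset.mul_sum]
  refine Finset.sum_congr rfl fun p _ => ?_
  rw [vecMul, dotProduct, Finset.mul_sum]
  refine Finset.sum_congr rfl fun i _ => ?_
  rw [map_mul, map_mul, innerL2_conj_symm, conj_ofReal, conjTranspose_apply, add_comm p]
  simp only [RCLike.star_def]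
  ring

theorem dotProduct_star_self_eq (v : Fin r → ℂ) :
    v ⬝ᵥ star v = ((∑ l, ‖v l‖ ^ 2 : ℝ) : ℂ) := by
  rw [dotProduct]; push_cast
  exact Finset.sum_congr rfl fun l _ => Complex.mul_conj' _

theorem diagonal_dotProduct_star_self_eq (ε v : Fin r → ℂ) :
    (v ᵥ* Matrix.diagonal ε) ⬝ᵥ star v = ∑ l, ε l * ((‖v l‖ ^ 2 : ℝ) : ℂ) := by
  rw [dotProduct]
  refine Finset.sum_congr rfl fun l _ => ?_
  rw [vecMul_diagonal, mul_comm (v l), mul_assoc]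
  congr 1
  push_cast
  exact Complex.mul_conj' _

section Framelet
variable {a : Mask d r r} {b : Mask d s r} {ε : Fin s → ℂ} {φ : Fin r → (Fin d → ℝ) → ℂ} {R : ℝ}

theorem energy_succ (hM : M.det ≠ 0)
    (hFB : ∀ k ξ, (symb a ξ)ᴴ * symb a (ξ + dualFreq M k)
      + (symb b ξ)ᴴ * Matrix.diagonal ε * symb b (ξ + dualFreq M k)
        = open scoped Classical in if InDual M k then 1 else 0)
    (hφ : ∀ l, MemLp (φ l) 2 volume) (hφR : ∀ l, SuppIn R (φ l))
    (href : ∀ l, φ l =ᵐ[volume] refined M a φ l) {f : (Fin d → ℝ) → ℂ} (hf : MemLp f 2 volume)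
    (hfs : HasCompactSupport f) (n : ℕ) :
    ((∑' k, ∑ l, ‖innerL2 f (atom M (n + 1) k (φ l))‖ ^ 2 : ℝ) : ℂ)
      = ((∑' k, ∑ l, ‖innerL2 f (atom M n k (φ l))‖ ^ 2 : ℝ) : ℂ)
        + ∑' k, ∑ l, ε l * ((‖innerL2 f (atom M n k (refined M b φ l))‖ ^ 2 : ℝ) : ℂ) := by
  obtain ⟨R', -, hfR⟩ := exists_suppIn hfs
  set v : RowSeq d r := fun k l => innerL2 f (atom M (n + 1) k (φ l)) with hvdef
  have hv : (Function.support v).Finite := by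
    refine (Set.finite_iUnion fun l => finite_innerL2_ne_zero hM (hfR.mono (le_max_left R' R))
      ((hφR l).mono (le_max_right R' R)) (n + 1)).subset fun k hk => ?_
    by_contra hc
    refine hk (funext fun l => ?_)
    by_contra h0
    exact hc (Set.mem_iUnion.2 ⟨l, h0⟩)
  have ha : (fun k l => innerL2 f (atom M n k (φ l))) = transition M a v := by
    rw [hvdef, ← innerL2_atom_refined_right hM a hφ hf n]
    funext k l
    rw [← innerL2_conj_symm (atom M n k (φ l)), ← innerL2_conj_symm _ f,
      innerL2_congr_left (atom_ae_eq hM (href l) n k) f]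
  have hb := innerL2_atom_refined_right hM b hφ hf n
  have h := energy_transition hM hFB hv
  rw [← ha, ← hb] at h
  simp only [dotProduct_star_self_eq, diagonal_dotProduct_star_self_eq] at h
  rw [← ofReal_tsum, ← ofReal_tsum] at h
  exact h

theorem system_inl (ψ : Fin s → (Fin d → ℝ) → ℂ) (l : Fin r) (k : Fin d → ℤ) :
    system M φ ψ (.inl (l, k)) = atom M 0 k (φ l) := by
  rw [atom_zero]; rfl

theorem memLp_system (hM : M.det ≠ 0) {ψ : Fin s → (Fin d → ℝ) → ℂ}
    (hφ : ∀ l, MemLp (φ l) 2 volume) (hψ : ∀ l, MemLp (ψ l) 2 volume) (i : SystemIndex d r s) :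
    MemLp (system M φ ψ i) 2 volume := by
  rcases i with ⟨l, k⟩ | ⟨j, l, k⟩
  · rw [system_inl]; exact memLp_atom hM (hφ l) 0 k
  · exact memLp_atom hM (hψ l) j k

theorem system_bessel (hM : IsDilation M) (hφ : ∀ l, MemLp (φ l) 2 volume)
    (hφR : ∀ l, SuppIn R (φ l)) (href : ∀ l, φ l =ᵐ[volume] refined M a φ l)
    (hψR : ∀ l, SuppIn R (refined M b φ l)) (hψ0 : ∀ l, ∫ x, refined M b φ l x = 0) :
    ∃ C : ℝ, 0 ≤ C ∧ ∀ f (S : Finset (SystemIndex d r s)),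
      ∑ i ∈ S, ‖inner ℂ (toH (system M φ (refined M b φ) i)) f‖ ^ 2 ≤ C * ‖f‖ ^ 2 := by
  classical
  have hdet := hM.det_ne_zero
  choose C₁ hC₁ h₁ using fun l => level_bessel hdet (hφ l) (hφR l)
  obtain ⟨C₂, hC₂, h₂⟩ := wavelet_bessel hM hφ hφR href hψR hψ0
  refine ⟨∑ l, C₁ l + C₂, add_nonneg (Finset.sum_nonneg fun l _ => hC₁ l) hC₂, fun f S => ?_⟩
  set T := S.toLeft.image Prod.snd
  have hsub : S.toLeft ⊆ Finset.univ ×ˢ T := fun z hz =>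
    Finset.mem_product.2 ⟨Finset.mem_univ _, Finset.mem_image_of_mem _ hz⟩
  rw [← Finset.toLeft_disjSum_toRight (u := S), Finset.sum_disjSum, add_mul]
  refine add_le_add ?_ (h₂ f S.toRight)
  refine (Finset.sum_le_sum_of_subset_of_nonneg hsub fun _ _ _ => sq_nonneg _).trans ?_
  rw [Finset.sum_product, Finset.sum_mul]
  refine Finset.sum_le_sum fun l _ => ?_
  simp only [system_inl]
  exact h₁ l 0 f T

theorem dense_compactly_supported :
    Dense {F : Lp ℂ 2 (volume : Measure (Fin d → ℝ)) |
      ∃ f, Continuous f ∧ HasCompactSupport f ∧ MemLp f 2 volume ∧ toH f = F} := by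
  rw [Metric.dense_iff]
  intro F δ hδ
  have hF : MemLp (F : (Fin d → ℝ) → ℂ) 2 volume := Lp.memLp F
  obtain ⟨g, hgs, hfg, hgc, hg⟩ := hF.exists_hasCompactSupport_eLpNorm_sub_le (by norm_num)
    (ε := ENNReal.ofReal (δ / 2)) (by simpa using hδ)
  refine ⟨toH g, ?_, g, hgc, hgs, hg, rfl⟩
  have hFF : toH F = F := by rw [toH_eq hF]; exact Lp.toLp_coeFn F hF
  have h1 : eLpNorm (fun x => F x - g x) 2 volume ≤ ENNReal.ofReal (δ / 2) := hfg
  rw [eLpNorm_eq_norm_toH (f := fun x => F x - g x) (hF.sub hg), toH_sub hF hg, hFF,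
    ENNReal.ofReal_le_ofReal_iff (by positivity)] at h1
  rw [Metric.mem_ball, dist_comm, dist_eq_norm]
  linarith

/-- The signed Parseval identity on continuous functions of compact support: the energies of the
levels telescope, and the energy in level `n` tends to the energy of the function. -/
theorem hasSum_energy (hM : IsDilation M) (hε : ∀ l, ε l = 1 ∨ ε l = -1)
    (hFB : ∀ k ξ, (symb a ξ)ᴴ * symb a (ξ + dualFreq M k)
      + (symb b ξ)ᴴ * Matrix.diagonal ε * symb b (ξ + dualFreq M k)
        = open scoped Classical in if InDual M k then 1 else 0)
    (hφ : ∀ l, MemLp (φ l) 2 volume) (hφR : ∀ l, SuppIn R (φ l))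
    (href : ∀ l, φ l =ᵐ[volume] refined M a φ l)
    (hψR : ∀ l, SuppIn R (refined M b φ l)) (hψ0 : ∀ l, ∫ x, refined M b φ l x = 0)
    (hφ1 : ∑ l, ‖∫ x, φ l x‖ ^ 2 = 1) {f : (Fin d → ℝ) → ℂ} (hfc : Continuous f)
    (hfs : HasCompactSupport f) (hf : MemLp f 2 volume) :
    HasSum (fun i => systemSign ε i *
      ((‖inner ℂ (toH (system M φ (refined M b φ) i)) (toH f)‖ ^ 2 : ℝ) : ℂ))
      ((‖toH f‖ ^ 2 : ℝ) : ℂ) := by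
  have hdet := hM.det_ne_zero
  have hψ : ∀ l, MemLp (refined M b φ l) 2 volume := fun l => memLp_refined hdet hφ l
  obtain ⟨C, hC, hbes⟩ := system_bessel hM hφ hφR href hψR hψ0
  set F : SystemIndex d r s → ℂ := fun i => systemSign ε i *
    ((‖inner ℂ (toH (system M φ (refined M b φ) i)) (toH f)‖ ^ 2 : ℝ) : ℂ) with hFdef
  have hsgn : ∀ i : SystemIndex d r s, ‖systemSign ε i‖ = 1 := by
    rintro (_ | ⟨_, l, _⟩)
    · simp [systemSign]
    · rcases hε l with h | h <;> simp [systemSign, h]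
  have hFs : Summable F := by
    refine Summable.of_norm (summable_of_sum_le (c := C * ‖toH f‖ ^ 2)
      (fun _ => norm_nonneg _) fun S => ?_)
    simpa [hFdef, hsgn] using hbes (toH f) S
  -- the energy of `f` in level `n` with respect to `φ`
  set e : ℕ → ℝ := fun n => ∑' k, ∑ l, ‖innerL2 f (atom M n k (φ l))‖ ^ 2 with he
  have hlev : ∀ n l, Summable fun k => ‖innerL2 f (atom M n k (φ l))‖ ^ 2 := fun n l =>
    summable_level hdet hf (hφ l) (hφR l).hasCompactSupport n
  have helim : Tendsto e atTop (𝓝 (‖toH f‖ ^ 2)) := by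
    have h1 : ∀ n, e n = ∑ l, ∑' k, ‖innerL2 f (atom M n k (φ l))‖ ^ 2 := fun n =>
      Summable.tsum_finsetSum fun l _ => hlev n l
    have h2 : ‖toH f‖ ^ 2 = ∑ l, ‖∫ x, φ l x‖ ^ 2 * ∫ x, ‖f x‖ ^ 2 := by
      rw [← Finset.sum_mul, hφ1, one_mul, norm_toH_sq hf]
    rw [funext h1, h2]
    exact tendsto_finsetSum _ fun l _ =>
      tendsto_level_energy hM hfc hfs (hφ l) (hφR l).hasCompactSupport
  have hinl : HasSum (fun z => F (.inl z)) (e 0 : ℂ) := by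
    have hs : Summable fun z : Fin r × (Fin d → ℤ) => F (.inl z) :=
      hFs.comp_injective Sum.inl_injective
    have h1 : ∀ z : Fin r × (Fin d → ℤ), F (.inl z)
        = ((‖innerL2 f (atom M 0 z.2 (φ z.1))‖ ^ 2 : ℝ) : ℂ) := by
      rintro ⟨l, k⟩
      simp only [hFdef, systemSign, one_mul, system_inl]
      rw [innerL2_eq_inner hf (memLp_atom hdet (hφ l) 0 k)]
    have h2 : ∑' z : Fin r × (Fin d → ℤ), F (.inl z) = (e 0 : ℂ) := by
      rw [hs.tsum_prod, tsum_fintype]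
      simp only [h1, ← ofReal_tsum, ← ofReal_sum]
      rw [he]
      dsimp only
      rw [Summable.tsum_finsetSum fun l _ => hlev 0 l]
    rw [← h2]; exact hs.hasSum
  have hinr : HasSum (fun z => F (.inr z)) ((‖toH f‖ ^ 2 : ℝ) - e 0 : ℂ) := by
    have hs : Summable fun z : ℕ × Fin s × (Fin d → ℤ) => F (.inr z) :=
      hFs.comp_injective Sum.inr_injective
    have h1 : ∀ n, ∑' y : Fin s × (Fin d → ℤ), F (.inr (n, y)) = (e (n + 1) : ℂ) - e n := by
      intro n
      have hsn := hs.prod_factor n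
      have h2 : ∀ y : Fin s × (Fin d → ℤ), F (.inr (n, y))
          = ε y.1 * ((‖innerL2 f (atom M n y.2 (refined M b φ y.1))‖ ^ 2 : ℝ) : ℂ) := by
        rintro ⟨l, k⟩
        rw [innerL2_eq_inner hf (memLp_atom hdet (hψ l) n k)]; rfl
      rw [hsn.tsum_prod, tsum_fintype, he]
      dsimp only
      -- the wavelets of level `n` carry the difference of the energies of levels `n + 1` and `n`
      rw [energy_succ hdet hFB hφ hφR href hf hfs n, add_sub_cancel_left]
      simp only [h2] at hsn ⊢
      rw [Summable.tsum_finsetSum fun l _ => hsn.prod_factor l]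
    have h3 : ∑' z : ℕ × Fin s × (Fin d → ℤ), F (.inr z) = (‖toH f‖ ^ 2 : ℝ) - e 0 := by
      rw [hs.tsum_prod]
      have h4 := hs.prod.hasSum.tendsto_sum_nat
      simp only [h1, Finset.sum_range_sub (fun n => (e n : ℂ))] at h4 ⊢
      refine tendsto_nhds_unique h4 (Tendsto.sub_const ?_ _)
      exact (continuous_ofReal.tendsto _).comp helim
    rw [← h3]; exact hs.hasSum
  have h5 := HasSum.sum (f := F) hinl hinr
  rwa [add_sub_cancel] at h5

/-- A quasi-tight filter bank whose low-pass filter has a compactly supported refinable vector in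
`L²` of unit mass generates a quasi-tight framelet, provided that the wavelets have mean zero. -/
theorem isQuasiTightFramelet (hM : IsDilation M) (hε : ∀ l, ε l = 1 ∨ ε l = -1)
    (hFB : ∀ k ξ, (symb a ξ)ᴴ * symb a (ξ + dualFreq M k)
      + (symb b ξ)ᴴ * Matrix.diagonal ε * symb b (ξ + dualFreq M k)
        = open scoped Classical in if InDual M k then 1 else 0)
    (hφ : ∀ l, MemLp (φ l) 2 volume) (hφR : ∀ l, SuppIn R (φ l))
    (href : ∀ l, φ l =ᵐ[volume] refined M a φ l)
    (hψR : ∀ l, SuppIn R (refined M b φ l)) (hψ0 : ∀ l, ∫ x, refined M b φ l x = 0)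
    (hφ1 : ∑ l, ‖∫ x, φ l x‖ ^ 2 = 1) :
    IsQuasiTightFramelet M φ (refined M b φ) ε := by
  have hdet := hM.det_ne_zero
  have hψ : ∀ l, MemLp (refined M b φ l) 2 volume := fun l => memLp_refined hdet hφ l
  obtain ⟨C, hC, hbes⟩ := system_bessel hM hφ hφR href hψR hψ0
  have hsgn : ∀ i : SystemIndex d r s, systemSign ε i = 1 ∨ systemSign ε i = -1 := by
    rintro (_ | ⟨_, l, _⟩)
    · exact Or.inl rfl
    · exact hε l
  have hrec := hasSum_of_dense (fun i => toH (system M φ (refined M b φ) i)) hsgn hC hbes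
    dense_compactly_supported (by
      rintro F ⟨f, hfc, hfs, hf, rfl⟩
      exact hasSum_energy hM hε hFB hφ hφR href hψR hψ0 hφ1 hfc hfs hf)
  have hinner : ∀ {f : (Fin d → ℝ) → ℂ}, MemLp f 2 volume → ∀ i,
      innerL2 f (system M φ (refined M b φ) i)
        = inner ℂ (toH (system M φ (refined M b φ) i)) (toH f) := fun hf i =>
    innerL2_eq_inner hf (memLp_system hdet hφ hψ i)
  refine ⟨⟨hφ, hψ, 1, (C + 1).toNNReal, one_pos, ?_, fun f hf => ?_⟩, fun f hf => ?_⟩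
  · exact Real.toNNReal_pos.2 (by positivity)
  · have hsum : Summable fun i => ‖innerL2 f (system M φ (refined M b φ) i)‖ ^ 2 := by
      refine summable_of_sum_le (c := C * ‖toH f‖ ^ 2) (fun _ => sq_nonneg _) fun S => ?_
      simp only [hinner hf]
      exact hbes (toH f) S
    have he : ∑' i, ‖innerL2 f (system M φ (refined M b φ) i)‖ₑ ^ 2
        = ENNReal.ofReal (∑' i, ‖innerL2 f (system M φ (refined M b φ) i)‖ ^ 2) := by
      rw [ENNReal.ofReal_tsum_of_nonneg (fun _ => sq_nonneg _) hsum]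
      refine tsum_congr fun i => ?_
      rw [ENNReal.ofReal_pow (norm_nonneg _), ofReal_norm]
    rw [he, eLpNorm_eq_norm_toH hf, ← ENNReal.ofReal_pow (norm_nonneg _)]
    constructor
    · rw [ENNReal.coe_one, one_mul]
      refine ENNReal.ofReal_le_ofReal ?_
      have h1 := (hrec (toH f)).mapL (innerSL ℂ (toH f))
      simp only [innerSL_apply_apply, inner_smul_right] at h1
      have h2 : ((‖toH f‖ ^ 2 : ℝ) : ℂ) = inner ℂ (toH f) (toH f) := by
        rw [inner_self_eq_norm_sq_to_K]; push_cast; rfl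
      have h3 : ‖toH f‖ ^ 2 = ‖(inner ℂ (toH f) (toH f) : ℂ)‖ := by
        rw [← h2, Complex.norm_real, Real.norm_of_nonneg (sq_nonneg _)]
      rw [h3, ← h1.tsum_eq]
      refine tsum_of_norm_bounded hsum.hasSum fun i => ?_
      rw [norm_mul, norm_mul, norm_inner_symm (toH f), hinner hf]
      rcases hsgn i with h | h <;> simp [h, sq]
    · change _ ≤ ENNReal.ofReal (C + 1) * _
      rw [← ENNReal.ofReal_mul (by positivity)]
      refine ENNReal.ofReal_le_ofReal (Real.tsum_le_of_sum_le (fun _ => sq_nonneg _) fun S => ?_)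
      simp only [hinner hf]
      exact (hbes (toH f) S).trans (mul_le_mul_of_nonneg_right (by linarith) (sq_nonneg _))
  · have h1 : ∀ S : Finset (SystemIndex d r s), eLpNorm (fun x => f x -
        ∑ i ∈ S, systemSign ε i * innerL2 f (system M φ (refined M b φ) i)
          * system M φ (refined M b φ) i x) 2 volume
        = ENNReal.ofReal ‖toH f - ∑ i ∈ S, (systemSign ε i *
          inner ℂ (toH (system M φ (refined M b φ) i)) (toH f))
            • toH (system M φ (refined M b φ) i)‖ := by
      intro S
      have hS : MemLp (fun x => ∑ i ∈ S, systemSign ε i *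
          innerL2 f (system M φ (refined M b φ) i) * system M φ (refined M b φ) i x) 2 volume :=
        memLp_finsetSum _ fun i _ => (memLp_system hdet hφ hψ i).const_mul _
      rw [eLpNorm_eq_norm_toH (f := fun x => f x - ∑ i ∈ S, systemSign ε i *
          innerL2 f (system M φ (refined M b φ) i) * system M φ (refined M b φ) i x) (hf.sub hS),
        ← toH_finset_sum _ _ _ fun i _ => memLp_system hdet hφ hψ i]
      simp only [← hinner hf]
      rw [← toH_sub hf hS]
    simp only [h1]
    rw [← ENNReal.ofReal_zero]
    refine ENNReal.tendsto_ofReal ?_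
    have h3 : Tendsto (fun S : Finset (SystemIndex d r s) => toH f - ∑ i ∈ S, (systemSign ε i *
          inner ℂ (toH (system M φ (refined M b φ) i)) (toH f))
            • toH (system M φ (refined M b φ) i)) atTop (𝓝 (toH f - toH f)) :=
      Tendsto.sub tendsto_const_nhds (hrec (toH f))
    simpa using h3.norm

end Framelet

end Energy

/-! ### Fourier transforms -/

section Fourier
variable {d r s : ℕ} {M : Matrix (Fin d) (Fin d) ℤ}

/-- The Fourier transform `∫ f(x) e^{-i x·ξ} dx` of a scalar function. -/
noncomputable def ft (f : (Fin d → ℝ) → ℂ) (ξ : Fin d → ℝ) : ℂ :=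
  ∫ x : Fin d → ℝ, f x * cexp (-(I * ((x ⬝ᵥ ξ : ℝ) : ℂ)))

theorem integrable_mul_exp {f : (Fin d → ℝ) → ℂ} (hf : Integrable f) (ξ : Fin d → ℝ) :
    Integrable fun x : Fin d → ℝ => f x * cexp (-(I * ((x ⬝ᵥ ξ : ℝ) : ℂ))) := by
  have h := integrable_bounded_mul (h := fun x : Fin d → ℝ => cexp (-(I * ((x ⬝ᵥ ξ : ℝ) : ℂ))))
    (R := 1) (Continuous.aestronglyMeasurable (by unfold dotProduct; fun_prop)) hf
    (fun x _ => by rw [Complex.norm_exp]; simp)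
  simpa only [mul_comm] using h

theorem ft_finset_sum {ι : Type*} (S : Finset ι) (c : ι → ℂ) {f : ι → (Fin d → ℝ) → ℂ}
    (hf : ∀ i, Integrable (f i)) (ξ : Fin d → ℝ) :
    ft (fun x => ∑ i ∈ S, c i * f i x) ξ = ∑ i ∈ S, c i * ft (f i) ξ := by
  simp only [ft, Finset.sum_mul, mul_assoc]
  rw [integral_finsetSum _ fun i _ => (integrable_mul_exp (hf i) ξ).const_mul (c i)]
  simp only [integral_const_mul]

theorem ft_sub_eq {f g : (Fin d → ℝ) → ℂ} (hf : Integrable f) (hg : Integrable g) (ξ : Fin d → ℝ) :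
    ft (fun x => f x - g x) ξ = ft f ξ - ft g ξ := by
  simp only [ft, sub_mul]
  exact integral_sub (integrable_mul_exp hf ξ) (integrable_mul_exp hg ξ)

theorem ft_conj (f : (Fin d → ℝ) → ℂ) (ξ : Fin d → ℝ) :
    ft (fun x => conj (f x)) ξ = conj (ft f (-ξ)) := by
  rw [ft, ft, ← integral_conj]
  refine integral_congr_ae (ae_of_all _ fun x => ?_)
  dsimp only
  rw [map_mul, conj_cexp_neg, dotProduct_neg, neg_neg]

theorem ft_zero (f : (Fin d → ℝ) → ℂ) : ft f 0 = ∫ x, f x := by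
  simp [ft]

theorem ft_comp_sub (f : (Fin d → ℝ) → ℂ) (k : Fin d → ℤ) (ξ : Fin d → ℝ) :
    ft (fun x => f (x - realVec k)) ξ = chr k ξ * ft f ξ := by
  rw [ft, ← integral_add_right_eq_self _ (realVec k), ft, ← integral_const_mul]
  refine integral_congr_ae (ae_of_all _ fun x => ?_)
  simp only [add_sub_cancel_right, add_dotProduct, ofReal_add, mul_add, neg_add, Complex.exp_add,
    chr]
  ring

theorem ft_atom_one (hM : M.det ≠ 0) (f : (Fin d → ℝ) → ℂ) (k : Fin d → ℤ) (ξ : Fin d → ℝ) :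
    ((Real.sqrt |(realMat M).det| : ℝ) : ℂ) * ft (atom M 1 k f) ξ
      = chr k (((realMat M)ᵀ)⁻¹ *ᵥ ξ) * ft f (((realMat M)ᵀ)⁻¹ *ᵥ ξ) := by
  have hD : |(realMat M).det| ≠ 0 := abs_ne_zero.2 (realMat_isUnit_det hM).ne_zero
  set ζ := ((realMat M)ᵀ)⁻¹ *ᵥ ξ with hζ
  rw [← ft_comp_sub]
  set G : (Fin d → ℝ) → ℂ := fun z => f (z - realVec k) * cexp (-(I * ((z ⬝ᵥ ζ : ℝ) : ℂ))) with hG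
  have h1 : ∀ x, atom M 1 k f x * cexp (-(I * ((x ⬝ᵥ ξ : ℝ) : ℂ)))
      = ((Real.sqrt |(realMat M).det| : ℝ) : ℂ) * G (realMat M *ᵥ x) := by
    intro x
    have h2 : (realMat M *ᵥ x) ⬝ᵥ ζ = x ⬝ᵥ ξ := by
      rw [← vecMul_transpose, ← dotProduct_mulVec, hζ, mulVec_mulVec, Matrix.mul_nonsing_inv,
        one_mulVec]
      rw [det_transpose]; exact realMat_isUnit_det hM
    simp only [hG, h2, atom, pow_one]
    ring
  have h3 : ft (atom M 1 k f) ξ = ((Real.sqrt |(realMat M).det| : ℝ) : ℂ) *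
      (|(realMat M).det|⁻¹ • ∫ z, G z) := by
    rw [ft]
    simp only [h1]
    rw [integral_const_mul, integral_comp_mulVec (realMat_isUnit_det hM).ne_zero G]
  rw [h3, ← mul_assoc, ← ofReal_mul, Real.mul_self_sqrt (abs_nonneg _), Complex.real_smul,
    ← mul_assoc, ← ofReal_mul, mul_inv_cancel₀ hD, ofReal_one, one_mul]
  rfl

theorem symb_mulVec_apply (c : Mask d s r) (ξ : Fin d → ℝ) (v : Fin r → ℂ) (l : Fin s) :
    (symb c ξ *ᵥ v) l = ∑ z ∈ c.support ×ˢ Finset.univ, c z.1 l z.2 * (chr z.1 ξ * v z.2) := by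
  rw [mulVec, dotProduct, Finset.sum_product_right]
  refine Finset.sum_congr rfl fun i _ => ?_
  rw [symb_apply, Finsupp.sum, Finset.sum_mul]
  exact Finset.sum_congr rfl fun k _ => by ring

theorem fourierVec_refined (hM : M.det ≠ 0) (c : Mask d s r) {f : Fin r → (Fin d → ℝ) → ℂ}
    (hf : ∀ i, Integrable (f i)) (ξ : Fin d → ℝ) :
    fourierVec (refined M c f) ξ
      = symb c (((realMat M)ᵀ)⁻¹ *ᵥ ξ) *ᵥ fourierVec f (((realMat M)ᵀ)⁻¹ *ᵥ ξ) := by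
  funext l
  rw [symb_mulVec_apply]
  change ft (refined M c f l) ξ = _
  have hi : ∀ z : (Fin d → ℤ) × Fin r, Integrable (atom M 1 z.1 (f z.2)) := fun z =>
    memLp_one_iff_integrable.1 (memLp_atom hM (memLp_one_iff_integrable.2 (hf z.2)) 1 z.1)
  refine (ft_finset_sum _ _ hi ξ).trans (Finset.sum_congr rfl fun z _ => ?_)
  rw [mul_comm (((Real.sqrt |(realMat M).det| : ℝ) : ℂ)), mul_assoc, ft_atom_one hM]
  rfl

/-- The functions `∑ₖ c(k) f(· - k)`. -/
noncomputable def maskSum (c : Mask d s r) (f : Fin r → (Fin d → ℝ) → ℂ) (l : Fin s)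
    (x : Fin d → ℝ) : ℂ :=
  ∑ z ∈ c.support ×ˢ Finset.univ, c z.1 l z.2 * f z.2 (x - realVec z.1)

theorem fourierVec_maskSum (c : Mask d s r) {f : Fin r → (Fin d → ℝ) → ℂ}
    (hf : ∀ i, Integrable (f i)) (ξ : Fin d → ℝ) :
    fourierVec (maskSum c f) ξ = symb c ξ *ᵥ fourierVec f ξ := by
  funext l
  rw [symb_mulVec_apply]
  change ft (maskSum c f l) ξ = _
  refine (ft_finset_sum (f := fun z : (Fin d → ℤ) × Fin r => fun x => f z.2 (x - realVec z.1)) _ _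
    (fun z => (hf z.2).comp_sub_right _) ξ).trans (Finset.sum_congr rfl fun z _ => ?_)
  rw [ft_comp_sub]; rfl

theorem memLp_maskSum {p : ℝ≥0∞} (c : Mask d s r) {f : Fin r → (Fin d → ℝ) → ℂ}
    (hf : ∀ i, MemLp (f i) p volume) (l : Fin s) : MemLp (maskSum c f l) p volume :=
  memLp_finsetSum _ fun z _ => (memLp_comp_sub (hf z.2) _).const_mul _

theorem exists_suppIn_maskSum (c : Mask d s r) {f : Fin r → (Fin d → ℝ) → ℂ} {R : ℝ}
    (hf : ∀ i, SuppIn R (f i)) : ∃ R', ∀ l, SuppIn R' (maskSum c f l) := by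
  refine ⟨∑ k ∈ c.support, ‖realVec k‖ + R, fun l x hx => ?_⟩
  obtain ⟨z, hz, hzx⟩ := Finset.exists_ne_zero_of_sum_ne_zero hx
  have h1 := hf z.2 _ (right_ne_zero_of_mul hzx)
  have h2 : ‖realVec z.1‖ ≤ ∑ k ∈ c.support, ‖realVec k‖ :=
    Finset.single_le_sum (f := fun k => ‖realVec k‖) (fun _ _ => norm_nonneg _)
      (Finset.mem_product.1 hz).1
  calc ‖x‖ = ‖realVec z.1 + (x - realVec z.1)‖ := by rw [add_sub_cancel]
    _ ≤ _ := (norm_add_le _ _).trans (add_le_add h2 h1)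

theorem exists_suppIn_refined (hM : M.det ≠ 0) (c : Mask d s r) {f : Fin r → (Fin d → ℝ) → ℂ}
    {R : ℝ} (hf : ∀ i, SuppIn R (f i)) : ∃ R', ∀ l, SuppIn R' (refined M c f l) := by
  obtain ⟨C, hC, h⟩ := exists_norm_mulVec_le (realMat M)⁻¹
  refine ⟨C * (∑ k ∈ c.support, ‖realVec k‖ + R), fun l x hx => ?_⟩
  obtain ⟨z, hz, hzx⟩ := Finset.exists_ne_zero_of_sum_ne_zero hx
  have h0 := right_ne_zero_of_mul hzx
  rw [atom, pow_one, pow_one] at h0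
  have h1 := hf z.2 _ (right_ne_zero_of_mul h0)
  have h2 : ‖realVec z.1‖ ≤ ∑ k ∈ c.support, ‖realVec k‖ :=
    Finset.single_le_sum (f := fun k => ‖realVec k‖) (fun _ _ => norm_nonneg _)
      (Finset.mem_product.1 hz).1
  have h3 : ‖realMat M *ᵥ x‖ ≤ ∑ k ∈ c.support, ‖realVec k‖ + R :=
    calc ‖realMat M *ᵥ x‖ = ‖realVec z.1 + (realMat M *ᵥ x - realVec z.1)‖ := by
          rw [add_sub_cancel]
      _ ≤ _ := (norm_add_le _ _).trans (add_le_add h2 h1)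
  rw [← realMat_inv_mulVec hM x]
  exact (h _).trans (mul_le_mul_of_nonneg_left h3 hC)

/-- A real integrable function is determined by its Fourier transform. -/
theorem ae_eq_zero_of_ft_real {u : (Fin d → ℝ) → ℝ} (hu : Integrable u)
    (h : ∀ ξ, ft (fun x => (u x : ℂ)) ξ = 0) : u =ᵐ[volume] 0 := by
  -- compare the characteristic functions of the measures with densities `u⁺` and `u⁻`
  set f : (Fin d → ℝ) → ℝ≥0∞ := fun x => ENNReal.ofReal (u x)
  set g : (Fin d → ℝ) → ℝ≥0∞ := fun x => ENNReal.ofReal (-u x)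
  have hfm : AEMeasurable f volume := hu.1.aemeasurable.ennreal_ofReal
  have hgm : AEMeasurable g volume := hu.1.aemeasurable.neg.ennreal_ofReal
  have : IsFiniteMeasure (volume.withDensity f) := isFiniteMeasure_withDensity_ofReal hu.2
  have : IsFiniteMeasure (volume.withDensity g) := isFiniteMeasure_withDensity_ofReal hu.neg.2
  have hft : ∀ x, f x < ∞ := fun x => ENNReal.ofReal_lt_top
  have hgt : ∀ x, g x < ∞ := fun x => ENNReal.ofReal_lt_top
  have hμν : volume.withDensity f = volume.withDensity g := by
    refine Measure.ext_of_charFunDual (funext fun L => ?_)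
    rw [charFunDual_apply, charFunDual_apply,
      integral_withDensity_eq_integral_toReal_smul₀ hfm (ae_of_all _ hft),
      integral_withDensity_eq_integral_toReal_smul₀ hgm (ae_of_all _ hgt), ← sub_eq_zero]
    set ξ : Fin d → ℝ := fun i => -L (Pi.single i 1) with hξ
    have hL : ∀ x, L x = -(x ⬝ᵥ ξ) := by
      intro x
      have h1 : x = ∑ i, x i • Pi.single i (1 : ℝ) := by
        conv_lhs => rw [← Finset.univ_sum_single x]
        exact Finset.sum_congr rfl fun i _ => by rw [← Pi.single_smul, smul_eq_mul, mul_one]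
      conv_lhs => rw [h1]
      rw [map_sum, dotProduct, ← Finset.sum_neg_distrib]
      exact Finset.sum_congr rfl fun i _ => by rw [map_smul, hξ, smul_eq_mul, mul_neg, neg_neg]
    have hpos : Integrable fun x => (((f x).toReal : ℝ) : ℂ) := by
      refine Integrable.ofReal ?_
      exact hu.pos_part.congr (ae_of_all _ fun x => ENNReal.toReal_ofReal'.symm)
    have hneg : Integrable fun x => (((g x).toReal : ℝ) : ℂ) := by
      refine Integrable.ofReal ?_
      exact hu.neg_part.congr (ae_of_all _ fun x => ENNReal.toReal_ofReal'.symm)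
    have hexp : ∀ x, cexp (L x * I) = cexp (-(I * ((x ⬝ᵥ ξ : ℝ) : ℂ))) := fun x => by
      rw [hL]; congr 1; push_cast; ring
    simp only [hexp, Complex.real_smul]
    rw [← integral_sub (integrable_mul_exp hpos ξ) (integrable_mul_exp hneg ξ), ← h ξ, ft]
    refine integral_congr_ae (ae_of_all _ fun x => ?_)
    dsimp only
    rw [← sub_mul, ← ofReal_sub]
    congr 2
    simp only [f, g, ENNReal.toReal_ofReal']
    exact max_zero_sub_eq_self (u x)
  have hfg := (withDensity_eq_iff_of_sigmaFinite hfm hgm).1 hμν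
  filter_upwards [hfg] with x hx
  have h1 : max (u x) 0 = max (-u x) 0 := by
    have := congrArg ENNReal.toReal hx
    simpa only [f, g, ENNReal.toReal_ofReal'] using this
  have h2 := max_zero_sub_eq_self (u x)
  rw [h1, sub_self] at h2
  exact h2.symm

/-- An integrable function is determined by its Fourier transform. -/
theorem ae_eq_of_ft {f g : (Fin d → ℝ) → ℂ} (hf : Integrable f) (hg : Integrable g)
    (h : ∀ ξ, ft f ξ = ft g ξ) : f =ᵐ[volume] g := by
  set w : (Fin d → ℝ) → ℂ := fun x => f x - g x
  have hw : Integrable w := hf.sub hg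
  have hw0 : ∀ ξ, ft w ξ = 0 := fun ξ => by rw [ft_sub_eq hf hg, h, sub_self]
  have hwc : Integrable fun x => conj (w x) :=
    (LinearIsometryEquiv.integrable_comp_iff Complex.conjLIE).2 hw
  have hwc0 : ∀ ξ, ft (fun x => conj (w x)) ξ = 0 := fun ξ => by rw [ft_conj, hw0, map_zero]
  have hsum : ∀ (c : Fin 2 → ℂ) ξ, ft (fun x => c 0 * w x + c 1 * conj (w x)) ξ = 0 := by
    intro c ξ
    have := ft_finset_sum Finset.univ c (f := ![w, fun x => conj (w x)])
      (Fin.forall_fin_two.2 ⟨hw, hwc⟩) ξ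
    simpa [Fin.sum_univ_two, hw0, hwc0] using this
  have hre := ae_eq_zero_of_ft_real hw.re fun ξ => by
    refine Eq.trans ?_ (hsum ![1 / 2, 1 / 2] ξ)
    congr 1; funext x
    change ((w x).re : ℂ) = 1 / 2 * w x + 1 / 2 * conj (w x)
    rw [Complex.re_eq_add_conj]; ring
  have him := ae_eq_zero_of_ft_real hw.im fun ξ => by
    refine Eq.trans ?_ (hsum ![1 / (2 * I), -(1 / (2 * I))] ξ)
    congr 1; funext x
    change ((w x).im : ℂ) = 1 / (2 * I) * w x + -(1 / (2 * I)) * conj (w x)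
    rw [Complex.im_eq_sub_conj]; ring
  filter_upwards [hre, him] with x h1 h2
  exact sub_eq_zero.1 (Complex.ext h1 h2)

/-- A vector of integrable functions that satisfies a refinement equation in the frequency domain
satisfies it almost everywhere. -/
theorem ae_eq_refined (hM : M.det ≠ 0) {a : Mask d r r} {φ : Fin r → (Fin d → ℝ) → ℂ}
    (hφ : ∀ l, Integrable (φ l))
    (href : ∀ ξ, fourierVec φ ((realMat M)ᵀ *ᵥ ξ) = symb a ξ *ᵥ fourierVec φ ξ) (l : Fin r) :
    φ l =ᵐ[volume] refined M a φ l := by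
  refine ae_eq_of_ft (hφ l) (memLp_one_iff_integrable.1
    (memLp_refined hM (fun i => memLp_one_iff_integrable.2 (hφ i)) l)) fun ξ => ?_
  have h1 := congrFun (fourierVec_refined hM a hφ ξ) l
  have h2 : (realMat M)ᵀ *ᵥ (((realMat M)ᵀ)⁻¹ *ᵥ ξ) = ξ := by
    rw [mulVec_mulVec, Matrix.mul_nonsing_inv, one_mulVec]
    rw [det_transpose]; exact realMat_isUnit_det hM
  rw [← href, h2] at h1
  exact h1.symm

theorem approx_fourierVec {φ : Fin r → (Fin d → ℝ) → ℂ} (hφ : IsCompactL2 φ) (n : ℕ) (l : Fin r) :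
    Approx n fun ξ => fourierVec φ ξ l := by
  obtain ⟨R, -, hR⟩ := exists_suppIn (hφ l).2
  exact approx_fourier measurable_id (integrable_of_memLp_two (hφ l).1 (hφ l).2) (R := R) hR n

/-- Vanishing moments are zeros of the Fourier transform at the origin. -/
theorem hasVanishingMoments_iff {ψ : Fin s → (Fin d → ℝ) → ℂ} (hψ : IsCompactL2 ψ) (n : ℕ) :
    HasVanishingMoments ψ n ↔ VanV n (fourierVec ψ) := by
  refine forall_congr' fun l => ?_
  obtain ⟨R, -, hR⟩ := exists_suppIn (hψ l).2
  have hi := integrable_of_memLp_two (hψ l).1 (hψ l).2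
  have hic : Integrable fun x => conj (ψ l x) :=
    (LinearIsometryEquiv.integrable_comp_iff Complex.conjLIE).2 hi
  have h := van_fourier_iff measurable_id hic (R := R)
    (fun x hx => hR x (by simpa using hx)) n
  refine Iff.trans h.symm ?_
  have hneg : ∀ ξ : Fin d → ℝ, (-1 : Matrix (Fin d) (Fin d) ℝ) *ᵥ ξ = -ξ := fun ξ => by
    rw [neg_mulVec, one_mulVec]
  have hc : ∀ ξ, ft (fun x => conj (ψ l x)) ξ = conj (fourierVec ψ (-ξ) l) := fun ξ => ft_conj _ ξ
  constructor
  · intro hv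
    refine ((hv.comp_mulVec (-1)).conj).congr fun ξ => ?_
    refine (congrArg conj (hc _)).trans ?_
    rw [conj_conj, hneg, neg_neg]
  · intro hv
    refine ((hv.comp_mulVec (-1)).conj).congr fun ξ => ?_
    rw [hneg]
    exact (hc ξ).symm

/-- A function that is invariant under `Mᵀ` up to `O(‖ξ‖^m)` is constant up to `O(‖ξ‖^m)`. -/
theorem van_sub_of_scaling (hM : IsDilation M) {m : ℕ} (hm : m ≠ 0) {h : (Fin d → ℝ) → ℂ}
    (hc : ContinuousAt h 0) (hv : Van m fun ξ => h ((realMat M)ᵀ *ᵥ ξ) - h ξ) :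
    Van m fun ξ => h ξ - h 0 := by
  have hdet := hM.det_ne_zero
  obtain ⟨C, ρ, hC, hρ, hρ1, -, hdec⟩ := hM.exists_norm_decay
  obtain ⟨K, hK0, hK⟩ := IsBigO.exists_nonneg hv
  obtain ⟨δ, hδ, hball⟩ := Metric.eventually_nhds_iff_ball.1 hK.bound
  set A := ((realMat M)ᵀ)⁻¹
  set q : ℝ := ρ ^ m
  have hq0 : 0 ≤ q := by positivity
  have hq1 : q < 1 := pow_lt_one₀ hρ.le hρ1 hm
  refine IsBigO.of_bound (K * C ^ m / (1 - q)) ?_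
  filter_upwards [Metric.ball_mem_nhds (0 : Fin d → ℝ) (show 0 < δ / C by positivity)] with ξ hξ
  rw [mem_ball_zero_iff, lt_div_iff₀ hC] at hξ
  rw [Real.norm_of_nonneg (by positivity)]
  have hAn : ∀ n, ‖(A ^ n) *ᵥ ξ‖ ≤ C * ρ ^ n * ‖ξ‖ := fun n => hdec n ξ
  have hsmall : ∀ n, ‖(A ^ n) *ᵥ ξ‖ < δ := fun n => by
    refine (hAn n).trans_lt (lt_of_le_of_lt ?_ hξ)
    have : ρ ^ n ≤ 1 := pow_le_one₀ hρ.le hρ1.le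
    nlinarith [norm_nonneg ξ, mul_nonneg hC.le (norm_nonneg ξ)]
  have hstep : ∀ n, ‖h ((A ^ n) *ᵥ ξ) - h ((A ^ (n + 1)) *ᵥ ξ)‖ ≤ K * C ^ m * ‖ξ‖ ^ m * q ^ n := by
    intro n
    have h1 := hball ((A ^ (n + 1)) *ᵥ ξ) (by rw [mem_ball_zero_iff]; exact hsmall _)
    have h2 : (realMat M)ᵀ *ᵥ ((A ^ (n + 1)) *ᵥ ξ) = (A ^ n) *ᵥ ξ := by
      rw [pow_succ', mulVec_mulVec, ← mul_assoc, Matrix.mul_nonsing_inv, one_mul]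
      rw [det_transpose]; exact realMat_isUnit_det hdet
    rw [h2, Real.norm_of_nonneg (by positivity)] at h1
    refine h1.trans ?_
    have h3 : ‖(A ^ (n + 1)) *ᵥ ξ‖ ≤ C * ρ ^ n * ‖ξ‖ := (hAn _).trans (by
      refine mul_le_mul_of_nonneg_right (mul_le_mul_of_nonneg_left ?_ hC.le) (norm_nonneg _)
      exact pow_le_pow_of_le_one hρ.le hρ1.le (Nat.le_succ n))
    calc K * ‖(A ^ (n + 1)) *ᵥ ξ‖ ^ m ≤ K * (C * ρ ^ n * ‖ξ‖) ^ m :=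
          mul_le_mul_of_nonneg_left (pow_le_pow_left₀ (norm_nonneg _) h3 m) hK0
      _ = _ := by rw [mul_pow, mul_pow, ← pow_mul, mul_comm n m, pow_mul]; ring
  have htel : ∀ n, ‖h ξ - h ((A ^ n) *ᵥ ξ)‖ ≤ K * C ^ m / (1 - q) * ‖ξ‖ ^ m := by
    intro n
    have h1 : h ξ - h ((A ^ n) *ᵥ ξ)
        = ∑ k ∈ Finset.range n, (h ((A ^ k) *ᵥ ξ) - h ((A ^ (k + 1)) *ᵥ ξ)) := by
      rw [Finset.sum_range_sub' (fun k => h ((A ^ k) *ᵥ ξ)), pow_zero, one_mulVec]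
    rw [h1]
    refine (norm_sum_le _ _).trans ((Finset.sum_le_sum fun k _ => hstep k).trans ?_)
    rw [← Finset.mul_sum]
    have h2 : ∑ k ∈ Finset.range n, q ^ k ≤ 1 / (1 - q) := by
      rw [one_div, ← tsum_geometric_of_lt_one hq0 hq1]
      exact (summable_geometric_of_lt_one hq0 hq1).sum_le_tsum _ fun k _ => pow_nonneg hq0 k
    calc _ ≤ K * C ^ m * ‖ξ‖ ^ m * (1 / (1 - q)) := mul_le_mul_of_nonneg_left h2 (by positivity)
      _ = _ := by ring
  have hlim : Tendsto (fun n => (A ^ n) *ᵥ ξ) atTop (𝓝 0) := by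
    refine squeeze_zero_norm hAn ?_
    simpa using ((tendsto_pow_atTop_nhds_zero_of_lt_one hρ.le hρ1).const_mul C).mul_const ‖ξ‖
  exact le_of_tendsto ((tendsto_const_nhds.sub (hc.tendsto.comp hlim)).norm)
    (Eventually.of_forall htel)

end Fourier

/-! ### The cosets in `Omega M` and the dual lattice -/

section DualLattice
variable {d r s : ℕ} {M : Matrix (Fin d) (Fin d) ℤ}

theorem eq_zero_iff_inDual (hM : M.det ≠ 0) {k : Fin d → ℤ}
    (hω : ∀ i, 0 ≤ (((realMat M)ᵀ)⁻¹ *ᵥ realVec k) i ∧ (((realMat M)ᵀ)⁻¹ *ᵥ realVec k) i < 1) :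
    ((realMat M)ᵀ)⁻¹ *ᵥ realVec k = 0 ↔ InDual M k := by
  have hM' : Mᵀ.det ≠ 0 := by rwa [det_transpose]
  constructor
  · intro h
    have h1 : realVec k = 0 := by
      rw [← realMat_mulVec_inv hM' (realVec k), ← realMat_transpose, h, mulVec_zero]
    refine ⟨0, ?_⟩
    rw [mulVec_zero]
    exact funext fun i => by simpa [realVec] using congrFun h1 i
  · rintro ⟨l, rfl⟩
    have h1 : ((realMat M)ᵀ)⁻¹ *ᵥ realVec (Mᵀ *ᵥ l) = realVec l := by
      rw [realMat_transpose, ← realMat_mulVec, realMat_inv_mulVec hM']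
    rw [h1] at hω ⊢
    funext i
    have h2 : 0 ≤ l i := by exact_mod_cast (show (0 : ℝ) ≤ (l i : ℝ) from (hω i).1)
    have h3 : l i < 1 := by exact_mod_cast (show (l i : ℝ) < 1 from (hω i).2)
    have h4 : l i = 0 := by omega
    simp [realVec, h4]

theorem Omega.exists_dualFreq (hM : M.det ≠ 0) {ω : Fin d → ℝ} (hω : ω ∈ Omega M) :
    ∃ k, (2 * Real.pi) • ω = dualFreq M k ∧ (ω = 0 ↔ InDual M k) := by
  obtain ⟨⟨k, rfl⟩, h⟩ := hω
  exact ⟨k, rfl, eq_zero_iff_inDual hM h⟩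

/-- Modulo `2π ℤ^d`, every dual frequency comes from `Omega M`. -/
theorem exists_mem_Omega (hM : M.det ≠ 0) (k : Fin d → ℤ) :
    ∃ ω ∈ Omega M, ∃ l, InDual M l ∧ (2 * Real.pi) • ω = dualFreq M (k + l) ∧
      (ω = 0 ↔ InDual M k) := by
  have hM' : Mᵀ.det ≠ 0 := by rwa [det_transpose]
  set x := ((realMat M)ᵀ)⁻¹ *ᵥ realVec k with hx
  set n : Fin d → ℤ := fun i => -⌊x i⌋
  have hn : ((realMat M)ᵀ)⁻¹ *ᵥ realVec (k + Mᵀ *ᵥ n) = x + realVec n := by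
    rw [realVec_add, mulVec_add, realMat_transpose, ← realMat_mulVec, realMat_inv_mulVec hM',
      ← realMat_transpose]
  have hmem : ∀ i, 0 ≤ (((realMat M)ᵀ)⁻¹ *ᵥ realVec (k + Mᵀ *ᵥ n)) i ∧
      (((realMat M)ᵀ)⁻¹ *ᵥ realVec (k + Mᵀ *ᵥ n)) i < 1 := by
    intro i
    have h1 : (((realMat M)ᵀ)⁻¹ *ᵥ realVec (k + Mᵀ *ᵥ n)) i = Int.fract (x i) := by
      rw [hn]
      simp [realVec, n, Int.fract, sub_eq_add_neg]
    rw [h1]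
    exact ⟨Int.fract_nonneg _, Int.fract_lt_one _⟩
  refine ⟨_, ⟨⟨_, rfl⟩, hmem⟩, Mᵀ *ᵥ n, ⟨n, rfl⟩, rfl, (eq_zero_iff_inDual hM hmem).trans ?_⟩
  constructor
  · rintro ⟨l, hl⟩
    exact ⟨l - n, by rw [mulVec_sub, ← hl, add_sub_cancel_right]⟩
  · rintro ⟨l, hl⟩
    exact ⟨l + n, by rw [mulVec_add, hl]⟩

open scoped Classical in
theorem isQuasiTightFilterBank_of_dualFreq (hM : M.det ≠ 0) {a : Mask d r r} {b : Mask d s r}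
    {ε : Fin s → ℂ} {Θ : (Fin d → ℝ) → Matrix (Fin r) (Fin r) ℂ}
    (h : ∀ k ξ, (symb a ξ)ᴴ * Θ ((realMat M)ᵀ *ᵥ ξ) * symb a (ξ + dualFreq M k)
      + (symb b ξ)ᴴ * Matrix.diagonal ε * symb b (ξ + dualFreq M k)
        = if InDual M k then Θ ξ else 0) :
    IsQuasiTightFilterBank M a b Θ ε := by
  intro ω hω ξ
  obtain ⟨k, hk, hk0⟩ := Omega.exists_dualFreq hM hω
  rw [hk, h]
  exact if_congr hk0.symm rfl rfl

end DualLattice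

/-! ### Sum rules -/

section SumRules
variable {d r s n m : ℕ} {M : Matrix (Fin d) (Fin d) ℤ}

open scoped Classical in
/-- Sum rules of order `n` for a matrix function `A` with a row vector function `G` as the matching
filter: `G(Mᵀξ) A(ξ + 2π M^{-T} k) = δ G(ξ) + O(‖ξ‖^n)` for all integer vectors `k`. -/
def SumRules (M : Matrix (Fin d) (Fin d) ℤ) (A : (Fin d → ℝ) → Matrix (Fin r) (Fin r) ℂ)
    (G : (Fin d → ℝ) → Fin r → ℂ) (n : ℕ) : Prop :=
  ∀ k, VanV n fun ξ => G ((realMat M)ᵀ *ᵥ ξ) ᵥ* A (ξ + dualFreq M k)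
    - if InDual M k then G ξ else 0

theorem hasSumRules_iff (hM : M.det ≠ 0) (a : Mask d r r) (υ : Mask d 1 r) (n : ℕ) :
    HasSumRules M a υ n ↔ symb υ 0 ≠ 0 ∧ SumRules M (symb a) (fun ξ => symb υ ξ 0) n := by
  refine and_congr_right fun _ => ⟨fun h k j => ?_, fun h ω hω j => ?_⟩
  · obtain ⟨ω, hω, l, hl, hωl, h0⟩ := exists_mem_Omega hM k
    refine Van.congr (h ω hω j) fun ξ => ?_
    rw [hωl, (trigM_symb a).dual_periodic hM ξ k hl]
    by_cases hk : InDual M k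
    · simp only [h0.2 hk, hk, if_true]; rfl
    · simp only [mt h0.1 hk, hk, if_false]; rfl
  · obtain ⟨k, hk, h0⟩ := Omega.exists_dualFreq hM hω
    refine Van.congr (h k j) fun ξ => ?_
    rw [hk]
    by_cases hk : InDual M k
    · simp only [h0.2 hk, hk, if_true]; rfl
    · simp only [mt h0.1 hk, hk, if_false]; rfl

/-- The dilated function `ξ ↦ T(Mᵀξ)` has the dual frequencies as periods. -/
theorem TrigM.dilate_add_dualFreq (hM : M.det ≠ 0) {T : (Fin d → ℝ) → Matrix (Fin r) (Fin s) ℂ}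
    (hT : TrigM T) (ξ : Fin d → ℝ) (k : Fin d → ℤ) :
    T ((realMat M)ᵀ *ᵥ (ξ + dualFreq M k)) = T ((realMat M)ᵀ *ᵥ ξ) := by
  have hM' : Mᵀ.det ≠ 0 := by rwa [det_transpose]
  have h1 : (realMat M)ᵀ *ᵥ dualFreq M k = (2 * Real.pi) • realVec k := by
    rw [dualFreq, mulVec_smul, realMat_transpose, realMat_mulVec_inv hM']
  rw [mulVec_add, h1, hT.periodic]

/-- A strongly invertible change of coordinates `T` of the refinable vector turns the sum rules of
`A` with matching filter `G` into those of `T(Mᵀ·) A T⁻¹` with any `w = G T⁻¹ + O(‖ξ‖^n)`. -/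
theorem SumRules.conjugate (hM : M.det ≠ 0) {A T T' : (Fin d → ℝ) → Matrix (Fin r) (Fin r) ℂ}
    {G w : (Fin d → ℝ) → Fin r → ℂ} (h : SumRules M A G n) (hA : TrigM A) (hT : TrigM T)
    (hT' : TrigM T') (hTT : ∀ ξ, T ξ * T' ξ = 1) (hw : VanV n fun ξ => G ξ ᵥ* T' ξ - w ξ) :
    SumRules M (fun ξ => T ((realMat M)ᵀ *ᵥ ξ) * A ξ * T' ξ) w n := by
  have hTT' : ∀ ξ, T' ξ * T ξ = 1 := fun ξ => mul_eq_one_comm.1 (hTT ξ)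
  intro k
  have h1 : VanV n fun ξ => (G ((realMat M)ᵀ *ᵥ ξ) ᵥ* T' ((realMat M)ᵀ *ᵥ ξ)
      - w ((realMat M)ᵀ *ᵥ ξ)) ᵥ*
        (T ((realMat M)ᵀ *ᵥ ξ) * A (ξ + dualFreq M k) * T' (ξ + dualFreq M k)) :=
    (hw.comp_mulVec _).vecMul
      (((hT.dilate M).mul (hA.translate _)).mul (hT'.translate _)).continuous.continuousAt
  have h2 := (h k).vecMul (hT'.translate (dualFreq M k)).continuous.continuousAt
  by_cases hk : InDual M k
  · refine ((h2.sub h1).add hw).congr fun ξ => ?_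
    have h3 : T' (ξ + dualFreq M k) = T' ξ := by
      have := hT'.dual_periodic hM ξ 0 hk
      rwa [zero_add, dualFreq_zero, add_zero] at this
    simp only [hk, if_true, hT.dilate_add_dualFreq hM, h3, sub_vecMul, vecMul_vecMul,
      ← Matrix.mul_assoc, hTT', Matrix.one_mul]
    abel
  · refine (h2.sub h1).congr fun ξ => ?_
    simp only [hk, if_false, hT.dilate_add_dualFreq hM, sub_vecMul, vecMul_vecMul,
      ← Matrix.mul_assoc, hTT', Matrix.one_mul, sub_zero]
    abel

open scoped Classical in
/-- In a quasi-tight framelet filter bank whose low-pass filter `A` reproduces `u` to order `n`,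
high-pass filters that annihilate `u` to order `n` force sum rules of order `n` on `A`. -/
theorem SumRules.of_filterBank {A : (Fin d → ℝ) → Matrix (Fin r) (Fin r) ℂ}
    {B : (Fin d → ℝ) → Matrix (Fin s) (Fin r) ℂ} {ε : Fin s → ℂ} (hA : TrigM A) (hB : TrigM B)
    (hFB : ∀ k ξ, (A ξ)ᴴ * A (ξ + dualFreq M k)
      + (B ξ)ᴴ * Matrix.diagonal ε * B (ξ + dualFreq M k)
        = if InDual M k then 1 else 0)
    {u : (Fin d → ℝ) → Fin r → ℂ} (hAu : VanV n fun ξ => A ξ *ᵥ u ξ - u ((realMat M)ᵀ *ᵥ ξ))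
    (hBu : VanV n fun ξ => B ξ *ᵥ u ξ) : SumRules M A (fun ξ => star (u ξ)) n := by
  intro k
  have h1 := hAu.star.vecMul (hA.translate (dualFreq M k)).continuous.continuousAt
  have h2 := hBu.star.vecMul
    ((TrigM.const (Matrix.diagonal ε)).mul (hB.translate (dualFreq M k))).continuous.continuousAt
  refine (VanV.sub (VanV.sub (fun _ => Van.zero) h1) h2).congr fun ξ => ?_
  have h3 : star (u ξ) ᵥ* (if InDual M k then 1 else 0 : Matrix (Fin r) (Fin r) ℂ)
      = if InDual M k then star (u ξ) else 0 := by
    split_ifs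
    · rw [vecMul_one]
    · rw [vecMul_zero]
  rw [← h3, ← hFB k ξ]
  simp only [star_sub, star_mulVec, sub_vecMul, vecMul_add, vecMul_vecMul, Matrix.mul_assoc]
  funext i
  simp only [Pi.sub_apply, Pi.add_apply]
  ring

end SumRules

/-! ### Change of coordinates to a balanced refinable vector -/

section Balancing
variable {d r m : ℕ} {N : Matrix (Fin d) (Fin d) ℤ} {κ : Fin r → Fin d → ℤ}

theorem approx_star_balVec (n : ℕ) (j : Fin r) : Approx n fun ξ => star (balVec N κ ξ) j := by
  obtain ⟨f, hf, h⟩ := approx_balVec (N := N) (κ := κ) n j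
  exact ⟨_, trig_conj hf, h.conj.congr fun ξ => by rw [map_sub]; rfl⟩

/-- A strongly invertible `θ` moves a column `F` and a row `G` with `G F = 1 + O(‖ξ‖^m)` to the
balanced vector `u = balVec N κ` and its adjoint. Both pairs have the same normal form, and `θ` is
the composition of the two changes of coordinates; the one of `u`, called `T`, is returned too. -/
theorem exists_balancing (hr : 2 ≤ r) (i₀ : Fin r) (hm : m ≠ 0) {F G : (Fin d → ℝ) → Fin r → ℂ}
    (hF : ∀ i, Approx (m + m) fun ξ => F ξ i) (hF0 : F 0 ≠ 0) (hG : ∀ i, Approx m fun ξ => G ξ i)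
    (hGF : Van m fun ξ => G ξ ⬝ᵥ F ξ - 1) :
    ∃ θ θ' T T' : (Fin d → ℝ) → Matrix (Fin r) (Fin r) ℂ, TrigM θ ∧ TrigM θ' ∧ TrigM T ∧ TrigM T' ∧
      (∀ ξ, θ ξ * θ' ξ = 1) ∧ (∀ ξ, T ξ * T' ξ = 1) ∧
      (VanV (m + m) fun ξ => T ξ *ᵥ balVec N κ ξ - Pi.single i₀ 1) ∧
      (VanV (m + m) fun ξ => θ ξ *ᵥ F ξ - balVec N κ ξ) ∧
      VanV m fun ξ => G ξ ᵥ* θ' ξ - star (balVec N κ ξ) := by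
  have hu : ∀ ξ, star (balVec N κ ξ) ⬝ᵥ balVec N κ ξ = 1 := balVec_unit (by omega)
  have hu0 : balVec N κ 0 ≠ 0 := fun h => by simpa [h] using hu 0
  obtain ⟨S, S', hS, hS', hSS, hSF, hGS⟩ :=
    exists_normal_form hr i₀ hm (Nat.le_add_right m m) hF hF0 hG hGF
  obtain ⟨T, T', hT, hT', hTT, hTu, huT⟩ :=
    exists_normal_form hr i₀ hm (Nat.le_add_right m m) (fun i => approx_balVec _ i) hu0
      (fun i => approx_star_balVec _ i) (Van.zero.congr fun ξ => by rw [hu, sub_self])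
  have hTT' : ∀ ξ, T' ξ * T ξ = 1 := fun ξ => mul_eq_one_comm.1 (hTT ξ)
  refine ⟨fun ξ => T' ξ * S ξ, fun ξ => S' ξ * T ξ, T, T', hT'.mul hS, hS'.mul hT, hT, hT',
    fun ξ => ?_, hTT, hTu, ?_, ?_⟩
  · rw [Matrix.mul_assoc, ← Matrix.mul_assoc (S ξ), hSS, Matrix.one_mul, hTT']
  · refine ((hSF.sub hTu).mulVec hT'.continuous.continuousAt).congr fun ξ => ?_
    rw [sub_sub_sub_cancel_right, mulVec_sub, mulVec_mulVec, mulVec_mulVec, hTT', one_mulVec]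
  · refine ((hGS.sub huT).vecMul hT.continuous.continuousAt).congr fun ξ => ?_
    rw [sub_sub_sub_cancel_right, sub_vecMul, vecMul_vecMul, vecMul_vecMul, hTT', vecMul_one]

end Balancing

/-! ### Largest orders -/

section Largest
variable {d r s m : ℕ} {M N : Matrix (Fin d) (Fin d) ℤ} {κ : Fin r → Fin d → ℤ}

theorem HasVanishingMoments.mono {ψ : Fin s → (Fin d → ℝ) → ℂ} {n : ℕ}
    (h : HasVanishingMoments ψ n) (hmn : m ≤ n) : HasVanishingMoments ψ m :=
  fun l p hp => h l p (hp.trans_le hmn)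

theorem HasBalancedVanishingMoments.mono {b : Mask d s r} {n : ℕ}
    (h : HasBalancedVanishingMoments M N κ b n) (hmn : m ≤ n) :
    HasBalancedVanishingMoments M N κ b m :=
  fun p ⟨P, hP, hp⟩ => h p ⟨P, hP.trans_le hmn, hp⟩

theorem isGreatest_of_not_succ {P : ℕ → Prop} (hm : P m) (h : ∀ k, m < k → P k → P (m + 1))
    (hs : ¬ P (m + 1)) : IsGreatest {k | P k} m :=
  ⟨hm, fun k hk => not_lt.1 fun hlt => hs (h k hlt hk)⟩

end Largest

end QuasiTight

theorem theorem1p1 {d r m : ℕ} (hr : 2 ≤ r) (hm : 1 ≤ m)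
    (M : Matrix (Fin d) (Fin d) ℤ) (hM : IsDilation M)
    (φ : Fin r → (Fin d → ℝ) → ℂ) (hφ : IsCompactL2 φ)
    (a : Mask d r r)
    (href : ∀ ξ, fourierVec φ ((realMat M)ᵀ *ᵥ ξ) = symb a ξ *ᵥ fourierVec φ ξ)
    (hφ0 : fourierVec φ 0 ≠ 0)
    (υ : Mask d 1 r) (hsr : HasSumRules M a υ m)
    (hυφ : symb υ 0 *ᵥ fourierVec φ 0 = 1)
    (N : Matrix (Fin d) (Fin d) ℤ) (hN : |N.det| = (r : ℤ))
    (κ : Fin r → Fin d → ℤ) (hκ : IsCosetReps N κ) :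
    ∃ (s : ℕ) (b : Mask d s r) (θ : Mask d r r) (ε : Fin s → ℂ)
      (φO : Fin r → (Fin d → ℝ) → ℂ) (ψ : Fin s → (Fin d → ℝ) → ℂ)
      (aO : Mask d r r) (bO : Mask d s r),
      (∀ l, ε l = 1 ∨ ε l = -1) ∧
      -- the derived functions and filters
      (∀ ξ, fourierVec φO ξ = symb θ ξ *ᵥ fourierVec φ ξ) ∧
      (∀ ξ, fourierVec ψ ξ =
        symb b (((realMat M)ᵀ)⁻¹ *ᵥ ξ) *ᵥ fourierVec φ (((realMat M)ᵀ)⁻¹ *ᵥ ξ)) ∧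
      (∀ ξ, symb aO ξ = symb θ ((realMat M)ᵀ *ᵥ ξ) * symb a ξ * (symb θ ξ)⁻¹) ∧
      (∀ ξ, symb bO ξ = symb b ξ * (symb θ ξ)⁻¹) ∧
      -- (1) the quasi-tight framelet, its vanishing moments and its refinable structure
      IsCompactL2 φO ∧ IsCompactL2 ψ ∧
      star (fourierVec φ 0) ⬝ᵥ (((symb θ 0)ᴴ * symb θ 0) *ᵥ fourierVec φ 0) = 1 ∧
      IsQuasiTightFramelet M φO ψ ε ∧
      HasVanishingMoments ψ m ∧
      (∀ ξ, fourierVec φO ((realMat M)ᵀ *ᵥ ξ) = symb aO ξ *ᵥ fourierVec φO ξ) ∧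
      (∀ ξ, fourierVec ψ ((realMat M)ᵀ *ᵥ ξ) = symb bO ξ *ᵥ fourierVec φO ξ) ∧
      -- (2) strong invertibility
      StronglyInvertible θ ∧
      -- (3) the two quasi-tight framelet filter banks
      IsQuasiTightFilterBank M a b (fun ξ => (symb θ ξ)ᴴ * symb θ ξ) ε ∧
      IsQuasiTightFilterBank M aO bO (fun _ => 1) ε ∧
      -- (4) the discrete multiframelet transform
      IsCompactTransform M aO bO ε ∧
      IsBalanced M N κ aO bO m ∧
      (IsGreatest {k | ∃ υ' : Mask d 1 r, HasSumRules M a υ' k} m →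
        IsGreatest {k | HasVanishingMoments ψ k} m ∧
        IsGreatest {k | HasBalancedVanishingMoments M N κ bO k} m ∧
        IsGreatest {k | IsBalanced M N κ aO bO k} m) := by
  classical
  have hdet := hM.det_ne_zero
  have hdet' : (realMat M)ᵀ.det ≠ 0 := by
    rw [det_transpose]; exact (realMat_isUnit_det hdet).ne_zero
  have hr0 : r ≠ 0 := by omega
  have hm0 : m ≠ 0 := by omega
  have hNdet : N.det ≠ 0 := fun h => by rw [h, abs_zero] at hN; omega
  have hforth : ∀ ξ, ((realMat M)ᵀ)⁻¹ *ᵥ ((realMat M)ᵀ *ᵥ ξ) = ξ := fun ξ => by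
    rw [mulVec_mulVec, Matrix.nonsing_inv_mul _ (isUnit_iff_ne_zero.2 hdet'), one_mulVec]
  have hφi : ∀ l, Integrable (φ l) := fun l => integrable_of_memLp_two (hφ l).1 (hφ l).2
  set F := fourierVec φ with hFdef
  have hF : ∀ n l, Approx n fun ξ => F ξ l := approx_fourierVec hφ
  have hFc : ContinuousAt F 0 := continuousAt_pi.2 fun l => (hF 1 l).continuousAt one_ne_zero
  set G : (Fin d → ℝ) → Fin r → ℂ := fun ξ => symb υ ξ 0 with hGdef
  have hG : ∀ n j, Approx n fun ξ => G ξ j := fun n j => Approx.of_trig (trigM_symb υ 0 j)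
  have hGc : ContinuousAt G 0 := continuousAt_pi.2 fun l => (hG 1 l).continuousAt one_ne_zero
  have hSR : SumRules M (symb a) G m := ((hasSumRules_iff hdet a υ m).1 hsr).2
  have hGF0 : G 0 ⬝ᵥ F 0 = 1 := by simpa [G, mulVec] using congrFun hυφ 0
  -- `υ̂ φ̂` is invariant under dilation to order `m`, hence constant to that order
  have hGF : Van m fun ξ => G ξ ⬝ᵥ F ξ - 1 := by
    have hc : ContinuousAt (fun ξ => G ξ ⬝ᵥ F ξ) 0 := by
      unfold dotProduct
      exact tendsto_finsetSum Finset.univ fun j _ =>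
        ((continuous_apply j).continuousAt.comp hGc).mul
          ((continuous_apply j).continuousAt.comp hFc)
    have h1 := van_sub_of_scaling hM hm0 hc (((hSR 0).dotProduct hFc).congr fun ξ => by
      rw [dualFreq_zero, add_zero, if_pos inDual_zero, href, sub_dotProduct, dotProduct_mulVec])
    exact h1.congr fun ξ => by rw [hGF0]
  obtain ⟨θ, θ', T, T', hθ, hθ', hT, hT', hθθ, hTT, hTu, hθF, hGθ⟩ :=
    exists_balancing (N := N) (κ := κ) hr ⟨0, by omega⟩ hm0 (hF (m + m)) hφ0 (hG m) hGF
  set u : (Fin d → ℝ) → Fin r → ℂ := balVec N κ with hudef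
  have hu : ∀ ξ, star (u ξ) ⬝ᵥ u ξ = 1 := balVec_unit hr0
  have hθθ' : ∀ ξ, θ' ξ * θ ξ = 1 := fun ξ => mul_eq_one_comm.1 (hθθ ξ)
  obtain ⟨aO, haO⟩ := exists_mask (((hθ.dilate M).mul (trigM_symb a)).mul hθ')
  have hsr' : SumRules M (symb aO) (fun ξ => star (u ξ)) m := by
    rw [funext haO]
    exact hSR.conjugate hdet (trigM_symb a) hθ hθ' hθθ hGθ
  have haW : ∀ ξ, symb aO ξ *ᵥ (θ ξ *ᵥ F ξ)
      = θ ((realMat M)ᵀ *ᵥ ξ) *ᵥ F ((realMat M)ᵀ *ᵥ ξ) := fun ξ => by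
    rw [haO, mulVec_mulVec, Matrix.mul_assoc, hθθ', Matrix.mul_one, ← mulVec_mulVec, href]
  have hau : VanV (m + m) fun ξ => symb aO ξ *ᵥ u ξ - u ((realMat M)ᵀ *ᵥ ξ) := by
    refine ((hθF.comp_mulVec (realMat M)ᵀ).sub
      (hθF.mulVec (trigM_symb aO).continuous.continuousAt)).congr fun ξ => ?_
    rw [mulVec_sub, haW]; abel
  obtain ⟨s, B, ε, hB, hε, hBu, hFB⟩ :=
    exists_factorization hdet (trigM_symb aO) hT hT' hTT continuous_balVec hu hTu hau hsr'
  obtain ⟨bO, hbO⟩ := exists_mask hB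
  obtain ⟨b, hb⟩ := exists_mask (hB.mul hθ)
  obtain ⟨θm, hθm⟩ := exists_mask hθ
  obtain ⟨θm', hθm'⟩ := exists_mask hθ'
  obtain rfl : symb bO = B := funext hbO
  obtain rfl : symb θm = θ := funext hθm
  have hinv : ∀ ξ, (symb θm ξ)⁻¹ = θ' ξ := fun ξ => Matrix.inv_eq_right_inv (hθθ ξ)
  set φO := maskSum θm φ with hφOdef
  set ψ := refined M bO φO with hψdef
  have hφO : ∀ ξ, fourierVec φO ξ = symb θm ξ *ᵥ F ξ := fourierVec_maskSum θm hφi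
  have hφOL : ∀ l, MemLp (φO l) 2 volume := memLp_maskSum θm fun l => (hφ l).1
  obtain ⟨R₀, hR₀⟩ : ∃ R, ∀ l, SuppIn R (φ l) := by
    choose R hR using fun l => exists_suppIn (hφ l).2
    exact ⟨∑ l, R l, fun l => (hR l).2.mono
      (Finset.single_le_sum (fun i _ => (hR i).1) (Finset.mem_univ l))⟩
  obtain ⟨R₁, hR₁⟩ := exists_suppIn_maskSum θm hR₀
  obtain ⟨R₂, hR₂⟩ := exists_suppIn_refined hdet bO hR₁
  have hφOC : IsCompactL2 φO := fun l => ⟨hφOL l, (hR₁ l).hasCompactSupport⟩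
  have hψC : IsCompactL2 ψ := fun l => ⟨memLp_refined hdet hφOL l, (hR₂ l).hasCompactSupport⟩
  have hφOi : ∀ l, Integrable (φO l) := fun l => integrable_of_memLp_two (hφOL l) (hφOC l).2
  have hψF : ∀ ξ, fourierVec ψ ξ = symb bO (((realMat M)ᵀ)⁻¹ *ᵥ ξ) *ᵥ
      (symb θm (((realMat M)ᵀ)⁻¹ *ᵥ ξ) *ᵥ F (((realMat M)ᵀ)⁻¹ *ᵥ ξ)) := fun ξ => by
    rw [← hφO]; exact fourierVec_refined hdet bO hφOi ξ
  have hφOref : ∀ ξ, fourierVec φO ((realMat M)ᵀ *ᵥ ξ) = symb aO ξ *ᵥ fourierVec φO ξ :=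
    fun ξ => by rw [hφO, hφO, haW]
  have hφO0 : fourierVec φO 0 = u 0 := by
    rw [hφO]
    exact funext fun i => sub_eq_zero.1 ((hθF i).eval_zero (by omega))
  -- vanishing moments of `ψ` and balanced vanishing moments of `bO` are the same condition
  have hψvan : ∀ n ≤ m + m, HasVanishingMoments ψ n ↔ VanV n fun ξ => symb bO ξ *ᵥ u ξ := by
    intro n hn
    have h1 : VanV n fun ξ => symb bO ξ *ᵥ (symb θm ξ *ᵥ F ξ - u ξ) :=
      (hθF.mono hn).mulVec (trigM_symb bO).continuous.continuousAt
    rw [hasVanishingMoments_iff hψC]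
    constructor
    · intro h
      refine ((h.comp_mulVec (realMat M)ᵀ).sub h1).congr fun ξ => ?_
      rw [hψF, hforth, mulVec_sub, sub_sub_cancel]
    · intro h
      refine ((h.add h1).comp_mulVec ((realMat M)ᵀ)⁻¹).congr fun ξ => ?_
      rw [hψF, mulVec_sub, add_sub_cancel]
  have hbal : ∀ n, HasBalancedVanishingMoments M N κ bO n ↔ VanV n fun ξ => symb bO ξ *ᵥ u ξ :=
    hasBalancedVanishingMoments_iff hr0 hdet hNdet bO
  have hψm : HasVanishingMoments ψ m := (hψvan m (Nat.le_add_right m m)).2 hBu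
  have hbm : IsBalanced M N κ aO bO m :=
    ⟨fun p hp => transition_balanced hr0 hNdet aO (hau.mono (Nat.le_add_right m m)) hp,
      (hbal m).2 hBu⟩
  -- a higher order would, through the filter bank, give `a` sum rules of order `m + 1`
  have hmax : IsGreatest {k | ∃ υ' : Mask d 1 r, HasSumRules M a υ' k} m →
      ¬ VanV (m + 1) fun ξ => symb bO ξ *ᵥ u ξ := by
    intro hgr hv
    have h1 : SumRules M (symb aO) (fun ξ => star (u ξ)) (m + 1) :=
      SumRules.of_filterBank (trigM_symb aO) (trigM_symb bO) hFB (hau.mono (by omega)) hv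
    choose w hw hwu using fun j => approx_star_balVec (N := N) (κ := κ) (m + 1) j
    obtain ⟨υ', hυ'⟩ := exists_mask (F := fun ξ => Matrix.of fun _ : Fin 1 =>
      (fun j => w j ξ) ᵥ* symb θm ξ) fun _ => (trigM_symb θm).vecMul hw
    have hwv : VanV (m + 1) fun ξ => star (u ξ) - fun j => w j ξ := hwu
    have h2 : VanV (m + 1) fun ξ => star (u ξ) ᵥ* symb θm ξ - symb υ' ξ 0 :=
      (hwv.vecMul (trigM_symb θm).continuous.continuousAt).congr fun ξ => by
        rw [hυ', sub_vecMul]; rfl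
    have h3 := h1.conjugate hdet (trigM_symb aO) hθ' hθ hθθ' h2
    have h4 : (fun ξ => θ' ((realMat M)ᵀ *ᵥ ξ) * symb aO ξ * symb θm ξ) = symb a :=
      funext fun ξ => by
        rw [haO, Matrix.mul_assoc, Matrix.mul_assoc _ (θ' ξ), hθθ', Matrix.mul_one,
          ← Matrix.mul_assoc, hθθ', Matrix.one_mul]
    rw [h4] at h3
    refine absurd (hgr.2 ⟨υ', (hasSumRules_iff hdet a υ' (m + 1)).2 ⟨fun h0 => ?_, h3⟩⟩)
      (by omega)
    have h5 : star (u 0) ᵥ* symb θm 0 = 0 := funext fun j => by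
      have : (star (u 0) ᵥ* symb θm 0 - symb υ' 0 0) j = 0 := (h2 j).eval_zero (by omega)
      rw [h0] at this
      simpa using this
    have h6 : star (u 0) = 0 := by
      rw [← vecMul_one (star (u 0)), ← hθθ 0, ← vecMul_vecMul, h5, zero_vecMul]
    simpa [h6] using hu 0
  refine ⟨s, b, θm, ε, φO, ψ, aO, bO, hε, hφO, ?_, ?_, ?_, hφOC, hψC, ?_, ?_, hψm, hφOref, ?_,
    ⟨θm', fun ξ => by rw [hθm', hθθ]⟩, ?_, ?_, isCompactTransform_of_filterBank hdet hFB, hbm, ?_⟩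
  · intro ξ
    rw [hψF, hb, mulVec_mulVec]
  · intro ξ
    rw [haO, hinv]
  · intro ξ
    rw [hb, hinv, Matrix.mul_assoc, hθθ, Matrix.mul_one]
  · have h1 := hu 0
    rw [← hφO0, hφO, star_mulVec, ← dotProduct_mulVec, mulVec_mulVec] at h1
    exact h1
  · refine isQuasiTightFramelet (R := max R₁ R₂) hM hε hFB hφOL
      (fun l => (hR₁ l).mono (le_max_left _ _)) (ae_eq_refined hdet hφOi hφOref)
      (fun l => (hR₂ l).mono (le_max_right _ _)) (fun l => ?_) ?_
    · rw [← ft_zero]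
      exact (((hasVanishingMoments_iff hψC m).1 hψm) l).eval_zero hm0
    · have h1 : ∀ l, ∫ x, φO l x = u 0 l := fun l => by
        rw [← ft_zero]; exact congrFun hφO0 l
      have h2 : ((∑ l, ‖u 0 l‖ ^ 2 : ℝ) : ℂ) = 1 := by
        rw [← hu 0, dotProduct, ofReal_sum]
        exact Finset.sum_congr rfl fun l _ => by
          rw [Pi.star_apply, RCLike.star_def, Complex.conj_mul', ofReal_pow]
      simp only [h1]
      exact_mod_cast h2
  · intro ξ
    rw [hψF, hforth, hφO]
  · -- conjugate the identity for `aO`, `bO` by `θ`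
    refine isQuasiTightFilterBank_of_dualFreq hdet fun k ξ => ?_
    have hθa : ∀ ζ, symb aO ζ * symb θm ζ = symb θm ((realMat M)ᵀ *ᵥ ζ) * symb a ζ := fun ζ => by
      rw [haO, Matrix.mul_assoc, hθθ', Matrix.mul_one]
    have hθb : ∀ ζ, symb b ζ = symb bO ζ * symb θm ζ := hb
    have hl : (symb a ξ)ᴴ * ((symb θm ((realMat M)ᵀ *ᵥ ξ))ᴴ * symb θm ((realMat M)ᵀ *ᵥ ξ))
          * symb a (ξ + dualFreq M k)
        + (symb b ξ)ᴴ * Matrix.diagonal ε * symb b (ξ + dualFreq M k)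
        = (symb θm ξ)ᴴ * ((symb aO ξ)ᴴ * symb aO (ξ + dualFreq M k)
          + (symb bO ξ)ᴴ * Matrix.diagonal ε * symb bO (ξ + dualFreq M k))
            * symb θm (ξ + dualFreq M k) := by
      have h3 : (symb θm ξ)ᴴ * (symb aO ξ)ᴴ
          = (symb a ξ)ᴴ * (symb θm ((realMat M)ᵀ *ᵥ ξ))ᴴ := by
        rw [← conjTranspose_mul, hθa, conjTranspose_mul]
      have h4 := hθa (ξ + dualFreq M k)
      rw [(trigM_symb θm).dilate_add_dualFreq hdet] at h4
      rw [Matrix.mul_add, Matrix.add_mul, hθb, hθb, conjTranspose_mul]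
      simp only [← Matrix.mul_assoc, h3]
      simp only [Matrix.mul_assoc, h4]
    rw [hl, hFB]
    by_cases hk : InDual M k
    · have h3 := (trigM_symb θm).dual_periodic hdet ξ 0 hk
      rw [zero_add, dualFreq_zero, add_zero] at h3
      simp only [hk, if_true, h3, Matrix.mul_one]
    · simp only [hk, if_false, Matrix.mul_zero, Matrix.zero_mul]
  · refine isQuasiTightFilterBank_of_dualFreq hdet fun k ξ => ?_
    rw [Matrix.mul_one]
    exact hFB k ξ
  · intro hgr
    have hno := hmax hgr
    refine ⟨isGreatest_of_not_succ hψm (fun k hk h => h.mono hk) fun h => hno ?_,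
      isGreatest_of_not_succ hbm.2 (fun k hk h => h.mono hk) fun h => hno ((hbal _).1 h),
      hbm, fun k hk => not_lt.1 fun hlt => hno ((hbal _).1 (hk.2.mono hlt))⟩
    exact (hψvan _ (by omega)).1 h
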